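/- **Setting (Problem P2).** Let $H\in\{0,1\}$ be a random hypothesis with arbitrary prior. Two observers O1, O2 take measurements $Y^1_t,Y^2_t$ ($t=1,2,\dots$) in measurable spaces. Given $H$, the measurements of each observer are independent over time with given laws $P^i_t(\cdot\mid H)$, and the two measurement sequences are independent of each other. Let $1\le T^1\le T^2$ be the horizons, $c^1\in\mathbb R$ and $c^2\ge 0$ the costs per measurement, and $J(u,h)$ the cost of deciding $u$ when $H=h$, with $J(0,0)\le J(1,0)$ and $J(1,1)\le J(0,1)$. Put $\pi^1_t=P(H=0\mid Y^1_{1:t})$. As long as it has sent only blanks $b$, O1 uses at $t<T^1$ thresholds $0\le\alpha^1_t\le\beta^1_t\le\delta^1_t\le\theta^1_t\le1$: it sends $1$ if $\pi^1_t\in[\alpha^1_t,\beta^1_t]$, otherwise $0$ if $\pi^1_t\in[\delta^1_t,\theta^1_t]$, otherwise a blank. At $T^1$ it uses one threshold: it sends $1$ if $\pi^1_{T^1}\le\alpha^1_{T^1}$, else $0$. Call $Z^1_t$ its message at $t$ and $\tau^1$ the first time that the message is not blank; nothing is sent afterwards. O2 compares $P(H=0\mid Y^2_{1:t},Z^1_{1:t})$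 with two thresholds $0\le\alpha\le\beta\le1$, which may depend on $t$ and on the messages $Z^1_{1:t}$: it stops with decision $1$ on $[0,\alpha]$, stops with decision $0$ on $[\beta,1]$ (ties are decided as $1$), and continues in between; at $T^2$ it must stop, and decides $1$ exactly on $[0,\alpha]$. Call $(\alpha^2_t,\beta^2_t)$, $t<T^1$, the thresholds of O2 used when only blanks have been received up to $t$, $\tau^2$ the stopping time of O2 (which may precede $\tau^1$), and $\pi^2_t$ the belief $P(H=0\mid Y^2_{1:t},Z^1_{1:t})$ of O2, kept constant from $\tau^2$ on. The objective, to be minimized over all these thresholds jointly, is $E[c^1\tau^1+c^2\tau^2+J(U_{\tau^2},H)]$, where $U_{\tau^2}$ is the decision of O2. Let $K^{n}_t(\pi)$ be the optimal cost of the Wald problem of horizon $n$ that starts from belief $\pi$ on $\{H=0\}$ and uses O2's measurements at times $t+1,\dots,t+n$ (it depends on $n,\pi$ only if $P^2_t$ does not depend on $t$), defined by Bellman's recursion $K^0_t(\pi)=\min_u s_u(\pi)$, $K^{n+1}_t(\pi)=\min\{\min_u s_u(\pi),\ c^2+E_\pi[K^{n}_{t+1}(\pi')]\}$, where $s_u(\pi)=\pi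 J(u,0)+(1-\pi)J(u,1)$ and $\pi'$ is the Bayes update of $\pi$ with the measurement at $t+1$. Thresholds are called Wald thresholds for horizon $n$ at time $t$ if their decision attains $K^n_t(\pi)$ at every $\pi\in[0,1]$. Put $D_t=\mathbb 1_{\{\tau^2\ge t\}}$ and $$\psi_t=P(H,\pi^1_t,\pi^2_{t-1},D_t\mid Z^1_{1:t-1}=b_{1:t-1}),\qquad \phi_t[z]=P(H,\pi^1_t,\pi^2_t,D_t\mid Z^1_{1:t-1}=b_{1:t-1},Z^1_t=z),\quad z\in\{0,1,b\},$$ understood as the zero measure if the conditioning event is null. **Theorem.** There exist transformations $Q^1_t$ ($t\le T^1$), $Q^2_t$ ($t<T^1$) and functions $\mathcal F_t,\mathcal F^*_t$ ($t\le T^1$), $\mathcal G_t,\mathcal G^*_t$ ($t<T^1$), none of them depending on the design, such that, with $\gamma^1_t$ denoting the threshold(s) of O1 at $t$ and $\gamma^2_t=(\alpha^2_t,\beta^2_t)$: 1. For all finite measures $\psi,\phi$ on $\{0,1\}\times[0,1]^2\times\{0,1\}$: $\mathcal F^*_t(\psi)=\inf_{\alpha^1_t,\beta^1_t,\delta^1_t,\theta^1_t}\mathcal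 F_t(\psi,\alpha^1_t,\beta^1_t,\delta^1_t,\theta^1_t)$ and $\mathcal G^*_t(\phi)=\inf_{\alpha^2_t,\beta^2_t}\mathcal G_t(\phi,\alpha^2_t,\beta^2_t)$ for $1\le t<T^1$, and $\mathcal F^*_{T^1}(\psi)=\inf_{\alpha^1_{T^1}}\mathcal F_{T^1}(\psi,\alpha^1_{T^1})$. 2. They satisfy the backward recursion $$\mathcal F_{T^1}(\psi,\gamma^1)=\sum_{z\in\{0,1\}}\psi(Z=z)\int \mathbb 1_{\{D=1\}}K^{T^2-T^1}_{T^1}(\pi^2)\,dQ^1_{T^1}(\psi,\gamma^1,z),$$ $$\mathcal G_t(\phi,\gamma^2)=\int \mathbb 1_{\{D=1\}}\,\ell(\pi^2,H)\,d\phi+\mathcal F^*_{t+1}(Q^2_t(\phi,\gamma^2)),$$ $$\mathcal F_t(\psi,\gamma^1)=\sum_{z\in\{0,1\}}\psi(Z=z)\int \mathbb 1_{\{D=1\}}K^{T^2-t}_t(\pi^2)\,dQ^1_t(\psi,\gamma^1,z)+\psi(Z=b)\bigl(c^1+\mathcal G^*_t(Q^1_t(\psi,\gamma^1,b))\bigr)\quad(t<T^1),$$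 where $\psi(Z=z)$ is the $\psi$-mass of the beliefs $\pi^1$ at which $\gamma^1$ sends $z$, and $\ell(\pi^2,H)=J(u,H)$ if $\gamma^2$ stops with decision $u$ at $\pi^2$ and $\ell=c^2$ if it continues. 3. $\psi_1$ does not depend on the design, and for every design $\phi_t[z]=Q^1_t(\psi_t,\gamma^1_t,z)$ ($t\le T^1$, $z\in\{0,1,b\}$) and $\psi_{t+1}=Q^2_t(\phi_t[b],\gamma^2_t)$ ($t<T^1$). 4. Optimal costs-to-go: for every design, $\mathcal F^*_t(\psi_t)$ ($1\le t\le T^1$) is the infimum, over all designs that have the same thresholds $\gamma^1_s,\gamma^2_s$ for $s<t$, of $E[c^1(\tau^1-t)+D_t(c^2(\tau^2-t)+J(U_{\tau^2},H))\mid Z^1_{1:t-1}=b_{1:t-1}]$; and $\mathcal G^*_t(\phi_t[b])$ ($1\le t<T^1$) is the infimum, over all designs with the same $\gamma^1_s$ for $s\le t$ and the same $\gamma^2_s$ for $s<t$, of $E[c^1(\tau^1-t-1)+D_t(c^2(\tau^2-t)+J(U_{\tau^2},H))\mid Z^1_{1:t}=b_{1:t}]$ (conditional expectations given null events are read as $0$).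 The total cost $c^1\tau^1+c^2\tau^2+J(U_{\tau^2},H)$ is integrable for every design, and the infimum of the objective over all designs is $c^1+c^2+\mathcal F^*_1(\psi_1)$. 5. Wald thresholds exist for every horizon and time. Replacing, in any design, the thresholds used by O2 from the time $t$ of a final message $0$ or $1$ onwards by Wald thresholds for the remaining horizons (starting with $T^2-t$) does not increase the objective. 6. A design that uses Wald thresholds after a final message is globally optimal if and only if, successively for $t=1,2,\dots$, its thresholds for O1 at $t$ attain the infimum defining $\mathcal F^*_t(\psi_t)$ $(t\le T^1)$ and its thresholds for O2 at $t$ attain the infimum defining $\mathcal G^*_t(\phi_t[b])$ $(t<T^1)$, where $\psi_t$ and $\phi_t[b]$ are determined by the previously chosen thresholds through the transformations in 3. -/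

import Mathlib

open MeasureTheory ProbabilityTheory

noncomputable section

namespace SeqDet

/-- The unit interval, in which beliefs on the event `H = 0` take their values. -/
abbrev Belief : Type := unitInterval

/-- Messages of O1 and decisions of O2.  `some u` is the final message or decision `u ∈ {0, 1}`;
`none` is the blank message `b` of O1, or the decision `N` of O2 to continue. -/
abbrev Symb : Type := Option (Fin 2)

/-- Joint laws of `(H, π¹, π², D)` on `{0,1} × [0,1] × [0,1] × {false,true}`. -/
abbrev InfoState : Type := Measure (Fin 2 × Belief × Belief × Bool)

/-- The four thresholds of O1 at one time before its horizon. -/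
structure FourThr where
  α : ℝ
  β : ℝ
  δ : ℝ
  θ : ℝ
  zero_le : 0 ≤ α
  le_αβ : α ≤ β
  le_βδ : β ≤ δ
  le_δθ : δ ≤ θ
  le_one : θ ≤ 1

/-- The two thresholds of O2 at one time. -/
structure TwoThr where
  α : ℝ
  β : ℝ
  zero_le : 0 ≤ α
  le_αβ : α ≤ β
  le_one : β ≤ 1

/-- O1's rule before its horizon: send `1` on `[α, β]`, send `0` on `[δ, θ]`, and a blank on
`[0, α) ∪ (β, δ) ∪ (θ, 1]`. -/
def rule1 (g : FourThr) (p : Belief) : Symb :=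
  if g.α ≤ (p : ℝ) ∧ (p : ℝ) ≤ g.β then some 1
  else if g.δ ≤ (p : ℝ) ∧ (p : ℝ) ≤ g.θ then some 0
  else none

/-- O1's rule at its horizon: send `1` if the belief is at most the threshold, else `0`. -/
def rule1Last (a : Belief) (p : Belief) : Fin 2 := if p ≤ a then 1 else 0

/-- O2's rule: decide `1` on `[0, α]`, decide `0` on `[β, 1]`, continue in between; when `last`
holds, O2 may not continue and decides `0` above `α`. -/
def rule2 (last : Prop) [Decidable last] (g : TwoThr) (p : Belief) : Symb :=
  if (p : ℝ) ≤ g.α then some 1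
  else if last ∨ g.β ≤ (p : ℝ) then some 0
  else none

/-- Conditional probability of the event `A` given `m`.  A version of it has values in `[0, 1]`, so
that the projection changes it on a null set only. -/
def posterior {Ω : Type*} {m₀ : MeasurableSpace Ω} (μ : Measure[m₀] Ω) (A : Set Ω)
    (m : MeasurableSpace Ω) (ω : Ω) : Belief :=
  Set.projIcc 0 1 zero_le_one (condExp m μ (A.indicator (fun _ => (1 : ℝ))) ω)

/-- The data and probabilistic assumptions of Problem P2.  Times are `1, 2, …`; index `0` of the
observation sequences is never used. -/
structure Model (Ω 𝒴₁ 𝒴₂ : Type*) [MeasurableSpace Ω] [MeasurableSpace 𝒴₁]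
    [MeasurableSpace 𝒴₂] where
  /-- the underlying probability -/
  μ : Measure Ω
  prob : IsProbabilityMeasure μ
  /-- the hypothesis -/
  H : Ω → Fin 2
  /-- observations of O1 and O2 -/
  Y₁ : ℕ → Ω → 𝒴₁
  Y₂ : ℕ → Ω → 𝒴₂
  /-- `P₁ t h`, `P₂ t h` are the laws of the observations at time `t` given `H = h` -/
  P₁ : ℕ → Fin 2 → Measure 𝒴₁
  P₂ : ℕ → Fin 2 → Measure 𝒴₂
  prob₁ : ∀ t h, IsProbabilityMeasure (P₁ t h)
  prob₂ : ∀ t h, IsProbabilityMeasure (P₂ t h)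
  meas_H : Measurable H
  meas_Y₁ : ∀ t, Measurable (Y₁ t)
  meas_Y₂ : ∀ t, Measurable (Y₂ t)
  law₁ : ∀ t h, μ (H ⁻¹' {h}) ≠ 0 → (μ[|H ⁻¹' {h}]).map (Y₁ t) = P₁ t h
  law₂ : ∀ t h, μ (H ⁻¹' {h}) ≠ 0 → (μ[|H ⁻¹' {h}]).map (Y₂ t) = P₂ t h
  /-- given `H`, the observations of each observer are independent over time -/
  indep₁ : ∀ h, μ (H ⁻¹' {h}) ≠ 0 → iIndepFun Y₁ μ[|H ⁻¹' {h}]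
  indep₂ : ∀ h, μ (H ⁻¹' {h}) ≠ 0 → iIndepFun Y₂ μ[|H ⁻¹' {h}]
  /-- given `H`, the observation sequences of the two observers are independent -/
  indep₁₂ : ∀ h, μ (H ⁻¹' {h}) ≠ 0 →
    IndepFun (fun ω t => Y₁ t ω) (fun ω t => Y₂ t ω) μ[|H ⁻¹' {h}]
  /-- horizons of O1 and O2 -/
  T₁ : ℕ
  T₂ : ℕ
  /-- costs of one measurement of O1 and of O2 -/
  c₁ : ℝ
  c₂ : ℝ
  /-- `J u h` is the cost of the final decision `u` when `H = h` -/
  J : Fin 2 → Fin 2 → ℝ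

/-- A joint threshold design: O1's four thresholds at `t < T₁`, O1's single threshold at `T₁`,
O2's two thresholds `o2 t` at `t < T₁` when only blanks were received up to `t`, and O2's two
thresholds `post s z t` at `t ≥ s` when the final message was `z`, received at time `s`. -/
structure Design where
  o1 : ℕ → FourThr
  o1Last : Belief
  o2 : ℕ → TwoThr
  post : ℕ → Fin 2 → ℕ → TwoThr

namespace Model

variable {Ω 𝒴₁ 𝒴₂ : Type*} [MeasurableSpace Ω] [MeasurableSpace 𝒴₁] [MeasurableSpace 𝒴₂]
variable (M : Model Ω 𝒴₁ 𝒴₂)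

/-! ### The finite-horizon Wald problem of O2 -/

/-- Expected cost of deciding `u` with belief `p` on `H = 0`. -/
def stopCost (u : Fin 2) (p : Belief) : ℝ := (p : ℝ) * M.J u 0 + (1 - (p : ℝ)) * M.J u 1

/-- Likelihood of the observation `y` of O2 at time `t` under `H = h`, that is, the density of
`P₂ t h` with respect to the dominating measure `P₂ t 0 + P₂ t 1`. -/
def lik (t : ℕ) (h : Fin 2) (y : 𝒴₂) : ℝ :=
  ((M.P₂ t h).rnDeriv (M.P₂ t 0 + M.P₂ t 1) y).toReal

/-- Bayes update of the belief `p` with the observation `y` of O2 at time `t`.  The quotient lies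
in `[0, 1]`, so that the projection does not change it. -/
def bayes (t : ℕ) (p : Belief) (y : 𝒴₂) : Belief :=
  Set.projIcc 0 1 zero_le_one
    ((p : ℝ) * M.lik t 0 y / ((p : ℝ) * M.lik t 0 y + (1 - (p : ℝ)) * M.lik t 1 y))

/-- Cost of one more measurement, at time `t + 1`, from the belief `p` at time `t`, followed by a
cost `V` of the updated belief. -/
def contCost (t : ℕ) (V : Belief → ℝ) (p : Belief) : ℝ :=
  M.c₂ + ((p : ℝ) * ∫ y, V (M.bayes (t + 1) p y) ∂(M.P₂ (t + 1) 0)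
    + (1 - (p : ℝ)) * ∫ y, V (M.bayes (t + 1) p y) ∂(M.P₂ (t + 1) 1))

/-- Optimal cost `K^n` of the Wald problem of horizon `n` that starts from the belief `p` at time
`t`; the measurements still available are those at the times `t + 1, …, t + n`. -/
def waldCost : ℕ → ℕ → Belief → ℝ
  | 0, _, p => min (M.stopCost 0 p) (M.stopCost 1 p)
  | n + 1, t, p =>
      min (min (M.stopCost 0 p) (M.stopCost 1 p)) (M.contCost t (waldCost n (t + 1)) p)

/-- `g` is a pair of Wald thresholds for the horizon `n` at time `t`: at every belief, its decision
attains the optimal cost of the Wald problem. -/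
def IsWaldThr (n t : ℕ) (g : TwoThr) : Prop :=
  ∀ p : Belief,
    (match rule2 (n = 0) g p with
      | some u => M.stopCost u p
      | none => M.contCost t (M.waldCost (n - 1) (t + 1)) p) = M.waldCost n t p

/-! ### The processes generated by a design -/

/-- `π¹_t = P(H = 0 | Y¹_{1:t})`. -/
def belief₁ (t : ℕ) : Ω → Belief :=
  posterior M.μ (M.H ⁻¹' {0}) (⨆ s ∈ Finset.Icc 1 t, MeasurableSpace.comap (M.Y₁ s) inferInstance)

/-- What the rule of O1 prescribes at time `t`, provided that no final message was sent before. -/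
def rawMsg (d : Design) (t : ℕ) (ω : Ω) : Symb :=
  if t < M.T₁ then rule1 (d.o1 t) (M.belief₁ t ω) else some (rule1Last d.o1Last (M.belief₁ t ω))

/-- `τ¹`, the time of the final message of O1. -/
def τ₁ (d : Design) (ω : Ω) : ℕ := sInf {t | 1 ≤ t ∧ M.rawMsg d t ω ≠ none}

/-- `Z¹_t`, the message of O1 at time `t`; there is no message after the final one. -/
def Z (d : Design) (t : ℕ) (ω : Ω) : Symb := if t ≤ M.τ₁ d ω then M.rawMsg d t ω else none

/-- `P(H = 0 | Y²_{1:t}, Z¹_{1:t})`. -/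
def rawBelief₂ (d : Design) (t : ℕ) : Ω → Belief :=
  posterior M.μ (M.H ⁻¹' {0}) (⨆ s ∈ Finset.Icc 1 t,
    MeasurableSpace.comap (M.Y₂ s) inferInstance ⊔ MeasurableSpace.comap (M.Z d s) ⊤)

/-- The thresholds that O2 uses at time `t`. -/
def thr₂ (d : Design) (t : ℕ) (ω : Ω) : TwoThr :=
  if M.τ₁ d ω ≤ t then d.post (M.τ₁ d ω) ((M.Z d (M.τ₁ d ω) ω).getD 0) t else d.o2 t

/-- `U²_t`, the decision of O2 at time `t`, provided that it has not stopped before. -/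
def U (d : Design) (t : ℕ) (ω : Ω) : Symb :=
  rule2 (t = M.T₂) (M.thr₂ d t ω) (M.rawBelief₂ d t ω)

/-- `τ²`, the time of the final decision of O2. -/
def τ₂ (d : Design) (ω : Ω) : ℕ := sInf {t | 1 ≤ t ∧ M.U d t ω ≠ none}

/-- The final decision of O2. -/
def decision (d : Design) (ω : Ω) : Fin 2 := (M.U d (M.τ₂ d ω) ω).getD 0

/-- `π²_t`, the belief of O2, which stays constant once O2 has announced its decision. -/
def belief₂ (d : Design) (t : ℕ) (ω : Ω) : Belief := M.rawBelief₂ d (min t (M.τ₂ d ω)) ω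

/-- `D_t`, the indicator of `τ² ≥ t`. -/
def D (d : Design) (t : ℕ) (ω : Ω) : Bool := decide (t ≤ M.τ₂ d ω)

/-- The event `Z¹_{1:t-1} = b_{1:t-1}`. -/
def blankBefore (d : Design) (t : ℕ) : Set Ω := {ω | ∀ s, 1 ≤ s → s < t → M.Z d s ω = none}

/-- `ψ_t = P(H, π¹_t, π²_{t-1}, D_t | Z¹_{1:t-1} = b_{1:t-1})`.  It is the zero measure if the
conditioning event is null. -/
def psi (d : Design) (t : ℕ) : InfoState :=
  (M.μ[|M.blankBefore d t]).map
    (fun ω => (M.H ω, M.belief₁ t ω, M.belief₂ d (t - 1) ω, M.D d t ω))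

/-- `φ_t[z] = P(H, π¹_t, π²_t, D_t | Z¹_{1:t-1} = b_{1:t-1}, Z¹_t = z)`.  It is the zero measure if
the conditioning event is null. -/
def phi (d : Design) (t : ℕ) (z : Symb) : InfoState :=
  (M.μ[|M.blankBefore d t ∩ {ω | M.Z d t ω = z}]).map
    (fun ω => (M.H ω, M.belief₁ t ω, M.belief₂ d t ω, M.D d t ω))

/-- The realized cost `c¹ τ¹ + c² τ² + J(U_{τ²}, H)`. -/
def totalCost (d : Design) (ω : Ω) : ℝ :=
  M.c₁ * M.τ₁ d ω + M.c₂ * M.τ₂ d ω + M.J (M.decision d ω) (M.H ω)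

/-- The system objective. -/
def cost (d : Design) : ℝ := ∫ ω, M.totalCost d ω ∂M.μ

/-- The costs of O2 after its measurement at time `t`; zero if O2 stopped before `t`. -/
def remaining₂ (d : Design) (t : ℕ) (ω : Ω) : ℝ :=
  if t ≤ M.τ₂ d ω then M.c₂ * ((M.τ₂ d ω : ℝ) - t) + M.J (M.decision d ω) (M.H ω) else 0

/-- Expected cost that is still to come at time `t`, after the measurements at `t` and before O1's
message, given that only blanks were sent before `t`. -/
def toGo₁ (d : Design) (t : ℕ) : ℝ :=
  ∫ ω, (M.c₁ * ((M.τ₁ d ω : ℝ) - t) + M.remaining₂ d t ω) ∂(M.μ[|M.blankBefore d t])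

/-- Expected cost that is still to come at time `t`, after O1's message and before O2's decision,
given that only blanks were sent up to and including `t`; the next measurement of O1 (at
`t + 1`) is not counted. -/
def toGo₂ (d : Design) (t : ℕ) : ℝ :=
  ∫ ω, (M.c₁ * ((M.τ₁ d ω : ℝ) - (t + 1)) + M.remaining₂ d t ω)
    ∂(M.μ[|M.blankBefore d (t + 1)])

/-- The thresholds of `d` after a final message are Wald thresholds for the remaining horizon. -/
def UsesWald (d : Design) : Prop :=
  ∀ s z t, 1 ≤ s → s ≤ M.T₁ → s ≤ t → t ≤ M.T₂ → M.IsWaldThr (M.T₂ - t) t (d.post s z t)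

/-! ### Ingredients of the dynamic program -/

/-- Expected Wald cost of O2, if it has not stopped, under the state `φ` at time `t`. -/
def waldTerm (t : ℕ) (φ : InfoState) : ℝ :=
  ∫ x, (if x.2.2.2 then M.waldCost (M.T₂ - t) t x.2.2.1 else 0) ∂φ

/-- Expected cost of O2 at one time under the state `φ`, if only blanks were received and O2 uses
the thresholds `g`: the decision cost if it stops now, `c²` if it continues, and zero if it had
stopped before. -/
def stageCost₂ (φ : InfoState) (g : TwoThr) : ℝ :=
  ∫ x, (if x.2.2.2 then
      (match rule2 False g x.2.2.1 with
        | some u => M.J u x.1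
        | none => M.c₂)
    else 0) ∂φ

end Model

/-- Two designs have the same thresholds for O1, and for O2 while only blanks were received, at all
times before `t`. -/
def AgreeBefore (d d' : Design) (t : ℕ) : Prop :=
  ∀ s, 1 ≤ s → s < t → d'.o1 s = d.o1 s ∧ d'.o2 s = d.o2 s

end SeqDet

end

open MeasureTheory ProbabilityTheory

noncomputable section

namespace SeqDet

/-! While only blanks have been sent, a design is just a deterministic sequence of threshold
choices, and the law of `(H, π¹, π², D)` given the blanks is a state driven by these choices. It
evolves autonomously for two reasons. First, given `H` the two observation sequences are
independent, so O1's message is, given `H`, independent of everything O2 has measured; it enters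
O2's Bayes formula only through its two probabilities under `H = 0` and `H = 1`, and these can be
read off the state (`measure_finalSet_inter_H`, `rawBelief₂_before_final`). Secondly, given `H` the
next observation is independent of the present state, so each update is a product with a known law
followed by a fixed map (`map_cond_eq_transition`). This yields `phi_eq_msgUpdate` and
`psi_succ_eq_obsUpdate`.

After a final message the later blanks carry no information. O2's belief then follows the plain
Bayes recursion (`rawBelief₂_after_final`), and O2 faces a Wald problem. Averaging over `H` given
O2's information replaces `J u H` by `stopCost u` at the current belief, and backward induction with
Bellman's inequality bounds the cost below by the Wald cost, with equality for Wald thresholds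
(`waldIntegral_le`, `waldIntegral_eq`). Thresholds suffice because the Wald cost is concave in the
belief (`concave_contCost`): the region where a given decision is best is the set where a concave
function is nonnegative, and it contains an endpoint of `[0, 1]`, hence is an interval
(`exists_optimal_thresholds`).

The costs-to-go satisfy the one-stage identities `toGo₁_eq` and `toGo₂_eq`. Compared with the
dynamic program, the excess of a cost-to-go over the optimal value is a sum of nonnegative terms:
the suboptimality at the present stage, the weighted excess of the next stage, and the loss after a
final message. Backward induction gives the lower bound, and choices that are optimal up to `ε` show
that it is sharp; attainment of the infima is never assumed. For a design with Wald thresholds the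
last term is absent, so it is optimal exactly when every stage attains its infimum (`optimal_iff`).
Null blank events need a separate look: the weight vanishes there, but so do both values that it
multiplies (`toGo₂_eq_starG_of_null`). -/

instance : MeasurableSpace Symb := ⊤

instance : DiscreteMeasurableSpace Symb := ⟨fun _ => trivial⟩

/-! ### Measurability of the decision rules and of posteriors -/

theorem measurable_rule1 (g : FourThr) : Measurable (rule1 g) := by
  have h : ∀ a b : ℝ, MeasurableSet {p : Belief | a ≤ (p : ℝ) ∧ (p : ℝ) ≤ b} := fun a b =>
    (measurableSet_le measurable_const measurable_subtype_coe).inter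
      (measurableSet_le measurable_subtype_coe measurable_const)
  exact Measurable.ite (h _ _) measurable_const
    (Measurable.ite (h _ _) measurable_const measurable_const)

theorem measurable_rule1Last (a : Belief) : Measurable (rule1Last a) :=
  Measurable.ite (measurableSet_le measurable_id measurable_const) measurable_const
    measurable_const

theorem measurable_rule2 (last : Prop) [Decidable last] (g : TwoThr) :
    Measurable (rule2 last g) := by
  refine Measurable.ite (measurableSet_le measurable_subtype_coe measurable_const)
    measurable_const (Measurable.ite ?_ measurable_const measurable_const)
  by_cases h : last
  · simp [h]
  · simpa [h] using measurableSet_le measurable_const measurable_subtype_coe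

/-- The rule of O2 occurs with the end conditions `t = M.T₂`, `n = 0` and `False`, each with its own
decidability instance; this lemma switches between them. -/
theorem rule2_congr {p q : Prop} [Decidable p] [Decidable q] (h : p ↔ q) (g : TwoThr)
    (x : Belief) : rule2 p g x = rule2 q g x := by
  by_cases hp : p
  · simp [rule2, hp, h.1 hp]
  · have hq : ¬ q := fun hq => hp (h.2 hq)
    simp [rule2, hp, hq]

theorem rule2_ne_none {p : Prop} [Decidable p] (h : p) (g : TwoThr) (x : Belief) :
    rule2 p g x ≠ none := by
  unfold rule2
  split_ifs <;> simp_all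

theorem measurable_posterior {Ω : Type*} {m₀ : MeasurableSpace Ω} (μ : Measure[m₀] Ω) (A : Set Ω)
    (m : MeasurableSpace Ω) : Measurable[m] (posterior μ A m) :=
  continuous_projIcc.measurable.comp stronglyMeasurable_condExp.measurable

namespace Model

variable {Ω 𝒴₁ 𝒴₂ : Type*} [MeasurableSpace Ω] [MeasurableSpace 𝒴₁] [MeasurableSpace 𝒴₂]
variable (M : Model Ω 𝒴₁ 𝒴₂)

/-! ### The stopping times -/

/-- The rule of O1 at time `t`. -/
def msgRule (d : Design) (t : ℕ) (p : Belief) : Symb :=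
  if t < M.T₁ then rule1 (d.o1 t) p else some (rule1Last d.o1Last p)

theorem measurable_msgRule (d : Design) (t : ℕ) : Measurable (M.msgRule d t) := by
  unfold msgRule
  split_ifs
  · exact measurable_rule1 _
  · exact measurable_from_top.comp (measurable_rule1Last _)

theorem rawMsg_eq (d : Design) (t : ℕ) (ω : Ω) :
    M.rawMsg d t ω = M.msgRule d t (M.belief₁ t ω) := rfl

variable {M}

/-- O1 has no blank at `M.T₁`, so the set defining `τ₁` is nonempty and its `sInf` is attained, not
the default value `0`. -/
theorem τ₁_mem (hT₁ : 1 ≤ M.T₁) (d : Design) (ω : Ω) :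
    1 ≤ M.τ₁ d ω ∧ M.rawMsg d (M.τ₁ d ω) ω ≠ none :=
  Nat.sInf_mem (s := {t | 1 ≤ t ∧ M.rawMsg d t ω ≠ none}) ⟨M.T₁, hT₁, by simp [rawMsg]⟩

theorem τ₁_le_of {d : Design} {ω : Ω} {t : ℕ} (ht : 1 ≤ t) (h : M.rawMsg d t ω ≠ none) :
    M.τ₁ d ω ≤ t := Nat.sInf_le ⟨ht, h⟩

theorem τ₁_le (hT₁ : 1 ≤ M.T₁) (d : Design) (ω : Ω) : M.τ₁ d ω ≤ M.T₁ :=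
  τ₁_le_of hT₁ (by simp [rawMsg])

theorem Z_ne_none_iff (hT₁ : 1 ≤ M.T₁) {d : Design} {ω : Ω} {t : ℕ} (ht : 1 ≤ t) :
    M.Z d t ω ≠ none ↔ M.τ₁ d ω = t := by
  constructor
  · intro h
    unfold Z at h
    split_ifs at h with h1
    · exact le_antisymm (τ₁_le_of ht h) h1
    · exact absurd rfl h
  · rintro rfl
    simpa [Z] using (τ₁_mem hT₁ d ω).2

theorem mem_blankBefore (hT₁ : 1 ≤ M.T₁) {d : Design} {ω : Ω} {t : ℕ} :
    ω ∈ M.blankBefore d t ↔ t ≤ M.τ₁ d ω := by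
  constructor
  · intro h
    by_contra! hlt
    exact (Z_ne_none_iff hT₁ (τ₁_mem hT₁ d ω).1).2 rfl (h _ (τ₁_mem hT₁ d ω).1 hlt)
  · intro h s hs hst
    by_contra hne
    have := (Z_ne_none_iff hT₁ hs).1 hne
    omega

theorem Z_eq_of_le {d : Design} {ω : Ω} {t : ℕ} (h : t ≤ M.τ₁ d ω) :
    M.Z d t ω = M.msgRule d t (M.belief₁ t ω) := by simp [Z, h, rawMsg_eq]

theorem blankBefore_succ (d : Design) {t : ℕ} (ht : 1 ≤ t) :
    M.blankBefore d (t + 1) = M.blankBefore d t ∩ {ω | M.Z d t ω = none} := by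
  ext ω
  constructor
  · exact fun h => ⟨fun s hs hst => h s hs (by omega), h t ht (by omega)⟩
  · rintro ⟨h1, h2⟩ s hs hst
    rcases Nat.lt_succ_iff_lt_or_eq.1 hst with h | rfl
    · exact h1 s hs h
    · exact h2

theorem blankBefore_one (d : Design) : M.blankBefore d 1 = Set.univ := by
  ext ω
  simp only [blankBefore, Set.mem_ofPred_eq, Set.mem_univ, iff_true]
  intros; omega

theorem blankBefore_anti (d : Design) {s t : ℕ} (h : s ≤ t) :
    M.blankBefore d t ⊆ M.blankBefore d s :=
  fun _ hω r hr hrs => hω r hr (by omega)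

/-- The set on which O1 sends its final message `z` at time `t`. -/
def finalSet (M : Model Ω 𝒴₁ 𝒴₂) (d : Design) (t : ℕ) (z : Symb) : Set Ω :=
  M.blankBefore d t ∩ {ω | M.Z d t ω = z}

theorem U_horizon (d : Design) (ω : Ω) : M.U d M.T₂ ω ≠ none := rule2_ne_none rfl _ _

theorem τ₂_mem (hT₂ : 1 ≤ M.T₂) (d : Design) (ω : Ω) :
    1 ≤ M.τ₂ d ω ∧ M.U d (M.τ₂ d ω) ω ≠ none :=
  Nat.sInf_mem (s := {t | 1 ≤ t ∧ M.U d t ω ≠ none}) ⟨M.T₂, hT₂, U_horizon d ω⟩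

theorem τ₂_le (hT₂ : 1 ≤ M.T₂) (d : Design) (ω : Ω) : M.τ₂ d ω ≤ M.T₂ :=
  Nat.sInf_le ⟨hT₂, U_horizon d ω⟩

theorem U_eq_none_of_lt {d : Design} {ω : Ω} {t : ℕ} (ht : 1 ≤ t) (h : t < M.τ₂ d ω) :
    M.U d t ω = none := by
  by_contra hne
  exact absurd (Nat.sInf_le (s := {t | 1 ≤ t ∧ M.U d t ω ≠ none}) ⟨ht, hne⟩) (not_le.2 h)

theorem succ_le_τ₂_iff (hT₂ : 1 ≤ M.T₂) {d : Design} {ω : Ω} {t : ℕ} (ht : 1 ≤ t) :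
    t + 1 ≤ M.τ₂ d ω ↔ t ≤ M.τ₂ d ω ∧ M.U d t ω = none := by
  constructor
  · exact fun h => ⟨by omega, U_eq_none_of_lt ht h⟩
  · rintro ⟨h1, h2⟩
    rcases h1.eq_or_lt with rfl | h
    · exact absurd h2 (τ₂_mem hT₂ d ω).2
    · exact h

theorem le_τ₂_iff (hT₂ : 1 ≤ M.T₂) {d : Design} {ω : Ω} {t : ℕ} :
    t ≤ M.τ₂ d ω ↔ ∀ k ∈ Finset.Ico 1 t, M.U d k ω = none := by
  constructor
  · intro h k hk
    rw [Finset.mem_Ico] at hk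
    exact U_eq_none_of_lt hk.1 (by omega)
  · intro h
    by_contra! hlt
    exact (τ₂_mem hT₂ d ω).2 (h _ (Finset.mem_Ico.2 ⟨(τ₂_mem hT₂ d ω).1, hlt⟩))

/-- The one-stage split behind both the recursion of the costs-to-go and the Wald verification:
continuing costs exactly one `c₂`, and stopping at `t` leaves nothing for `t + 1`. -/
theorem remaining₂_succ (hT₂ : 1 ≤ M.T₂) (d : Design) {t : ℕ} (ht : 1 ≤ t) (ω : Ω) :
    M.remaining₂ d t ω = (if t ≤ M.τ₂ d ω then
      (match M.U d t ω with
        | some u => M.J u (M.H ω)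
        | none => M.c₂) else 0) + M.remaining₂ d (t + 1) ω := by
  unfold remaining₂
  by_cases h : t ≤ M.τ₂ d ω
  · rcases hU : M.U d t ω with _ | u
    · have h' := (succ_le_τ₂_iff hT₂ ht).2 ⟨h, hU⟩
      simp only [h, h', if_true]
      push_cast; ring
    · have h' : ¬ t + 1 ≤ M.τ₂ d ω := fun h' => by
        simp [((succ_le_τ₂_iff hT₂ ht).1 h').2] at hU
      have h'' : M.τ₂ d ω = t := by omega
      simp [h'', decision, hU]
  · have h' : ¬ t + 1 ≤ M.τ₂ d ω := by omega
    simp [h, h']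

/-! ### Measurability -/

variable (M)

/-- The information in the observations of O1 up to time `t`. -/
abbrev obs₁ (t : ℕ) : MeasurableSpace Ω :=
  ⨆ s ∈ Finset.Icc 1 t, MeasurableSpace.comap (M.Y₁ s) inferInstance

/-- The information in the observations of O2 up to time `t`. -/
abbrev obs₂ (t : ℕ) : MeasurableSpace Ω :=
  ⨆ s ∈ Finset.Icc 1 t, MeasurableSpace.comap (M.Y₂ s) inferInstance

/-- The information of O2 at time `t`. -/
abbrev info₂ (d : Design) (t : ℕ) : MeasurableSpace Ω :=
  ⨆ s ∈ Finset.Icc 1 t,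
    MeasurableSpace.comap (M.Y₂ s) inferInstance ⊔ MeasurableSpace.comap (M.Z d s) ⊤

theorem obs₁_mono {s t : ℕ} (h : s ≤ t) : M.obs₁ s ≤ M.obs₁ t :=
  biSup_mono fun _ hk => Finset.Icc_subset_Icc_right h hk

theorem info₂_mono (d : Design) {s t : ℕ} (h : s ≤ t) : M.info₂ d s ≤ M.info₂ d t :=
  biSup_mono fun _ hk => Finset.Icc_subset_Icc_right h hk

theorem obs₁_le (t : ℕ) : M.obs₁ t ≤ (inferInstance : MeasurableSpace Ω) :=
  iSup₂_le fun s _ => (M.meas_Y₁ s).comap_le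

theorem obs₂_le (t : ℕ) : M.obs₂ t ≤ (inferInstance : MeasurableSpace Ω) :=
  iSup₂_le fun s _ => (M.meas_Y₂ s).comap_le

theorem measurable_belief₁ (t : ℕ) : Measurable[M.obs₁ t] (M.belief₁ t) :=
  measurable_posterior _ _ _

theorem measurable_rawMsg (d : Design) (t : ℕ) : Measurable[M.obs₁ t] (M.rawMsg d t) :=
  (M.measurable_msgRule d t).comp (M.measurable_belief₁ t)

theorem measurable_rawBelief₂ (d : Design) (t : ℕ) :
    Measurable[M.info₂ d t] (M.rawBelief₂ d t) :=
  measurable_posterior _ _ _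

variable {M}

theorem le_τ₁_iff (hT₁ : 1 ≤ M.T₁) {d : Design} {ω : Ω} {t : ℕ} :
    t ≤ M.τ₁ d ω ↔ ∀ s ∈ Finset.Ico 1 t, M.rawMsg d s ω = none := by
  constructor
  · intro h s hs
    rw [Finset.mem_Ico] at hs
    by_contra hne
    have := τ₁_le_of hs.1 hne
    omega
  · intro h
    by_contra! hlt
    exact (τ₁_mem hT₁ d ω).2 (h _ (Finset.mem_Ico.2 ⟨(τ₁_mem hT₁ d ω).1, hlt⟩))

/-- The event depends on the messages before `t` only; hence the slack of one in `t ≤ s + 1`. -/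
theorem measurableSet_le_τ₁ (hT₁ : 1 ≤ M.T₁) (d : Design) {s t : ℕ} (h : t ≤ s + 1) :
    MeasurableSet[M.obs₁ s] {ω | t ≤ M.τ₁ d ω} := by
  simp only [le_τ₁_iff hT₁, Set.ofPred_forall]
  refine Finset.measurableSet_biInter _ fun k hk => ?_
  rw [Finset.mem_Ico] at hk
  exact M.obs₁_mono (by omega : k ≤ s) _ ((M.measurable_rawMsg d k) (measurableSet_singleton none))

theorem measurable_Z (hT₁ : 1 ≤ M.T₁) (d : Design) (t : ℕ) : Measurable[M.obs₁ t] (M.Z d t) :=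
  Measurable.ite (measurableSet_le_τ₁ hT₁ d (by omega)) (M.measurable_rawMsg d t)
    measurable_const

/-- Messages are functions of O1's observations. This reduces every independence claim about O2's
information to the raw observations. -/
theorem info₂_le_sup (hT₁ : 1 ≤ M.T₁) (d : Design) (t : ℕ) :
    M.info₂ d t ≤ M.obs₁ t ⊔ M.obs₂ t := by
  refine iSup₂_le fun s hs => sup_le ?_ ?_
  · exact le_sup_of_le_right
      (le_iSup₂ (f := fun s _ => MeasurableSpace.comap (M.Y₂ s) inferInstance) s hs)
  · rw [Finset.mem_Icc] at hs
    exact le_sup_of_le_left ((measurable_Z hT₁ d s).comap_le.trans (M.obs₁_mono hs.2))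

theorem info₂_le (hT₁ : 1 ≤ M.T₁) (d : Design) (t : ℕ) :
    M.info₂ d t ≤ (inferInstance : MeasurableSpace Ω) :=
  (info₂_le_sup hT₁ d t).trans (sup_le (M.obs₁_le t) (M.obs₂_le t))

theorem measurable_Z_info (d : Design) {s t : ℕ} (hs : 1 ≤ s) (hst : s ≤ t) :
    Measurable[M.info₂ d t] (M.Z d s) := by
  rw [measurable_iff_comap_le]
  exact le_sup_right.trans (le_iSup₂ (f := fun s _ =>
    MeasurableSpace.comap (M.Y₂ s) inferInstance ⊔ MeasurableSpace.comap (M.Z d s) ⊤) s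
    (Finset.mem_Icc.2 ⟨hs, hst⟩))

theorem measurable_Y₂_info (d : Design) {s t : ℕ} (hs : 1 ≤ s) (hst : s ≤ t) :
    Measurable[M.info₂ d t] (M.Y₂ s) := by
  rw [measurable_iff_comap_le]
  exact le_sup_left.trans (le_iSup₂ (f := fun s _ =>
    MeasurableSpace.comap (M.Y₂ s) inferInstance ⊔ MeasurableSpace.comap (M.Z d s) ⊤) s
    (Finset.mem_Icc.2 ⟨hs, hst⟩))

theorem measurableSet_blankBefore_info (d : Design) {s t : ℕ} (h : t ≤ s + 1) :
    MeasurableSet[M.info₂ d s] (M.blankBefore d t) := by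
  simp only [blankBefore, Set.ofPred_forall]
  refine MeasurableSet.iInter fun k => MeasurableSet.iInter fun hk => MeasurableSet.iInter
    fun hkt => measurable_Z_info d hk (by omega) (measurableSet_singleton none)

theorem measurableSet_blankBefore (hT₁ : 1 ≤ M.T₁) (d : Design) {s t : ℕ} (h : t ≤ s + 1) :
    MeasurableSet[M.obs₁ s] (M.blankBefore d t) := by
  have : M.blankBefore d t = {ω | t ≤ M.τ₁ d ω} := Set.ext fun _ => mem_blankBefore hT₁
  rw [this]
  exact measurableSet_le_τ₁ hT₁ d h

theorem measurableSet_finalSet (hT₁ : 1 ≤ M.T₁) (d : Design) (t : ℕ) (z : Symb) :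
    MeasurableSet[M.obs₁ t] (M.finalSet d t z) :=
  (measurableSet_blankBefore hT₁ d (by omega)).inter
    (measurable_Z hT₁ d t (measurableSet_singleton z))

theorem measurableSet_finalSet_info (d : Design) {s t : ℕ} (ht : 1 ≤ t) (hts : t ≤ s) (z : Symb) :
    MeasurableSet[M.info₂ d s] (M.finalSet d t z) :=
  (measurableSet_blankBefore_info d (by omega)).inter
    (measurable_Z_info d ht hts (measurableSet_singleton z))

theorem τ₁_of_mem_finalSet (hT₁ : 1 ≤ M.T₁) {d : Design} {t : ℕ} (ht : 1 ≤ t) {z : Fin 2} {ω : Ω}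
    (h : ω ∈ M.finalSet d t (some z)) : M.τ₁ d ω = t :=
  (Z_ne_none_iff hT₁ ht).1 (by rw [h.2]; simp)

theorem U_eq_of_final (hT₁ : 1 ≤ M.T₁) {d : Design} {s t : ℕ} (hs : 1 ≤ s) (hst : s ≤ t)
    {z : Fin 2} {ω : Ω} (h : ω ∈ M.finalSet d s (some z)) :
    M.U d t ω = rule2 (t = M.T₂) (d.post s z t) (M.rawBelief₂ d t ω) := by
  have h1 := τ₁_of_mem_finalSet hT₁ hs h
  have h2 : M.Z d s ω = some z := h.2
  simp [U, thr₂, h1, hst, h2]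

theorem U_eq_of_blank (hT₁ : 1 ≤ M.T₁) {d : Design} {t : ℕ}
    {ω : Ω} (h : ω ∈ M.blankBefore d (t + 1)) :
    M.U d t ω = rule2 (t = M.T₂) (d.o2 t) (M.rawBelief₂ d t ω) := by
  have h1 : ¬ M.τ₁ d ω ≤ t := by rw [mem_blankBefore hT₁] at h; omega
  simp [U, thr₂, h1]

/-- The thresholds in force depend on `τ₁`, of which O2 knows only what has happened by `t`. On the
event of no final message by `t`, and on each event of a final message `z` at some `s ≤ t`, they are
fixed, and all these events are known to O2. -/
theorem measurable_U (hT₁ : 1 ≤ M.T₁) (d : Design) (t : ℕ) :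
    Measurable[M.info₂ d t] (M.U d t) := by
  refine @measurable_to_countable' _ _ _ _ (M.info₂ d t) _ fun u => ?_
  have : M.U d t ⁻¹' {u} =
      (M.blankBefore d (t + 1) ∩
        (fun ω => rule2 (t = M.T₂) (d.o2 t) (M.rawBelief₂ d t ω)) ⁻¹' {u}) ∪
      ⋃ s ∈ Finset.Icc 1 t, ⋃ z : Fin 2, (M.finalSet d s (some z) ∩
        (fun ω => rule2 (t = M.T₂) (d.post s z t) (M.rawBelief₂ d t ω)) ⁻¹' {u}) := by
    ext ω
    simp only [Set.mem_union, Set.mem_inter_iff, Set.mem_preimage, Set.mem_iUnion, exists_prop]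
    constructor
    · intro h
      by_cases hb : ω ∈ M.blankBefore d (t + 1)
      · exact Or.inl ⟨hb, by rwa [← U_eq_of_blank hT₁ hb]⟩
      · right
        have hle : M.τ₁ d ω ≤ t := by rw [mem_blankBefore hT₁] at hb; omega
        have h1 := (τ₁_mem hT₁ d ω).1
        obtain ⟨z, hz⟩ := Option.ne_none_iff_exists'.1 ((Z_ne_none_iff (d := d) hT₁ h1).2 rfl)
        have hf : ω ∈ M.finalSet d (M.τ₁ d ω) (some z) := ⟨(mem_blankBefore hT₁).2 le_rfl, hz⟩
        exact ⟨_, Finset.mem_Icc.2 ⟨h1, hle⟩, z, hf, by rwa [← U_eq_of_final hT₁ h1 hle hf]⟩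
    · rintro (⟨hb, h⟩ | ⟨s, hs, z, hf, h⟩)
      · rwa [U_eq_of_blank hT₁ hb]
      · rw [Finset.mem_Icc] at hs
        rwa [U_eq_of_final hT₁ hs.1 hs.2 hf]
  rw [this]
  have hr : ∀ g, Measurable[M.info₂ d t]
      (fun ω => rule2 (t = M.T₂) g (M.rawBelief₂ d t ω)) :=
    fun g => (measurable_rule2 _ g).comp (M.measurable_rawBelief₂ d t)
  refine ((measurableSet_blankBefore_info d le_rfl).inter
    (hr _ (measurableSet_singleton u))).union ?_
  refine Finset.measurableSet_biUnion _ fun s hs => MeasurableSet.iUnion fun z => ?_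
  rw [Finset.mem_Icc] at hs
  exact (measurableSet_finalSet_info d hs.1 hs.2 _).inter (hr _ (measurableSet_singleton u))

theorem measurableSet_le_τ₂ (hT₁ : 1 ≤ M.T₁) (hT₂ : 1 ≤ M.T₂) (d : Design) {s t : ℕ}
    (h : t ≤ s + 1) : MeasurableSet[M.info₂ d s] {ω | t ≤ M.τ₂ d ω} := by
  simp only [le_τ₂_iff hT₂, Set.ofPred_forall]
  refine Finset.measurableSet_biInter _ fun k hk => ?_
  rw [Finset.mem_Ico] at hk
  exact M.info₂_mono d (by omega : k ≤ s) _ (measurable_U hT₁ d k (measurableSet_singleton none))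

theorem measurable_D (hT₁ : 1 ≤ M.T₁) (hT₂ : 1 ≤ M.T₂) (d : Design) {s t : ℕ}
    (h : t ≤ s + 1) : Measurable[M.info₂ d s] (M.D d t) := by
  refine @measurable_to_bool _ (M.info₂ d s) _ ?_
  have : M.D d t ⁻¹' {true} = {ω | t ≤ M.τ₂ d ω} := by ext; simp [D]
  rw [this]
  exact measurableSet_le_τ₂ hT₁ hT₂ d h

theorem belief₂_of_le {d : Design} {t : ℕ} {ω : Ω} (h : t ≤ M.τ₂ d ω) :
    M.belief₂ d t ω = M.rawBelief₂ d t ω := by simp [belief₂, h]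

theorem belief₂_of_lt {d : Design} {t : ℕ} {ω : Ω} (h : M.τ₂ d ω < t) :
    M.belief₂ d t ω = M.belief₂ d (t - 1) ω := by
  have : M.τ₂ d ω ≤ t - 1 := by omega
  simp [belief₂, h.le, this]

theorem measurable_belief₂ (hT₁ : 1 ≤ M.T₁) (hT₂ : 1 ≤ M.T₂) (d : Design) (t : ℕ) :
    Measurable[M.info₂ d t] (M.belief₂ d t) := by
  induction t with
  | zero =>
    have : M.belief₂ d 0 = M.rawBelief₂ d 0 := funext fun ω => by simp [belief₂]
    rw [this]
    exact M.measurable_rawBelief₂ d 0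
  | succ t ih =>
    have : M.belief₂ d (t + 1) = fun ω =>
        if t + 1 ≤ M.τ₂ d ω then M.rawBelief₂ d (t + 1) ω else M.belief₂ d t ω := by
      funext ω
      split_ifs with h
      · exact belief₂_of_le h
      · exact belief₂_of_lt (not_le.1 h)
    rw [this]
    exact Measurable.ite (measurableSet_le_τ₂ hT₁ hT₂ d (by omega))
      (M.measurable_rawBelief₂ d _) (ih.mono (M.info₂_mono d (by omega)) le_rfl)

end Model

/-! ### Bayes updates -/

section Bayes

variable {𝒴 : Type*} [MeasurableSpace 𝒴]

/-- The density of `P h` with respect to `P 0 + P 1`. -/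
def likelihood (P : Fin 2 → Measure 𝒴) (h : Fin 2) (y : 𝒴) : ℝ :=
  ((P h).rnDeriv (P 0 + P 1) y).toReal

/-- Bayes update of the belief `p` with the observation `y`, when the law of the observation is
the multiple `r h` of `P h` given `H = h`. -/
def bayesUpdate (P : Fin 2 → Measure 𝒴) (r : Fin 2 → ℝ) (p : Belief) (y : 𝒴) : Belief :=
  Set.projIcc 0 1 zero_le_one
    ((p : ℝ) * (r 0 * likelihood P 0 y) /
      ((p : ℝ) * (r 0 * likelihood P 0 y) + (1 - (p : ℝ)) * (r 1 * likelihood P 1 y)))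

theorem likelihood_nonneg (P : Fin 2 → Measure 𝒴) (h : Fin 2) (y : 𝒴) : 0 ≤ likelihood P h y :=
  ENNReal.toReal_nonneg

theorem measurable_likelihood (P : Fin 2 → Measure 𝒴) (h : Fin 2) :
    Measurable (likelihood P h) :=
  (Measure.measurable_rnDeriv _ _).ennreal_toReal

theorem measurable_bayesUpdate (P : Fin 2 → Measure 𝒴) (r : Fin 2 → ℝ) :
    Measurable (fun x : Belief × 𝒴 => bayesUpdate P r x.1 x.2) := by
  have h : ∀ i, Measurable fun x : Belief × 𝒴 => likelihood P i x.2 :=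
    fun i => (measurable_likelihood P i).comp measurable_snd
  have hp : Measurable fun x : Belief × 𝒴 => (x.1 : ℝ) := measurable_subtype_coe.comp measurable_fst
  exact continuous_projIcc.measurable.comp
    ((hp.mul ((h 0).const_mul _)).div ((hp.mul ((h 0).const_mul _)).add
      ((hp.const_sub 1).mul ((h 1).const_mul _))))

/-- For `a = b = 0` the quotient is `0` by convention, which still lies in `[0, 1]`; so the
projection never acts. -/
theorem coe_projIcc_div {a b : ℝ} (ha : 0 ≤ a) (hb : 0 ≤ b) :
    ((Set.projIcc 0 1 zero_le_one (a / (a + b)) : Belief) : ℝ) = a / (a + b) := by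
  rw [Set.projIcc_of_mem zero_le_one ⟨by positivity, div_le_one_of_le₀ (by linarith) (by linarith)⟩]

theorem absolutelyContinuous_add (P : Fin 2 → Measure 𝒴) (h : Fin 2) : P h ≪ P 0 + P 1 := by
  fin_cases h
  · exact Measure.absolutelyContinuous_of_le (Measure.le_add_right le_rfl)
  · exact Measure.absolutelyContinuous_of_le (Measure.le_add_left le_rfl)

variable (P : Fin 2 → Measure 𝒴) [∀ h, IsProbabilityMeasure (P h)]

theorem integral_eq_likelihood (h : Fin 2) (f : 𝒴 → ℝ) :
    ∫ y, f y ∂(P h) = ∫ y, likelihood P h y * f y ∂(P 0 + P 1) :=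
  (integral_rnDeriv_smul (absolutelyContinuous_add P h)).symm

theorem withDensity_likelihood (h : Fin 2) :
    (P 0 + P 1).withDensity (fun y => ENNReal.ofReal (likelihood P h y)) = P h := by
  conv_rhs => rw [← Measure.withDensity_rnDeriv_eq _ _ (absolutelyContinuous_add P h)]
  refine withDensity_congr_ae ?_
  filter_upwards [Measure.rnDeriv_lt_top (P h) (P 0 + P 1)] with y hy
  exact ENNReal.ofReal_toReal hy.ne

theorem likelihood_pos_ae (h : Fin 2) : ∀ᵐ y ∂(P h), 0 < likelihood P h y := by
  filter_upwards [Measure.rnDeriv_pos (absolutelyContinuous_add P h),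
    (absolutelyContinuous_add P h).ae_le (Measure.rnDeriv_lt_top (P h) (P 0 + P 1))] with y h1 h2
  exact ENNReal.toReal_pos h1.ne' h2.ne

theorem integrable_likelihood (h : Fin 2) : Integrable (likelihood P h) (P 0 + P 1) :=
  Measure.integrable_toReal_rnDeriv

end Bayes

/-! ### Concave functions of the belief -/

/-- Concavity of a function on the unit interval. -/
def ConcaveBelief (f : Belief → ℝ) : Prop :=
  ∀ (p q x : Belief) (a b : ℝ), 0 ≤ a → 0 ≤ b → a + b = 1 → (x : ℝ) = a * p + b * q →
    a * f p + b * f q ≤ f x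

theorem ConcaveBelief.min {f g : Belief → ℝ} (hf : ConcaveBelief f) (hg : ConcaveBelief g) :
    ConcaveBelief (fun p => min (f p) (g p)) := by
  intro p q x a b ha hb hab hx
  refine le_min ((add_le_add ?_ ?_).trans (hf p q x a b ha hb hab hx))
    ((add_le_add ?_ ?_).trans (hg p q x a b ha hb hab hx)) <;>
  apply mul_le_mul_of_nonneg_left <;>
    first | assumption | exact min_le_left _ _ | exact min_le_right _ _

/-- A concave function that is nonnegative at `0` is nonnegative on an initial interval. -/
theorem exists_threshold {f a : Belief → ℝ} (hf : ConcaveBelief f) (h0 : 0 ≤ f 0)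
    (ha : Continuous a) (hfa : ∀ p, f p ≤ a p) (h1 : 0 ≤ a 1 → 0 ≤ f 1) :
    ∃ α : Belief, ∀ p, 0 ≤ f p ↔ p ≤ α := by
  set S : Set Belief := {p | 0 ≤ f p} with hS
  have hlub : IsLUB S (sSup S) := isLUB_sSup S
  set α := sSup S with hα
  -- A concave function may jump down at an endpoint, so closedness of `S` at `1` is not automatic.
  -- There the continuous majorant `a` decides; below `1` concavity does.
  have hmem : α ∈ S := by
    rcases eq_or_lt_of_le (unitInterval.le_one' (t := α)) with h | h
    · have hcl : α ∈ closure S := hlub.mem_closure ⟨0, h0⟩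
      have hsub : closure S ⊆ {p | 0 ≤ a p} :=
        closure_minimal (fun p hp => le_trans hp (hfa p)) (isClosed_le continuous_const ha)
      have := hsub hcl
      rw [h] at this ⊢
      exact h1 this
    · by_contra hneg
      have hneg' : f α < 0 := not_le.1 hneg
      have hαr : (α : ℝ) < 1 := h
      have hα0 : (0 : ℝ) ≤ α := α.2.1
      have hp1 : f 1 < 0 := by
        by_contra! h1'
        by_cases hz : (α : ℝ) = 0
        · have : α = 0 := Subtype.ext hz
          rw [this] at hneg'
          linarith
        · have := hf 0 1 α (1 - α) α (by linarith) hα0 (by ring) (by simp)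
          have h2 : 0 ≤ (1 - (α : ℝ)) * f 0 := mul_nonneg (by linarith) h0
          have h3 : 0 ≤ (α : ℝ) * f 1 := mul_nonneg hα0 h1'
          linarith
      -- points of `S` close to `α`
      have key : ∀ p ∈ S, (α : ℝ) - p ≥ (1 - α) * (f α / f 1) := by
        intro p hp
        have hpα : (p : ℝ) ≤ α := hlub.1 hp
        have hp1' : (0 : ℝ) < 1 - p := by linarith
        have := hf p 1 α ((1 - α) / (1 - p)) ((α - p) / (1 - p)) (by
          apply div_nonneg <;> linarith) (by apply div_nonneg <;> linarith)
          (by field_simp; ring) (by simp; field_simp; ring)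
        have h2 : 0 ≤ (1 - (α : ℝ)) / (1 - p) * f p :=
          mul_nonneg (div_nonneg (by linarith) hp1'.le) hp
        have h3 : ((α : ℝ) - p) / (1 - p) * f 1 ≤ f α := by linarith
        have h4 : ((α : ℝ) - p) * f 1 ≤ (1 - p) * f α := by
          rw [div_mul_eq_mul_div, div_le_iff₀ hp1'] at h3
          linarith
        have h5 : ((α : ℝ) - p) * f 1 ≤ (1 - α) * f α := by nlinarith
        rw [ge_iff_le, ← mul_div_assoc, div_le_iff_of_neg hp1]
        exact h5
      -- By `key`, all of `S` stays at least this positive distance below its own supremum, which is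
      -- absurd.
      have hpos : 0 < (1 - (α : ℝ)) * (f α / f 1) :=
        mul_pos (by linarith) (div_pos_of_neg_of_neg hneg' hp1)
      have hα1 : (1 - (α : ℝ)) * (f α / f 1) ≤ α := by
        have := key 0 h0
        simpa using this
      have hub : (⟨(α : ℝ) - (1 - α) * (f α / f 1), by linarith, by linarith⟩ : Belief) ∈
          upperBounds S := fun p hp => by
        have := key p hp
        show (p : ℝ) ≤ _
        simp only
        linarith
      have : (α : ℝ) ≤ (α : ℝ) - (1 - α) * (f α / f 1) := hlub.2 hub
      linarith
  refine ⟨α, fun p => ⟨fun hp => hlub.1 hp, fun hp => ?_⟩⟩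
  by_cases hz : (α : ℝ) = 0
  · have h2 : (p : ℝ) ≤ α := hp
    have : p = 0 := Subtype.ext (le_antisymm (h2.trans hz.le) p.2.1)
    rw [this]
    exact h0
  · have hα0 : (0 : ℝ) < α := lt_of_le_of_ne α.2.1 (Ne.symm hz)
    have h2 : (p : ℝ) ≤ α := hp
    have := hf 0 α p (1 - p / α) (p / α) (by rw [sub_nonneg, div_le_one hα0]; exact h2)
      (div_nonneg p.2.1 hα0.le) (by ring) (by simp; field_simp)
    have h3 : 0 ≤ (1 - (p : ℝ) / α) * f 0 :=
      mul_nonneg (by rw [sub_nonneg, div_le_one hα0]; exact h2) h0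
    have h4 : 0 ≤ (p : ℝ) / α * f α := mul_nonneg (div_nonneg p.2.1 hα0.le) hmem
    linarith

theorem exists_threshold_symm {f a : Belief → ℝ} (hf : ConcaveBelief f) (h1 : 0 ≤ f 1)
    (ha : Continuous a) (hfa : ∀ p, f p ≤ a p) (h0 : 0 ≤ a 0 → 0 ≤ f 0) :
    ∃ β : Belief, ∀ p, 0 ≤ f p ↔ β ≤ p := by
  obtain ⟨α, hα⟩ := exists_threshold (f := fun p => f (unitInterval.symm p))
    (a := fun p => a (unitInterval.symm p))
    (fun p q x c d hc hd hcd hx => hf _ _ _ c d hc hd hcd (by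
      simp only [unitInterval.coe_symm_eq, hx]
      linear_combination (-1 : ℝ) * hcd)) (by simpa using h1) (ha.comp unitInterval.continuous_symm)
    (fun p => hfa _) (by simpa using h0)
  refine ⟨unitInterval.symm α, fun p => ?_⟩
  have := hα (unitInterval.symm p)
  rw [unitInterval.symm_symm] at this
  rw [this]
  constructor <;> intro h
  · have h' : 1 - (p : ℝ) ≤ α := h
    show 1 - (α : ℝ) ≤ p
    linarith
  · have h' : 1 - (α : ℝ) ≤ p := h
    show 1 - (p : ℝ) ≤ α
    linarith

namespace Model

variable {Ω 𝒴₁ 𝒴₂ : Type*} [MeasurableSpace Ω] [MeasurableSpace 𝒴₁] [MeasurableSpace 𝒴₂]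
variable (M : Model Ω 𝒴₁ 𝒴₂)

/-! ### The Wald problem -/

instance (t : ℕ) (h : Fin 2) : IsProbabilityMeasure (M.P₁ t h) := M.prob₁ t h

instance (t : ℕ) (h : Fin 2) : IsProbabilityMeasure (M.P₂ t h) := M.prob₂ t h

instance : IsProbabilityMeasure M.μ := M.prob

theorem bayes_eq (t : ℕ) (p : Belief) (y : 𝒴₂) :
    M.bayes t p y = bayesUpdate (M.P₂ t) (fun _ => 1) p y := by
  simp only [bayesUpdate, one_mul]
  rfl

theorem coe_bayes (t : ℕ) (p : Belief) (y : 𝒴₂) : (M.bayes t p y : ℝ) =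
    (p : ℝ) * M.lik t 0 y / ((p : ℝ) * M.lik t 0 y + (1 - (p : ℝ)) * M.lik t 1 y) :=
  coe_projIcc_div (mul_nonneg p.2.1 ENNReal.toReal_nonneg)
    (mul_nonneg (by linarith [p.2.2]) ENNReal.toReal_nonneg)

/-- A bound for the decision costs. -/
def costBound : ℝ := |M.J 0 0| + |M.J 0 1| + |M.J 1 0| + |M.J 1 1|

theorem abs_J_le (u h : Fin 2) : |M.J u h| ≤ M.costBound := by
  have h1 := abs_nonneg (M.J 0 0)
  have h2 := abs_nonneg (M.J 0 1)
  have h3 := abs_nonneg (M.J 1 0)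
  have h4 := abs_nonneg (M.J 1 1)
  unfold costBound
  fin_cases u <;> fin_cases h <;> simp <;> linarith

theorem costBound_nonneg : 0 ≤ M.costBound := (abs_nonneg _).trans (M.abs_J_le 0 0)

theorem abs_stopCost_le (u : Fin 2) (p : Belief) : |M.stopCost u p| ≤ M.costBound := by
  have h0 := abs_le.1 (M.abs_J_le u 0)
  have h1 := abs_le.1 (M.abs_J_le u 1)
  have hp := p.2.1
  have hp' := p.2.2
  unfold stopCost
  rw [abs_le]
  constructor <;> nlinarith

theorem continuous_stopCost (u : Fin 2) : Continuous (M.stopCost u) := by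
  unfold stopCost
  fun_prop

theorem concave_stopCost (u : Fin 2) : ConcaveBelief (M.stopCost u) := by
  intro p q x a b ha hb hab hx
  have hb' : b = 1 - a := by linarith
  subst hb'
  simp only [stopCost, hx]
  apply le_of_eq; ring

theorem measurable_integral_bayes (t : ℕ) (h : Fin 2) {V : Belief → ℝ} (hV : Measurable V) :
    Measurable fun p => ∫ y, V (M.bayes t p y) ∂(M.P₂ t h) := by
  refine (StronglyMeasurable.integral_prod_right (f := fun p y => V (M.bayes t p y)) ?_).measurable
  simp only [bayes_eq]
  exact (hV.comp (measurable_bayesUpdate (M.P₂ t) (fun _ => 1))).stronglyMeasurable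

theorem measurable_contCost (t : ℕ) {V : Belief → ℝ} (hV : Measurable V) :
    Measurable (M.contCost t V) := by
  unfold contCost
  have hp : Measurable fun p : Belief => (p : ℝ) := measurable_subtype_coe
  exact measurable_const.add ((hp.mul (M.measurable_integral_bayes _ 0 hV)).add
    ((hp.const_sub 1).mul (M.measurable_integral_bayes _ 1 hV)))

theorem measurable_waldCost (n t : ℕ) : Measurable (M.waldCost n t) := by
  have hs := ((M.continuous_stopCost 0).measurable.min (M.continuous_stopCost 1).measurable)
  induction n generalizing t with
  | zero => exact hs
  | succ n ih => exact hs.min (M.measurable_contCost t (ih (t + 1)))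

theorem waldCost_le_stopCost (n t : ℕ) (u : Fin 2) (p : Belief) :
    M.waldCost n t p ≤ M.stopCost u p := by
  have : min (M.stopCost 0 p) (M.stopCost 1 p) ≤ M.stopCost u p := by
    fin_cases u
    · exact min_le_left _ _
    · exact min_le_right _ _
  cases n with
  | zero => exact this
  | succ n => exact (min_le_left _ _).trans this

theorem waldCost_succ_le_contCost (n t : ℕ) (p : Belief) :
    M.waldCost (n + 1) t p ≤ M.contCost t (M.waldCost n (t + 1)) p := min_le_right _ _

theorem integrable_bayes (t : ℕ) (p : Belief) {V : Belief → ℝ} (hV : Measurable V)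
    {C : ℝ} (hC : ∀ p, |V p| ≤ C) (ν : Measure 𝒴₂) [IsFiniteMeasure ν] :
    Integrable (fun y => V (M.bayes t p y)) ν := by
  refine Integrable.of_bound (C := C) ?_ (Filter.Eventually.of_forall fun y => hC _)
  simp only [bayes_eq]
  exact (hV.comp ((measurable_bayesUpdate (M.P₂ t) (fun _ => 1)).comp
    measurable_prodMk_left)).aestronglyMeasurable

theorem neg_le_contCost (hc₂ : 0 ≤ M.c₂) (t : ℕ) {V : Belief → ℝ} (hV : Measurable V)
    {C : ℝ} (hC : ∀ p, |V p| ≤ C) (p : Belief) : -C ≤ M.contCost t V p := by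
  have key : ∀ h, -C ≤ ∫ y, V (M.bayes (t + 1) p y) ∂(M.P₂ (t + 1) h) := fun h => by
    calc -C = ∫ _, -C ∂(M.P₂ (t + 1) h) := by simp
      _ ≤ _ := integral_mono (integrable_const _) (M.integrable_bayes _ p hV hC _)
        fun y => (abs_le.1 (hC _)).1
  have h0 := key 0
  have h1 := key 1
  have hp := p.2.1
  have hp' := p.2.2
  unfold contCost
  nlinarith

theorem abs_contCost_le (hc₂ : 0 ≤ M.c₂) (t : ℕ) {V : Belief → ℝ} (hV : Measurable V)
    {C : ℝ} (hC : ∀ p, |V p| ≤ C) (p : Belief) : |M.contCost t V p| ≤ M.c₂ + C := by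
  have h0 : 0 ≤ C := (abs_nonneg _).trans (hC p)
  have key : ∀ h, ∫ y, V (M.bayes (t + 1) p y) ∂(M.P₂ (t + 1) h) ≤ C := fun h => by
    calc _ ≤ ∫ _, C ∂(M.P₂ (t + 1) h) := integral_mono (M.integrable_bayes _ p hV hC _)
          (integrable_const _) fun y => (abs_le.1 (hC _)).2
      _ = C := by simp
  refine abs_le.2 ⟨by linarith [M.neg_le_contCost hc₂ t hV hC p], ?_⟩
  have h1 := key 0
  have h2 := key 1
  have hp := p.2.1
  have hp' := p.2.2
  unfold contCost
  nlinarith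

theorem abs_waldCost_le (hc₂ : 0 ≤ M.c₂) (n t : ℕ) (p : Belief) :
    |M.waldCost n t p| ≤ M.costBound := by
  have hmin : ∀ p, -M.costBound ≤ min (M.stopCost 0 p) (M.stopCost 1 p) := fun p =>
    le_min (abs_le.1 (M.abs_stopCost_le 0 p)).1 (abs_le.1 (M.abs_stopCost_le 1 p)).1
  induction n generalizing t p with
  | zero =>
    exact abs_le.2 ⟨hmin p, (M.waldCost_le_stopCost 0 t 0 p).trans
      (abs_le.1 (M.abs_stopCost_le 0 p)).2⟩
  | succ n ih =>
    refine abs_le.2 ⟨le_min (hmin p) ?_, (M.waldCost_le_stopCost _ t 0 p).trans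
      (abs_le.1 (M.abs_stopCost_le 0 p)).2⟩
    exact M.neg_le_contCost hc₂ t (M.measurable_waldCost n (t + 1)) (ih (t + 1)) p

/-- Over the common dominating measure the two conditional integrals merge into one against the
mixture density, so that concavity in `p` can be checked for each `y` separately. -/
theorem contCost_eq_integral (t : ℕ) {V : Belief → ℝ} (hV : Measurable V)
    {C : ℝ} (hC : ∀ p, |V p| ≤ C) (p : Belief) :
    (Integrable (fun y => ((p : ℝ) * M.lik (t + 1) 0 y + (1 - (p : ℝ)) * M.lik (t + 1) 1 y) *
      V (M.bayes (t + 1) p y)) (M.P₂ (t + 1) 0 + M.P₂ (t + 1) 1)) ∧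
    M.contCost t V p = M.c₂ +
      ∫ y, ((p : ℝ) * M.lik (t + 1) 0 y + (1 - (p : ℝ)) * M.lik (t + 1) 1 y) *
        V (M.bayes (t + 1) p y) ∂(M.P₂ (t + 1) 0 + M.P₂ (t + 1) 1) := by
  have hint : ∀ h, Integrable (fun y => M.lik (t + 1) h y * V (M.bayes (t + 1) p y))
      (M.P₂ (t + 1) 0 + M.P₂ (t + 1) 1) := fun h =>
    Integrable.mul_bdd (c := C) (integrable_likelihood (M.P₂ (t + 1)) h)
      (M.integrable_bayes _ p hV hC _).aestronglyMeasurable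
      (Filter.Eventually.of_forall fun y => hC _)
  have heq : (fun y => ((p : ℝ) * M.lik (t + 1) 0 y + (1 - (p : ℝ)) * M.lik (t + 1) 1 y) *
      V (M.bayes (t + 1) p y)) = fun y => (p : ℝ) * (M.lik (t + 1) 0 y * V (M.bayes (t + 1) p y))
        + (1 - (p : ℝ)) * (M.lik (t + 1) 1 y * V (M.bayes (t + 1) p y)) := by
    funext y; ring
  refine ⟨by rw [heq]; exact ((hint 0).const_mul _).add ((hint 1).const_mul _), ?_⟩
  rw [heq, integral_add ((hint 0).const_mul _) ((hint 1).const_mul _), integral_const_mul,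
    integral_const_mul]
  unfold contCost
  rw [integral_eq_likelihood, integral_eq_likelihood]
  rfl

/-- For fixed `y` the integrand is the perspective of `V`: the mixture density, affine in the
belief, times `V` at a quotient of two affine functions with that density as denominator.
Perspectives of concave functions are concave. -/
theorem concave_contCost (t : ℕ) {V : Belief → ℝ} (hV : Measurable V) {C : ℝ}
    (hC : ∀ p, |V p| ≤ C) (hconc : ConcaveBelief V) : ConcaveBelief (M.contCost t V) := by
  intro p q x a b ha hb hab hx
  obtain ⟨hip, hp⟩ := M.contCost_eq_integral t hV hC p
  obtain ⟨hiq, hq⟩ := M.contCost_eq_integral t hV hC q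
  obtain ⟨hix, hx'⟩ := M.contCost_eq_integral t hV hC x
  rw [hp, hq, hx']
  have hsum : ∀ u v : ℝ, a * (M.c₂ + u) + b * (M.c₂ + v) = M.c₂ + (a * u + b * v) := fun u v => by
    linear_combination M.c₂ * hab
  rw [hsum, ← integral_const_mul, ← integral_const_mul,
    ← integral_add (hip.const_mul _) (hiq.const_mul _)]
  refine add_le_add le_rfl (integral_mono ((hip.const_mul _).add (hiq.const_mul _)) hix fun y => ?_)
  simp only
  have l0 : 0 ≤ M.lik (t + 1) 0 y := ENNReal.toReal_nonneg
  have l1 : 0 ≤ M.lik (t + 1) 1 y := ENNReal.toReal_nonneg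
  set l0' := M.lik (t + 1) 0 y with hl0
  set l1' := M.lik (t + 1) 1 y with hl1
  have hpos : ∀ r : Belief, 0 ≤ (r : ℝ) * l0' + (1 - (r : ℝ)) * l1' := fun r =>
    add_nonneg (mul_nonneg r.2.1 l0) (mul_nonneg (by linarith [r.2.2]) l1)
  -- This also holds where the mixture density vanishes, because then `r * l0'` vanishes too.
  have hmul : ∀ r : Belief, ((r : ℝ) * l0' + (1 - (r : ℝ)) * l1') * (M.bayes (t + 1) r y : ℝ) =
      r * l0' := fun r => by
    rw [coe_bayes]
    rcases (hpos r).eq_or_lt with h | h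
    · have : (r : ℝ) * l0' = 0 := by
        have h1 := mul_nonneg r.2.1 l0
        have h2 : 0 ≤ (1 - (r : ℝ)) * l1' := mul_nonneg (by linarith [r.2.2]) l1
        linarith
      rw [← h, this, zero_mul]
    · rw [mul_div_cancel₀ _ h.ne']
  set dp := (p : ℝ) * l0' + (1 - (p : ℝ)) * l1' with hdp
  set dq := (q : ℝ) * l0' + (1 - (q : ℝ)) * l1' with hdq
  set dx := (x : ℝ) * l0' + (1 - (x : ℝ)) * l1' with hdx
  have hd : dx = a * dp + b * dq := by
    rw [hdx, hdp, hdq, hx]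
    linear_combination (-l1') * hab
  have hap : 0 ≤ a * dp := mul_nonneg ha (hpos p)
  have hbq : 0 ≤ b * dq := mul_nonneg hb (hpos q)
  have hdx0 : 0 ≤ dx := hpos x
  rcases hdx0.eq_or_lt with h | h
  · have h1 : a * dp = 0 := by linarith
    have h2 : b * dq = 0 := by linarith
    rw [← h, ← mul_assoc, ← mul_assoc, h1, h2]
    simp
  -- Given `y`, the updated belief of the mixture is a convex combination of the two updated
  -- beliefs, with the weights `a` and `b` reweighted by the densities of `y`.
  · have := hconc (M.bayes (t + 1) p y) (M.bayes (t + 1) q y) (M.bayes (t + 1) x y)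
      (a * dp / dx) (b * dq / dx) (by positivity) (by positivity)
      (by rw [← add_div, ← hd, div_self h.ne']) (by
        have h1 : dp * (M.bayes (t + 1) p y : ℝ) = p * l0' := hmul p
        have h2 : dq * (M.bayes (t + 1) q y : ℝ) = q * l0' := hmul q
        have h3 : dx * (M.bayes (t + 1) x y : ℝ) = x * l0' := hmul x
        have hne := h.ne'
        rw [div_mul_eq_mul_div, div_mul_eq_mul_div, ← add_div, eq_div_iff hne]
        linear_combination h3 - a * h1 - b * h2 + l0' * hx)
    have h2 := mul_le_mul_of_nonneg_left this h.le
    calc _ = dx * (a * dp / dx * V (M.bayes (t + 1) p y)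
        + b * dq / dx * V (M.bayes (t + 1) q y)) := by
          have hne := h.ne'
          field_simp
      _ ≤ _ := h2

theorem concave_waldCost (hc₂ : 0 ≤ M.c₂) (n t : ℕ) : ConcaveBelief (M.waldCost n t) := by
  have hs := (M.concave_stopCost 0).min (M.concave_stopCost 1)
  induction n generalizing t with
  | zero => exact hs
  | succ n ih =>
    exact hs.min (M.concave_contCost t (M.measurable_waldCost n (t + 1))
      (M.abs_waldCost_le hc₂ n (t + 1)) (ih (t + 1)))

/-- The update of the belief `1` is `1` only where the likelihood under `H = 0` is positive, that
is, almost surely under `H = 0`; the integral under `H = 1` has weight zero. -/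
theorem contCost_one (t : ℕ) (V : Belief → ℝ) : M.contCost t V 1 = M.c₂ + V 1 := by
  have : ∀ᵐ y ∂(M.P₂ (t + 1) 0), V (M.bayes (t + 1) 1 y) = V 1 := by
    filter_upwards [likelihood_pos_ae (M.P₂ (t + 1)) 0] with y hy
    have hy' : 0 < M.lik (t + 1) 0 y := hy
    congr 1
    refine Subtype.ext ?_
    rw [coe_bayes]
    simp [hy'.ne']
  unfold contCost
  rw [integral_congr_ae this]
  simp

/-- The numerator of Bayes' formula is zero, and so is `0 / 0`; hence, unlike at belief `1`, no null
set has to be removed. -/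
theorem contCost_zero (t : ℕ) (V : Belief → ℝ) : M.contCost t V 0 = M.c₂ + V 0 := by
  have : ∀ y, V (M.bayes (t + 1) 0 y) = V 0 := fun y => by
    congr 1
    refine Subtype.ext ?_
    rw [coe_bayes]
    simp
  unfold contCost
  simp [this]

/-- A certain belief is not changed by measurements, which cost `c₂ ≥ 0`, so stopping is optimal.
This and `waldCost_zero` place the endpoints in the stopping regions. -/
theorem waldCost_one (hc₂ : 0 ≤ M.c₂) (hJ₀ : M.J 0 0 ≤ M.J 1 0) (n t : ℕ) :
    M.waldCost n t 1 = M.stopCost 0 1 := by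
  have h : min (M.stopCost 0 1) (M.stopCost 1 1) = M.stopCost 0 1 :=
    min_eq_left (by simpa [stopCost] using hJ₀)
  induction n generalizing t with
  | zero => exact h
  | succ n ih =>
    rw [waldCost, h, contCost_one, ih]
    exact min_eq_left (by linarith)

theorem waldCost_zero (hc₂ : 0 ≤ M.c₂) (hJ₁ : M.J 1 1 ≤ M.J 0 1) (n t : ℕ) :
    M.waldCost n t 0 = M.stopCost 1 0 := by
  have h : min (M.stopCost 0 0) (M.stopCost 1 0) = M.stopCost 1 0 :=
    min_eq_right (by simpa [stopCost] using hJ₁)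
  induction n generalizing t with
  | zero => exact h
  | succ n ih =>
    rw [waldCost, h, contCost_zero, ih]
    exact min_eq_left (by linarith)

theorem concaveBelief_sub_stopCost {f : Belief → ℝ} (hf : ConcaveBelief f) (u : Fin 2) :
    ConcaveBelief (fun p => f p - M.stopCost u p) := by
  intro p q x a b ha hb hab hx
  have h1 := hf p q x a b ha hb hab hx
  have h2 : a * M.stopCost u p + b * M.stopCost u q = M.stopCost u x := by
    have hb' : b = 1 - a := by linarith
    subst hb'
    simp only [stopCost, hx]
    ring
  simp only
  linarith

/-- Optimal thresholds for a one-stage stopping problem with concave continuation cost. -/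
theorem exists_optimal_thresholds (hJ₀ : M.J 0 0 ≤ M.J 1 0) (hJ₁ : M.J 1 1 ≤ M.J 0 1)
    {C : Belief → ℝ} (hC : ConcaveBelief C) (hC0 : M.stopCost 1 0 ≤ C 0)
    (hC1 : M.stopCost 0 1 ≤ C 1) :
    ∃ g : TwoThr, ∀ p, (match rule2 False g p with
      | some u => M.stopCost u p
      | none => C p) = min (min (M.stopCost 0 p) (M.stopCost 1 p)) (C p) := by
  have hJ0 : M.stopCost 1 0 ≤ M.stopCost 0 0 := by simpa [stopCost] using hJ₁
  have hJ1 : M.stopCost 0 1 ≤ M.stopCost 1 1 := by simpa [stopCost] using hJ₀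
  -- Decision `1` is best where this function is nonnegative. It is concave since `stopCost 1` is
  -- affine. Because `C` is merely concave, the continuous majorant is the one obtained by ignoring
  -- `C`; at belief `1` nothing is lost, by `hC1`.
  obtain ⟨α, hα⟩ := exists_threshold
    (f := fun p => min (M.stopCost 0 p) (C p) - M.stopCost 1 p)
    (a := fun p => M.stopCost 0 p - M.stopCost 1 p)
    (M.concaveBelief_sub_stopCost ((M.concave_stopCost 0).min hC) 1)
    (sub_nonneg.2 (le_min hJ0 hC0))
    ((M.continuous_stopCost 0).sub (M.continuous_stopCost 1))
    (fun p => sub_le_sub_right (min_le_left _ _) _)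
    (fun h => sub_nonneg.2 (le_min (sub_nonneg.1 h)
      (le_trans (le_trans (sub_nonneg.1 h) le_rfl) hC1)))
  obtain ⟨β, hβ⟩ := exists_threshold_symm
    (f := fun p => min (M.stopCost 1 p) (C p) - M.stopCost 0 p)
    (a := fun p => M.stopCost 1 p - M.stopCost 0 p)
    (M.concaveBelief_sub_stopCost ((M.concave_stopCost 1).min hC) 0)
    (sub_nonneg.2 (le_min hJ1 hC1))
    ((M.continuous_stopCost 1).sub (M.continuous_stopCost 0))
    (fun p => sub_le_sub_right (min_le_left _ _) _)
    (fun h => sub_nonneg.2 (le_min (sub_nonneg.1 h)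
      (le_trans (sub_nonneg.1 h) hC0)))
  simp only [sub_nonneg, le_min_iff] at hα hβ
  -- The `max` secures the order of the thresholds and changes no decision: up to `α` the decision
  -- is `1` anyway, and above `α` the conditions `max α β ≤ p` and `β ≤ p` are equivalent.
  refine ⟨⟨α, max α β, α.2.1, le_max_left _ _, max_le α.2.2 β.2.2⟩, fun p => ?_⟩
  simp only [rule2, false_or]
  have hα' := hα p
  have hβ' := hβ p
  rw [← Subtype.coe_le_coe] at hα' hβ'
  by_cases h1 : (p : ℝ) ≤ α
  · have := hα'.2 h1
    rw [if_pos h1]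
    simp only
    rw [min_eq_right this.1, min_eq_left this.2]
  · rw [if_neg h1]
    have h1' : (α : ℝ) ≤ p := (not_le.1 h1).le
    by_cases h2 : (β : ℝ) ≤ p
    · have := hβ'.2 h2
      rw [if_pos (max_le h1' h2)]
      simp only
      rw [min_eq_left this.1, min_eq_left this.2]
    · rw [if_neg (fun h => h2 ((le_max_right _ _).trans h))]
      simp only
      have ha : ¬ (M.stopCost 1 p ≤ M.stopCost 0 p ∧ M.stopCost 1 p ≤ C p) := fun h => h1 (hα'.1 h)
      have hb : ¬ (M.stopCost 0 p ≤ M.stopCost 1 p ∧ M.stopCost 0 p ≤ C p) := fun h => h2 (hβ'.1 h)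
      rw [eq_comm, min_eq_right_iff]
      by_contra hlt
      rw [le_min_iff, not_and_or] at hlt
      rcases le_total (M.stopCost 0 p) (M.stopCost 1 p) with h | h
      · refine hb ⟨h, ?_⟩
        rcases hlt with hlt | hlt <;> linarith
      · refine ha ⟨h, ?_⟩
        rcases hlt with hlt | hlt <;> linarith

theorem exists_isWaldThr (hc₂ : 0 ≤ M.c₂) (hJ₀ : M.J 0 0 ≤ M.J 1 0) (hJ₁ : M.J 1 1 ≤ M.J 0 1)
    (n t : ℕ) : ∃ g, M.IsWaldThr n t g := by
  cases n with
  | zero =>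
    -- With no measurement left, `stopCost 0` plays the continuation cost: "continue" then means
    -- "decide `0`", which is what `rule2` does when it has to stop.
    obtain ⟨g, hg⟩ := M.exists_optimal_thresholds hJ₀ hJ₁ (M.concave_stopCost 0)
      (by simpa [stopCost] using hJ₁) le_rfl
    refine ⟨g, fun p => ?_⟩
    have := hg p
    rw [waldCost]
    rw [show min (min (M.stopCost 0 p) (M.stopCost 1 p)) (M.stopCost 0 p) =
      min (M.stopCost 0 p) (M.stopCost 1 p) from min_eq_left (min_le_left _ _)] at this
    rw [← this]
    simp only [rule2, true_or, if_true, false_or]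
    split_ifs <;> rfl
  | succ n =>
    obtain ⟨g, hg⟩ := M.exists_optimal_thresholds hJ₀ hJ₁
      (M.concave_contCost t (M.measurable_waldCost n (t + 1)) (M.abs_waldCost_le hc₂ n (t + 1))
        (M.concave_waldCost hc₂ n (t + 1)))
      (by rw [contCost_zero, M.waldCost_zero hc₂ hJ₁]; linarith)
      (by rw [contCost_one, M.waldCost_one hc₂ hJ₀]; linarith)
    refine ⟨g, fun p => ?_⟩
    have := hg p
    rw [rule2_congr (show n + 1 = 0 ↔ False by simp)]
    exact this

end Model

/-! ### Posterior probabilities -/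

section Posterior

variable {Ω : Type*} {m m₀ : MeasurableSpace Ω} {μ : Measure Ω} [IsProbabilityMeasure μ]
  {A : Set Ω}

theorem integrable_indicator_one (hA : MeasurableSet A) :
    Integrable (A.indicator fun _ => (1 : ℝ)) μ :=
  (integrable_const 1).indicator hA

theorem coe_posterior_ae (hm : m ≤ m₀) (hA : MeasurableSet A) :
    (fun ω => (posterior μ A m ω : ℝ)) =ᵐ[μ] μ[A.indicator fun _ => (1 : ℝ)|m] := by
  have h0 : 0 ≤ᵐ[μ] μ[A.indicator fun _ => (1 : ℝ)|m] :=
    condExp_nonneg (Filter.Eventually.of_forall fun ω =>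
      Set.indicator_nonneg (fun _ _ => zero_le_one) ω)
  have h1 : μ[A.indicator fun _ => (1 : ℝ)|m] ≤ᵐ[μ] μ[fun _ => (1 : ℝ)|m] :=
    condExp_mono (integrable_indicator_one hA) (integrable_const 1)
      (Filter.Eventually.of_forall fun ω =>
        Set.indicator_le_self' (fun _ _ => zero_le_one) ω)
  rw [condExp_const hm] at h1
  filter_upwards [h0, h1] with ω h0 h1
  unfold posterior
  rw [Set.projIcc_of_mem zero_le_one ⟨h0, h1⟩]

theorem setIntegral_posterior (hm : m ≤ m₀) (hA : MeasurableSet A) {S : Set Ω}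
    (hS : MeasurableSet[m] S) : ∫ ω in S, (posterior μ A m ω : ℝ) ∂μ = μ.real (S ∩ A) := by
  rw [integral_congr_ae (ae_restrict_of_ae (coe_posterior_ae hm hA)),
    setIntegral_condExp hm (integrable_indicator_one hA) hS, setIntegral_indicator hA]
  simp

theorem measurable_coe_posterior {μ : Measure Ω} (hm : m ≤ m₀) :
    Measurable fun ω => (posterior μ A m ω : ℝ) :=
  measurable_subtype_coe.comp ((measurable_posterior μ A m).mono hm le_rfl)

theorem integrable_posterior {μ : Measure Ω} (hm : m ≤ m₀) {ν : Measure Ω} [IsFiniteMeasure ν] :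
    Integrable (fun ω => (posterior μ A m ω : ℝ)) ν :=
  Integrable.of_bound (C := 1) (measurable_coe_posterior hm).aestronglyMeasurable
    (Filter.Eventually.of_forall fun ω => by
      rw [Real.norm_eq_abs, abs_of_nonneg (posterior μ A m ω).2.1]
      exact (posterior μ A m ω).2.2)

theorem setLIntegral_posterior (hm : m ≤ m₀) (hA : MeasurableSet A) {S : Set Ω}
    (hS : MeasurableSet[m] S) :
    ∫⁻ ω in S, ENNReal.ofReal (posterior μ A m ω) ∂μ = μ (S ∩ A) := by
  rw [← ofReal_integral_eq_lintegral_ofReal (integrable_posterior hm)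
    (Filter.Eventually.of_forall fun ω => (posterior μ A m ω).2.1),
    setIntegral_posterior hm hA hS, ofReal_measureReal]

theorem setLIntegral_one_sub_posterior (hm : m ≤ m₀) (hA : MeasurableSet A) {S : Set Ω}
    (hS : MeasurableSet[m] S) :
    ∫⁻ ω in S, ENNReal.ofReal (1 - posterior μ A m ω) ∂μ = μ (S ∩ Aᶜ) := by
  have hi : Integrable (fun ω => 1 - (posterior μ A m ω : ℝ)) (μ.restrict S) :=
    (integrable_const 1).sub (integrable_posterior hm)
  rw [← ofReal_integral_eq_lintegral_ofReal hi
    (Filter.Eventually.of_forall fun ω => sub_nonneg.2 (posterior μ A m ω).2.2),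
    integral_sub (integrable_const 1) (integrable_posterior hm),
    setIntegral_posterior hm hA hS]
  have : μ.real S = μ.real (S ∩ A) + μ.real (S ∩ Aᶜ) := by
    rw [← Set.sdiff_eq]
    exact (measureReal_inter_add_sdiff hA).symm
  simp [this]

/-- Integrals over `A` of functions measurable with respect to the conditioning `σ`-algebra. -/
theorem setIntegral_mul_posterior (hm : m ≤ m₀) (hA : MeasurableSet A) {f : Ω → ℝ}
    (hf : Measurable[m] f) {C : ℝ} (hC : ∀ ω, |f ω| ≤ C) :
    ∫ ω in A, f ω ∂μ = ∫ ω, posterior μ A m ω * f ω ∂μ := by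
  have hfi : Integrable (f * A.indicator fun _ => (1 : ℝ)) μ :=
    (integrable_indicator_one hA).bdd_mul (c := C) (hf.mono hm le_rfl).aestronglyMeasurable
      (Filter.Eventually.of_forall hC)
  have h := condExp_mul_of_stronglyMeasurable_left (μ := μ) (m := m) hf.stronglyMeasurable hfi
    (integrable_indicator_one hA)
  calc ∫ ω in A, f ω ∂μ = ∫ ω, (f * A.indicator fun _ => (1 : ℝ)) ω ∂μ := by
        rw [← integral_indicator hA]
        refine integral_congr_ae (Filter.Eventually.of_forall fun ω => ?_)
        by_cases hω : ω ∈ A <;> simp [hω]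
    _ = ∫ ω, (μ[f * A.indicator fun _ => (1 : ℝ)|m]) ω ∂μ := (integral_condExp hm).symm
    _ = ∫ ω, posterior μ A m ω * f ω ∂μ := by
        refine integral_congr_ae ?_
        filter_upwards [h, coe_posterior_ae (μ := μ) hm hA] with ω h1 h2
        rw [h1, h2, Pi.mul_apply, mul_comm]

theorem setIntegral_compl_mul_posterior (hm : m ≤ m₀) (hA : MeasurableSet A) {f : Ω → ℝ}
    (hf : Measurable[m] f) {C : ℝ} (hC : ∀ ω, |f ω| ≤ C) :
    ∫ ω in Aᶜ, f ω ∂μ = ∫ ω, (1 - posterior μ A m ω) * f ω ∂μ := by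
  have hfi : Integrable f μ := Integrable.of_bound (C := C)
    (hf.mono hm le_rfl).aestronglyMeasurable (Filter.Eventually.of_forall hC)
  have hpi : Integrable (fun ω => posterior μ A m ω * f ω) μ :=
    (integrable_posterior (A := A) hm).mul_bdd (c := C) hfi.aestronglyMeasurable
      (Filter.Eventually.of_forall hC)
  have h1 := integral_add_compl hA hfi
  rw [setIntegral_mul_posterior hm hA hf hC] at h1
  simp only [sub_mul, one_mul]
  rw [integral_sub hfi hpi]
  linarith

/-- Bayes' formula for the posterior of `A`, localized to an event `N`. -/
theorem posterior_eq_div {E : Type*} [MeasurableSpace E] (hm : m ≤ m₀) (hA : MeasurableSet A)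
    {N : Set Ω} (hN : MeasurableSet[m] N) {X : Ω → E} (hX : Measurable[m] X) {ν : Measure E}
    {f₀ f₁ : E → ℝ} (hf₀ : Measurable f₀) (hf₁ : Measurable f₁) (h₀ : ∀ x, 0 ≤ f₀ x)
    (h₁ : ∀ x, 0 ≤ f₁ x)
    (hν₀ : (μ.restrict (N ∩ A)).map X = ν.withDensity fun x => ENNReal.ofReal (f₀ x))
    (hν₁ : (μ.restrict (N ∩ Aᶜ)).map X = ν.withDensity fun x => ENNReal.ofReal (f₁ x))
    (htr : ∀ S, MeasurableSet[m] S → ∃ C, MeasurableSet C ∧ S ∩ N = X ⁻¹' C ∩ N) :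
    ∀ᵐ ω ∂μ, ω ∈ N → posterior μ A m ω =
      Set.projIcc 0 1 zero_le_one (f₀ (X ω) / (f₀ (X ω) + f₁ (X ω))) := by
  have hX' : Measurable X := hX.mono hm le_rfl
  set ρ : E → ℝ := fun x => f₀ x / (f₀ x + f₁ x) with hρ
  have hρm : Measurable ρ := hf₀.div (hf₀.add hf₁)
  have hρ0 : ∀ x, 0 ≤ ρ x := fun x => div_nonneg (h₀ x) (add_nonneg (h₀ x) (h₁ x))
  have hρ1 : ∀ x, ρ x ≤ 1 := fun x =>
    div_le_one_of_le₀ (by linarith [h₁ x]) (add_nonneg (h₀ x) (h₁ x))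
  have hgm : Measurable[m] (N.indicator fun ω => ρ (X ω)) := (hρm.comp hX).indicator hN
  have hρi : ∀ (ν' : Measure Ω) [IsFiniteMeasure ν'], Integrable (fun ω => ρ (X ω)) ν' :=
    fun ν' _ => Integrable.of_bound (C := 1) (hρm.comp hX').aestronglyMeasurable
      (Filter.Eventually.of_forall fun ω => by
        rw [Real.norm_eq_abs, abs_of_nonneg (hρ0 _)]; exact hρ1 _)
  have hAN := hA.inter (hm _ hN)
  have hdens : ∀ (f : E → ℝ) (D : Set Ω), Measurable f → (∀ x, 0 ≤ f x) → MeasurableSet D →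
      (μ.restrict D).map X = ν.withDensity (fun x => ENNReal.ofReal (f x)) →
      ∀ (C : Set E), MeasurableSet C → ∫⁻ ω in X ⁻¹' C ∩ D, ENNReal.ofReal (ρ (X ω)) ∂μ =
        ∫⁻ x in C, ENNReal.ofReal (f x) * ENNReal.ofReal (ρ x) ∂ν := by
    intro f D hf hf0 hD hmap C hC
    rw [← Measure.restrict_restrict (hX' hC), ← setLIntegral_map hC hρm.ennreal_ofReal hX', hmap,
      restrict_withDensity hC, lintegral_withDensity_eq_lintegral_mul _ hf.ennreal_ofReal
        hρm.ennreal_ofReal]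
    rfl
  -- The candidate is tested on events of `m`. Inside `N` these are events of `X` by `htr`, and
  -- there `(f₀ + f₁) * ρ = f₀`, also where the sum is zero.
  have key : N.indicator (fun ω => ρ (X ω)) =ᵐ[μ] μ[(N ∩ A).indicator fun _ => (1 : ℝ)|m] := by
    refine ae_eq_condExp_of_forall_setIntegral_eq hm
      (integrable_indicator_one ((hm _ hN).inter hA))
      (fun S _ _ => ((hρi μ).indicator (hm _ hN)).integrableOn) (fun S hS _ => ?_)
      hgm.aestronglyMeasurable
    obtain ⟨C, hC, hSC⟩ := htr S hS
    rw [setIntegral_indicator (hm _ hN), setIntegral_indicator ((hm _ hN).inter hA),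
      setIntegral_const, smul_eq_mul, mul_one, ← Set.inter_assoc, hSC,
      integral_eq_lintegral_of_nonneg_ae (Filter.Eventually.of_forall fun ω => hρ0 _)
        (hρm.comp hX').aestronglyMeasurable, Measure.real]
    congr 1
    have hdisj : Disjoint (X ⁻¹' C ∩ (N ∩ A)) (X ⁻¹' C ∩ (N ∩ Aᶜ)) :=
      Set.disjoint_left.2 fun ω h1 h2 => h2.2.2 h1.2.2
    have hun : X ⁻¹' C ∩ N = X ⁻¹' C ∩ (N ∩ A) ∪ X ⁻¹' C ∩ (N ∩ Aᶜ) := by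
      rw [← Set.inter_union_distrib_left, ← Set.inter_union_distrib_left, Set.union_compl_self,
        Set.inter_univ]
    rw [show X ⁻¹' C ∩ N ∩ A = X ⁻¹' C ∩ (N ∩ A) from Set.inter_assoc _ _ _, hun,
      lintegral_union ((hX' hC).inter ((hm _ hN).inter hA.compl)) hdisj,
      hdens f₀ _ hf₀ h₀ ((hm _ hN).inter hA) hν₀ C hC,
      hdens f₁ _ hf₁ h₁ ((hm _ hN).inter hA.compl) hν₁ C hC,
      ← lintegral_add_left (f := fun x => ENNReal.ofReal (f₀ x) * ENNReal.ofReal (ρ x))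
        (hf₀.ennreal_ofReal.mul hρm.ennreal_ofReal)]
    have : ∀ x, ENNReal.ofReal (f₀ x) * ENNReal.ofReal (ρ x) +
        ENNReal.ofReal (f₁ x) * ENNReal.ofReal (ρ x) = ENNReal.ofReal (f₀ x) := fun x => by
      rw [← add_mul, ← ENNReal.ofReal_add (h₀ x) (h₁ x),
        ← ENNReal.ofReal_mul (add_nonneg (h₀ x) (h₁ x))]
      congr 1
      rcases (add_nonneg (h₀ x) (h₁ x)).eq_or_lt with h | h
      · have : f₀ x = 0 := by linarith [h₀ x, h₁ x]
        rw [← h, this, zero_mul]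
      · exact mul_div_cancel₀ _ h.ne'
    simp only [this]
    rw [← withDensity_apply _ hC, ← hν₀, Measure.map_apply hX' hC,
      Measure.restrict_apply (hX' hC)]
  -- As `N` belongs to `m`, on `N` the conditional probabilities of `N ∩ A` and of `A` agree.
  have hind := condExp_indicator (μ := μ) (integrable_indicator_one (μ := μ) hA) hN
  rw [Set.indicator_indicator] at hind
  filter_upwards [key, hind] with ω h1 h2 hω
  rw [h2, Set.indicator_of_mem hω, Set.indicator_of_mem hω] at h1
  unfold posterior
  rw [← h1]

/-- Localized Bayes update of the posterior of `A`: on the event `N`, the information `m` consists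
of `W` and of the observation `Y`, which has the conditional law `r h • P h`. -/
theorem posterior_update {E 𝒴 : Type*} [MeasurableSpace E] [MeasurableSpace 𝒴] (hm : m ≤ m₀)
    (hA : MeasurableSet A) {B N : Set Ω} {W : Ω → E} {Y : Ω → 𝒴} (hW : Measurable[m] W)
    (hY : Measurable[m] Y) (hB : MeasurableSet[MeasurableSpace.comap W inferInstance] B)
    (hN : MeasurableSet[m] N) (P : Fin 2 → Measure 𝒴) [∀ h, IsProbabilityMeasure (P h)]
    {r : Fin 2 → ℝ} (hr : ∀ h, 0 ≤ r h)
    (h₀ : (μ.restrict (N ∩ A)).map (fun ω => (W ω, Y ω)) =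
      ((μ.restrict (B ∩ A)).map W).prod (ENNReal.ofReal (r 0) • P 0))
    (h₁ : (μ.restrict (N ∩ Aᶜ)).map (fun ω => (W ω, Y ω)) =
      ((μ.restrict (B ∩ Aᶜ)).map W).prod (ENNReal.ofReal (r 1) • P 1))
    (htr : ∀ S, MeasurableSet[m] S → ∃ C, MeasurableSet C ∧
      S ∩ N = (fun ω => (W ω, Y ω)) ⁻¹' C ∩ N) :
    ∀ᵐ ω ∂μ, ω ∈ N → posterior μ A m ω =
      bayesUpdate P r (posterior μ A (MeasurableSpace.comap W inferInstance) ω) (Y ω) := by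
  have hW' : Measurable W := hW.mono hm le_rfl
  have hc : MeasurableSpace.comap W inferInstance ≤ m₀ := hW'.comap_le
  -- The old posterior is a function `q` of `W`. So `q` and `1 - q` are the densities of the laws of
  -- `W` on `B ∩ A` and `B ∩ Aᶜ` with respect to its law on `B`; multiplied by the likelihoods of
  -- `Y` they give both joint laws as densities over one product measure.
  obtain ⟨q, hq, hqW⟩ := (measurable_posterior μ A
    (MeasurableSpace.comap W inferInstance)).exists_eq_measurable_comp
  have hqm : Measurable fun w => (q w : ℝ) := measurable_subtype_coe.comp hq
  have hdens : ∀ (D : Set Ω) (f : E → ℝ), Measurable f → MeasurableSet D →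
      (∀ S, MeasurableSet[MeasurableSpace.comap W inferInstance] S →
        ∫⁻ ω in S, ENNReal.ofReal (f (W ω)) ∂μ = μ (S ∩ D)) →
      (μ.restrict (B ∩ D)).map W =
        ((μ.restrict B).map W).withDensity fun w => ENNReal.ofReal (f w) := by
    intro D f hf hD h
    ext C hC
    rw [Measure.map_apply hW' hC, Measure.restrict_apply (hW' hC), withDensity_apply _ hC,
      setLIntegral_map hC hf.ennreal_ofReal hW', Measure.restrict_restrict (hW' hC),
      h _ (MeasurableSet.inter ⟨C, hC, rfl⟩ hB), Set.inter_assoc]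
  have hd₀ := hdens A (fun w => q w) hqm hA fun S hS => by
    rw [← setLIntegral_posterior hc hA hS, hqW]; rfl
  have hd₁ := hdens Aᶜ (fun w => 1 - q w) (hqm.const_sub 1) hA.compl fun S hS => by
    rw [← setLIntegral_one_sub_posterior hc hA hS, hqW]; rfl
  have hP : ∀ h, ENNReal.ofReal (r h) • P h =
      (P 0 + P 1).withDensity fun y => ENNReal.ofReal (r h * likelihood P h y) := fun h => by
    conv_lhs => rw [← withDensity_likelihood P h,
      ← withDensity_smul _ (measurable_likelihood P h).ennreal_ofReal]
    congr 1
    funext y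
    rw [ENNReal.ofReal_mul (hr h)]
    rfl
  have hlm : ∀ h, Measurable fun y => r h * likelihood P h y :=
    fun h => (measurable_likelihood P h).const_mul _
  rw [hd₀, hP, prod_withDensity hqm.ennreal_ofReal (hlm 0).ennreal_ofReal] at h₀
  rw [hd₁, hP, prod_withDensity (hqm.const_sub 1).ennreal_ofReal (hlm 1).ennreal_ofReal] at h₁
  have := posterior_eq_div (μ := μ) hm hA hN (hW.prodMk hY)
    (ν := ((μ.restrict B).map W).prod (P 0 + P 1))
    (f₀ := fun z => q z.1 * (r 0 * likelihood P 0 z.2))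
    (f₁ := fun z => (1 - q z.1) * (r 1 * likelihood P 1 z.2))
    ((hqm.comp measurable_fst).mul ((hlm 0).comp measurable_snd))
    (((hqm.const_sub 1).comp measurable_fst).mul ((hlm 1).comp measurable_snd))
    (fun z => mul_nonneg (q z.1).2.1 (mul_nonneg (hr 0) (likelihood_nonneg _ _ _)))
    (fun z => mul_nonneg (sub_nonneg.2 (q z.1).2.2) (mul_nonneg (hr 1) (likelihood_nonneg _ _ _)))
    (by rw [h₀]; congr 1; funext z; rw [ENNReal.ofReal_mul (q z.1).2.1])
    (by rw [h₁]; congr 1; funext z; rw [ENNReal.ofReal_mul (sub_nonneg.2 (q z.1).2.2)])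
    htr
  filter_upwards [this] with ω hω hωN
  rw [hω hωN, hqW]
  rfl

end Posterior

/-- Applied with `m₁` all observations of one observer, `m₂` the past and `m₃` the next observation
of the other. Intersections of sets from `m₁` and `m₂` form a generating π-system, on which the
probability factors in two steps. -/
theorem indep_sup_of_indep_sup {Ω : Type*} {m₁ m₂ m₃ m₀ : MeasurableSpace Ω} {μ : Measure Ω}
    [IsProbabilityMeasure μ] (h₁ : m₁ ≤ m₀) (h₂ : m₂ ≤ m₀) (h₃ : m₃ ≤ m₀)
    (h : Indep m₁ (m₂ ⊔ m₃) μ) (h' : Indep m₂ m₃ μ) : Indep (m₁ ⊔ m₂) m₃ μ := by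
  refine IndepSets.indep (p1 := {s | ∃ A B, MeasurableSet[m₁] A ∧ MeasurableSet[m₂] B ∧ s = A ∩ B})
    (p2 := {s | MeasurableSet[m₃] s}) (sup_le h₁ h₂) h₃ ?_
    (@MeasurableSpace.isPiSystem_measurableSet _ m₃) ?_
    (@MeasurableSpace.generateFrom_measurableSet _ m₃).symm ?_
  · rintro _ ⟨A, B, hA, hB, rfl⟩ _ ⟨A', B', hA', hB', rfl⟩ -
    exact ⟨A ∩ A', B ∩ B', hA.inter hA', hB.inter hB', Set.inter_inter_inter_comm _ _ _ _⟩
  · refine le_antisymm (sup_le ?_ ?_) (MeasurableSpace.generateFrom_le ?_)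
    · exact fun A hA => MeasurableSpace.measurableSet_generateFrom
        ⟨A, Set.univ, hA, MeasurableSet.univ, (Set.inter_univ A).symm⟩
    · exact fun B hB => MeasurableSpace.measurableSet_generateFrom
        ⟨Set.univ, B, MeasurableSet.univ, hB, (Set.univ_inter B).symm⟩
    · rintro _ ⟨A, B, hA, hB, rfl⟩
      exact MeasurableSet.inter ((le_sup_left : m₁ ≤ m₁ ⊔ m₂) _ hA)
        ((le_sup_right : m₂ ≤ m₁ ⊔ m₂) _ hB)
  · rw [IndepSets_iff]
    rintro _ C ⟨A, B, hA, hB, rfl⟩ hC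
    have hB' := (le_sup_left : m₂ ≤ m₂ ⊔ m₃) _ hB
    have hC' := (le_sup_right : m₃ ≤ m₂ ⊔ m₃) _ hC
    rw [Indep_iff] at h h'
    rw [Set.inter_assoc, h A _ hA (MeasurableSet.inter hB' hC'), h' B C hB hC, h A B hA hB',
      mul_assoc]

namespace Model

variable {Ω 𝒴₁ 𝒴₂ : Type*} [MeasurableSpace Ω] [MeasurableSpace 𝒴₁] [MeasurableSpace 𝒴₂]
variable (M : Model Ω 𝒴₁ 𝒴₂)

/-! ### Conditional independence of the observations -/

/-- The information in all observations of O1. -/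
abbrev allObs₁ : MeasurableSpace Ω := MeasurableSpace.comap (fun ω t => M.Y₁ t ω) inferInstance

/-- The information in all observations of O2. -/
abbrev allObs₂ : MeasurableSpace Ω := MeasurableSpace.comap (fun ω t => M.Y₂ t ω) inferInstance

theorem allObs₁_le : M.allObs₁ ≤ (inferInstance : MeasurableSpace Ω) :=
  (measurable_pi_lambda _ fun t => M.meas_Y₁ t).comap_le

theorem allObs₂_le : M.allObs₂ ≤ (inferInstance : MeasurableSpace Ω) :=
  (measurable_pi_lambda _ fun t => M.meas_Y₂ t).comap_le

theorem comap_Y₁_le (t : ℕ) : MeasurableSpace.comap (M.Y₁ t) inferInstance ≤ M.allObs₁ :=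
  ((measurable_pi_apply t).comp (comap_measurable fun ω t => M.Y₁ t ω)).comap_le

theorem comap_Y₂_le (t : ℕ) : MeasurableSpace.comap (M.Y₂ t) inferInstance ≤ M.allObs₂ :=
  ((measurable_pi_apply t).comp (comap_measurable fun ω t => M.Y₂ t ω)).comap_le

theorem obs₁_le_all (t : ℕ) : M.obs₁ t ≤ M.allObs₁ := iSup₂_le fun s _ => M.comap_Y₁_le s

theorem obs₂_le_all (t : ℕ) : M.obs₂ t ≤ M.allObs₂ := iSup₂_le fun s _ => M.comap_Y₂_le s

theorem measurableSet_H (h : Fin 2) : MeasurableSet (M.H ⁻¹' {h}) :=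
  M.meas_H (measurableSet_singleton h)

theorem compl_H : (M.H ⁻¹' {0})ᶜ = M.H ⁻¹' {1} := by
  ext ω
  simp only [Set.mem_compl_iff, Set.mem_preimage, Set.mem_singleton_iff]
  omega

theorem indep_allObs {h : Fin 2} (hh : M.μ (M.H ⁻¹' {h}) ≠ 0) :
    Indep M.allObs₁ M.allObs₂ M.μ[|M.H ⁻¹' {h}] :=
  (IndepFun_iff_Indep _ _ _).1 (M.indep₁₂ h hh)

theorem indep_obs₁_succ {h : Fin 2} (hh : M.μ (M.H ⁻¹' {h}) ≠ 0) (t : ℕ) :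
    Indep (M.obs₁ t) (MeasurableSpace.comap (M.Y₁ (t + 1)) inferInstance) M.μ[|M.H ⁻¹' {h}] := by
  have := indep_iSup_of_disjoint (fun i => (M.meas_Y₁ i).comap_le)
    ((iIndepFun_iff_iIndep _ _ _).1 (M.indep₁ h hh)) (S := {i | i ∈ Finset.Icc 1 t}) (T := {t + 1})
    (by simp)
  simp only [Set.mem_singleton_iff, iSup_iSup_eq_left] at this
  exact this

theorem indep_obs₂_succ {h : Fin 2} (hh : M.μ (M.H ⁻¹' {h}) ≠ 0) (t : ℕ) :
    Indep (M.obs₂ t) (MeasurableSpace.comap (M.Y₂ (t + 1)) inferInstance) M.μ[|M.H ⁻¹' {h}] := by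
  have := indep_iSup_of_disjoint (fun i => (M.meas_Y₂ i).comap_le)
    ((iIndepFun_iff_iIndep _ _ _).1 (M.indep₂ h hh)) (S := {i | i ∈ Finset.Icc 1 t}) (T := {t + 1})
    (by simp)
  simp only [Set.mem_singleton_iff, iSup_iSup_eq_left] at this
  exact this

variable {M}

theorem isProbabilityMeasure_cond_H {h : Fin 2} (hh : M.μ (M.H ⁻¹' {h}) ≠ 0) :
    IsProbabilityMeasure M.μ[|M.H ⁻¹' {h}] := cond_isProbabilityMeasure hh

theorem mul_cond_H (h : Fin 2) (S : Set Ω) :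
    M.μ (S ∩ M.H ⁻¹' {h}) = M.μ (M.H ⁻¹' {h}) * M.μ[|M.H ⁻¹' {h}] S := by
  rw [mul_comm, cond_mul_eq_inter (M.measurableSet_H h), Set.inter_comm]

theorem measure_inter_H_eq_zero {h : Fin 2} (hh : M.μ (M.H ⁻¹' {h}) = 0) (S : Set Ω) :
    M.μ (S ∩ M.H ⁻¹' {h}) = 0 := measure_mono_null Set.inter_subset_right hh

/-- The event `A` may involve all observations of O1, later ones included. Therefore one can
condition on O1's message at `t + 1` before drawing O2's measurement at `t + 1`. If `H = h` is null
the model says nothing about the law, but both sides are zero. -/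
theorem measure_inter_Y₂ (h : Fin 2) (t : ℕ) {A : Set Ω}
    (hA : MeasurableSet[M.allObs₁ ⊔ M.obs₂ t] A) {C : Set 𝒴₂} (hC : MeasurableSet C) :
    M.μ (A ∩ M.Y₂ (t + 1) ⁻¹' C ∩ M.H ⁻¹' {h}) =
      M.μ (A ∩ M.H ⁻¹' {h}) * M.P₂ (t + 1) h C := by
  by_cases hh : M.μ (M.H ⁻¹' {h}) = 0
  · simp [measure_inter_H_eq_zero hh]
  have := isProbabilityMeasure_cond_H hh
  have hi := indep_sup_of_indep_sup M.allObs₁_le (M.obs₂_le t) (M.meas_Y₂ (t + 1)).comap_le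
    (indep_of_indep_of_le_right (M.indep_allObs hh)
      (sup_le (M.obs₂_le_all t) (M.comap_Y₂_le (t + 1)))) (M.indep_obs₂_succ hh t)
  rw [Indep_iff] at hi
  rw [mul_cond_H, mul_cond_H, hi A _ hA ⟨C, hC, rfl⟩, ← M.law₂ (t + 1) h hh,
    Measure.map_apply (M.meas_Y₂ _) hC, mul_assoc]

theorem measure_inter_Y₁ (h : Fin 2) (t : ℕ) {A : Set Ω}
    (hA : MeasurableSet[M.allObs₂ ⊔ M.obs₁ t] A) {C : Set 𝒴₁} (hC : MeasurableSet C) :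
    M.μ (A ∩ M.Y₁ (t + 1) ⁻¹' C ∩ M.H ⁻¹' {h}) =
      M.μ (A ∩ M.H ⁻¹' {h}) * M.P₁ (t + 1) h C := by
  by_cases hh : M.μ (M.H ⁻¹' {h}) = 0
  · simp [measure_inter_H_eq_zero hh]
  have := isProbabilityMeasure_cond_H hh
  have hi := indep_sup_of_indep_sup M.allObs₂_le (M.obs₁_le t) (M.meas_Y₁ (t + 1)).comap_le
    (indep_of_indep_of_le_right (M.indep_allObs hh).symm
      (sup_le (M.obs₁_le_all t) (M.comap_Y₁_le (t + 1)))) (M.indep_obs₁_succ hh t)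
  rw [Indep_iff] at hi
  rw [mul_cond_H, mul_cond_H, hi A _ hA ⟨C, hC, rfl⟩, ← M.law₁ (t + 1) h hh,
    Measure.map_apply (M.meas_Y₁ _) hC, mul_assoc]

/-- Conditional independence given `H = h`, multiplied by the square of the probability of `H = h`
so that null hypotheses need not be excluded. -/
theorem measure_inter_obs (h : Fin 2) {A B : Set Ω} (hA : MeasurableSet[M.allObs₁] A)
    (hB : MeasurableSet[M.allObs₂] B) : M.μ (A ∩ B ∩ M.H ⁻¹' {h}) * M.μ (M.H ⁻¹' {h}) =
      M.μ (A ∩ M.H ⁻¹' {h}) * M.μ (B ∩ M.H ⁻¹' {h}) := by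
  by_cases hh : M.μ (M.H ⁻¹' {h}) = 0
  · simp [measure_inter_H_eq_zero hh]
  have hi := M.indep_allObs hh
  rw [Indep_iff] at hi
  rw [mul_cond_H, mul_cond_H, mul_cond_H, hi A B hA hB]
  ring

/-- The joint law of `V` and the next observation of O2 on an event, given `H = h`. -/
theorem map_prodMk_Y₂ (h : Fin 2) (t : ℕ) {E : Type*} [MeasurableSpace E] {V : Ω → E}
    (hV : Measurable[M.allObs₁ ⊔ M.obs₂ t] V) {A : Set Ω}
    (hA : MeasurableSet[M.allObs₁ ⊔ M.obs₂ t] A) :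
    (M.μ.restrict (A ∩ M.H ⁻¹' {h})).map (fun ω => (V ω, M.Y₂ (t + 1) ω)) =
      ((M.μ.restrict (A ∩ M.H ⁻¹' {h})).map V).prod (M.P₂ (t + 1) h) := by
  have hV' : Measurable V := hV.mono (sup_le M.allObs₁_le (M.obs₂_le t)) le_rfl
  refine (Measure.prod_eq fun S C hS hC => ?_).symm
  rw [Measure.map_apply (hV'.prodMk (M.meas_Y₂ _)) (hS.prod hC), Measure.map_apply hV' hS,
    Measure.restrict_apply ((hV'.prodMk (M.meas_Y₂ _)) (hS.prod hC)),
    Measure.restrict_apply (hV' hS), ← Set.inter_assoc, ← Set.inter_assoc,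
    ← measure_inter_Y₂ h t (MeasurableSet.inter (hV hS) hA) hC, Set.mk_preimage_prod]
  congr 2
  exact Set.inter_right_comm _ _ _

/-- The joint law of `V` and the next observation of O1 on an event, given `H = h`. -/
theorem map_prodMk_Y₁ (h : Fin 2) (t : ℕ) {E : Type*} [MeasurableSpace E] {V : Ω → E}
    (hV : Measurable[M.allObs₂ ⊔ M.obs₁ t] V) {A : Set Ω}
    (hA : MeasurableSet[M.allObs₂ ⊔ M.obs₁ t] A) :
    (M.μ.restrict (A ∩ M.H ⁻¹' {h})).map (fun ω => (V ω, M.Y₁ (t + 1) ω)) =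
      ((M.μ.restrict (A ∩ M.H ⁻¹' {h})).map V).prod (M.P₁ (t + 1) h) := by
  have hV' : Measurable V := hV.mono (sup_le M.allObs₂_le (M.obs₁_le t)) le_rfl
  refine (Measure.prod_eq fun S C hS hC => ?_).symm
  rw [Measure.map_apply (hV'.prodMk (M.meas_Y₁ _)) (hS.prod hC), Measure.map_apply hV' hS,
    Measure.restrict_apply ((hV'.prodMk (M.meas_Y₁ _)) (hS.prod hC)),
    Measure.restrict_apply (hV' hS), ← Set.inter_assoc, ← Set.inter_assoc,
    ← measure_inter_Y₁ h t (MeasurableSet.inter (hV hS) hA) hC, Set.mk_preimage_prod]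
  congr 2
  exact Set.inter_right_comm _ _ _

end Model

/-- Presents the information of finitely many times as that of a single random element, the form in
which `posterior_update` takes the past. -/
theorem comap_finset_pi {Ω E : Type*} [MeasurableSpace E] (I : Finset ℕ) (X : ℕ → Ω → E) :
    MeasurableSpace.comap (fun ω (s : I) => X s ω) inferInstance =
      ⨆ s ∈ I, MeasurableSpace.comap (X s) inferInstance := by
  refine le_antisymm ?_ (iSup₂_le fun s hs => ?_)
  · refine Measurable.comap_le (@measurable_pi_lambda _ _ _ (_) _ _ fun s => ?_)
    rw [measurable_iff_comap_le]
    exact le_iSup₂ (f := fun s _ => MeasurableSpace.comap (X s) inferInstance) s.1 s.2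
  · exact ((measurable_pi_apply (⟨s, hs⟩ : I)).comp
      (comap_measurable fun ω (s : I) => X s ω)).comap_le

namespace Model

variable {Ω 𝒴₁ 𝒴₂ : Type*} [MeasurableSpace Ω] [MeasurableSpace 𝒴₁] [MeasurableSpace 𝒴₂]
variable {M : Model Ω 𝒴₁ 𝒴₂}

/-! ### Recursions for the beliefs -/

theorem belief₁_succ (t : ℕ) : ∀ᵐ ω ∂M.μ, M.belief₁ (t + 1) ω =
    bayesUpdate (M.P₁ (t + 1)) (fun _ => 1) (M.belief₁ t ω) (M.Y₁ (t + 1) ω) := by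
  set W : Ω → (Finset.Icc 1 t → 𝒴₁) := fun ω s => M.Y₁ s ω with hW
  have hWc : MeasurableSpace.comap W inferInstance = M.obs₁ t := comap_finset_pi _ M.Y₁
  have hWm : Measurable[M.obs₁ t] W := by rw [measurable_iff_comap_le, hWc]
  have hY : Measurable[M.obs₁ (t + 1)] (M.Y₁ (t + 1)) := by
    rw [measurable_iff_comap_le]
    exact le_iSup₂ (f := fun s _ => MeasurableSpace.comap (M.Y₁ s) inferInstance) (t + 1)
      (by simp)
  have hlaw : ∀ h, (M.μ.restrict (Set.univ ∩ M.H ⁻¹' {h})).map (fun ω => (W ω, M.Y₁ (t + 1) ω)) =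
      ((M.μ.restrict (Set.univ ∩ M.H ⁻¹' {h})).map W).prod
        (ENNReal.ofReal ((fun _ => 1 : Fin 2 → ℝ) h) • M.P₁ (t + 1) h) := fun h => by
    rw [ENNReal.ofReal_one, one_smul]
    exact map_prodMk_Y₁ h t (hWm.mono le_sup_right le_rfl) MeasurableSet.univ
  have := posterior_update (μ := M.μ) (m := M.obs₁ (t + 1)) (W := W) (Y := M.Y₁ (t + 1))
    (A := M.H ⁻¹' {0}) (B := Set.univ) (N := Set.univ)
    (M.obs₁_le (t + 1)) (M.measurableSet_H 0) (hWm.mono (M.obs₁_mono (by omega)) le_rfl) hY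
    MeasurableSet.univ MeasurableSet.univ (M.P₁ (t + 1)) (r := fun _ => 1)
    (fun _ => zero_le_one) (hlaw 0) (by rw [compl_H]; exact hlaw 1) (fun S hS => by
      have hle : M.obs₁ (t + 1) ≤
          MeasurableSpace.comap (fun ω => (W ω, M.Y₁ (t + 1) ω)) inferInstance := by
        refine iSup₂_le fun s hs => ?_
        rw [Finset.mem_Icc] at hs
        rcases Nat.lt_succ_iff_lt_or_eq.1 (Nat.lt_succ_of_le hs.2) with h | rfl
        · exact ((measurable_pi_apply
            (⟨s, Finset.mem_Icc.2 ⟨hs.1, by omega⟩⟩ : Finset.Icc 1 t)).comp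
            (measurable_fst.comp (comap_measurable fun ω => (W ω, M.Y₁ (t + 1) ω)))).comap_le
        · exact (measurable_snd.comp
            (comap_measurable fun ω => (W ω, M.Y₁ (t + 1) ω))).comap_le
      obtain ⟨C, hC, rfl⟩ := hle S hS
      exact ⟨C, hC, rfl⟩)
  rw [hWc] at this
  filter_upwards [this] with ω hω
  exact hω trivial

/-- Update of the belief of O2 on an event on which the past messages are known. -/
theorem rawBelief₂_update (hT₁ : 1 ≤ M.T₁) (d : Design) (t : ℕ) (z : Symb) {B : Set Ω}
    (hB : MeasurableSet[M.info₂ d t] B) (hB₁ : MeasurableSet[M.allObs₁] B) (ζ : ℕ → Symb)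
    (hζ : ∀ s ∈ Finset.Icc 1 t, ∀ ω ∈ B, M.Z d s ω = ζ s) {r : Fin 2 → ℝ} (hr : ∀ h, 0 ≤ r h)
    (hrB : ∀ h, M.μ (B ∩ {ω | M.Z d (t + 1) ω = z} ∩ M.H ⁻¹' {h}) =
      ENNReal.ofReal (r h) * M.μ (B ∩ M.H ⁻¹' {h})) :
    ∀ᵐ ω ∂M.μ, ω ∈ B ∩ {ω | M.Z d (t + 1) ω = z} → M.rawBelief₂ d (t + 1) ω =
      bayesUpdate (M.P₂ (t + 1)) r (M.rawBelief₂ d t ω) (M.Y₂ (t + 1) ω) := by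
  set W : Ω → (Finset.Icc 1 t → 𝒴₂ × Symb) := fun ω s => (M.Y₂ s ω, M.Z d s ω) with hW
  have hWc : MeasurableSpace.comap W inferInstance = M.info₂ d t := by
    rw [hW, comap_finset_pi (Finset.Icc 1 t) (fun s ω => (M.Y₂ s ω, M.Z d s ω))]
    exact iSup_congr fun s => iSup_congr fun _ => MeasurableSpace.comap_prodMk _ _
  have hWm : Measurable[M.info₂ d t] W := by rw [measurable_iff_comap_le, hWc]
  have hWm' : Measurable[M.allObs₁ ⊔ M.obs₂ t] W :=
    hWm.mono ((info₂_le_sup hT₁ d t).trans (sup_le_sup_right (M.obs₁_le_all t) _)) le_rfl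
  have hW0 : Measurable W := hWm.mono (info₂_le hT₁ d t) le_rfl
  set N := B ∩ {ω | M.Z d (t + 1) ω = z} with hN
  have hZm : MeasurableSet[M.allObs₁] {ω | M.Z d (t + 1) ω = z} :=
    M.obs₁_le_all (t + 1) _ (measurable_Z hT₁ d (t + 1) (measurableSet_singleton z))
  have hN₁ : MeasurableSet[M.allObs₁] N := MeasurableSet.inter hB₁ hZm
  have hlaw : ∀ h, (M.μ.restrict (N ∩ M.H ⁻¹' {h})).map (fun ω => (W ω, M.Y₂ (t + 1) ω)) =
      ((M.μ.restrict (B ∩ M.H ⁻¹' {h})).map W).prod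
        (ENNReal.ofReal (r h) • M.P₂ (t + 1) h) := fun h => by
    rw [map_prodMk_Y₂ h t hWm' ((le_sup_left : _ ≤ M.allObs₁ ⊔ M.obs₂ t) _ hN₁),
      Measure.prod_smul_right, ← Measure.prod_smul_left]
    congr 1
    ext S hS
    rw [Measure.smul_apply, Measure.map_apply hW0 hS, Measure.map_apply hW0 hS,
      Measure.restrict_apply (hW0 hS), Measure.restrict_apply (hW0 hS), smul_eq_mul]
    by_cases hh : M.μ (M.H ⁻¹' {h}) = 0
    · have h0 : ∀ D, M.μ (W ⁻¹' S ∩ (D ∩ M.H ⁻¹' {h})) = 0 := fun D => by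
        rw [← Set.inter_assoc]
        exact measure_inter_H_eq_zero hh _
      rw [h0, h0, mul_zero]
    -- On `B` the past messages are the constants `ζ`, so an event of `W` turns into an event of
    -- O2's observations alone.
    set S' : Set Ω := {ω | (fun s : Finset.Icc 1 t => (M.Y₂ s ω, ζ s)) ∈ S} with hS'
    have hS'm : MeasurableSet[M.allObs₂] S' := by
      have : Measurable[M.allObs₂] fun ω (s : Finset.Icc 1 t) => (M.Y₂ s ω, ζ s) := by
        refine @measurable_pi_lambda _ _ _ (M.allObs₂) _ _ fun s => ?_
        exact Measurable.prodMk (measurable_iff_comap_le.2 (M.comap_Y₂_le s)) measurable_const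
      exact this hS
    have hWS : ∀ D ⊆ B, W ⁻¹' S ∩ (D ∩ M.H ⁻¹' {h}) = D ∩ S' ∩ M.H ⁻¹' {h} := by
      intro D hD
      ext ω
      simp only [Set.mem_inter_iff, Set.mem_preimage]
      have : ω ∈ D → (W ω ∈ S ↔ ω ∈ S') := fun hω => by
        have : W ω = fun s : Finset.Icc 1 t => (M.Y₂ s ω, ζ s) := funext fun s => by
          rw [hW, ← hζ s s.2 ω (hD hω)]
        rw [this]; rfl
      tauto
    rw [hWS N Set.inter_subset_left, hWS B le_rfl]
    -- Given `H`, the event `S'` is independent of both `N` and `B`; hence restricting to `S'`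
    -- leaves the ratio `r h` of their probabilities unchanged.
    have h1 := measure_inter_obs h hN₁ hS'm
    have h2 := measure_inter_obs h hB₁ hS'm
    rw [hrB h, mul_assoc, ← h2, ← mul_assoc] at h1
    exact (ENNReal.mul_left_inj hh (measure_ne_top _ _)).1 h1
  have := posterior_update (μ := M.μ) (m := M.info₂ d (t + 1)) (W := W) (Y := M.Y₂ (t + 1))
    (A := M.H ⁻¹' {0}) (B := B) (N := N)
    (info₂_le hT₁ d (t + 1)) (M.measurableSet_H 0) (hWm.mono (M.info₂_mono d (by omega)) le_rfl)
    (measurable_Y₂_info d (by omega) le_rfl) (by rw [hWc]; exact hB)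
    (MeasurableSet.inter (M.info₂_mono d (by omega) _ hB)
      (measurable_Z_info d (by omega) le_rfl (measurableSet_singleton z)))
    (M.P₂ (t + 1)) hr (hlaw 0) (by rw [compl_H]; exact hlaw 1) (fun S hS => by
      have hle : M.info₂ d (t + 1) ≤ MeasurableSpace.comap
          (fun ω => ((W ω, M.Y₂ (t + 1) ω), M.Z d (t + 1) ω)) inferInstance := by
        have hc : Measurable[MeasurableSpace.comap (fun ω =>
            ((W ω, M.Y₂ (t + 1) ω), M.Z d (t + 1) ω)) inferInstance]
            (fun ω => ((W ω, M.Y₂ (t + 1) ω), M.Z d (t + 1) ω)) := comap_measurable _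
        refine iSup₂_le fun s hs => ?_
        rw [Finset.mem_Icc] at hs
        rcases Nat.lt_succ_iff_lt_or_eq.1 (Nat.lt_succ_of_le hs.2) with h | rfl
        · have hc' := (measurable_pi_apply
            (⟨s, Finset.mem_Icc.2 ⟨hs.1, by omega⟩⟩ : Finset.Icc 1 t)).comp
            (measurable_fst.comp (measurable_fst.comp hc))
          exact sup_le (measurable_fst.comp hc').comap_le (measurable_snd.comp hc').comap_le
        · exact sup_le (measurable_snd.comp (measurable_fst.comp hc)).comap_le
            (measurable_snd.comp hc).comap_le
      obtain ⟨C, hC, rfl⟩ := hle S hS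
      -- On `N` the new message is the constant `z`, so the section of `C` at `z` describes the same
      -- event.
      refine ⟨{x | (x, z) ∈ C}, measurable_prodMk_right hC, ?_⟩
      ext ω
      simp only [Set.mem_inter_iff, Set.mem_preimage]
      refine and_congr_left fun hω => ?_
      rw [show M.Z d (t + 1) ω = z from hω.2]
      rfl)
  rw [hWc] at this
  exact this

/-- All other messages are then known to be blank. The next one has likelihood `1` under both
hypotheses, so its factor drops out of Bayes' formula. -/
theorem rawBelief₂_after_final (hT₁ : 1 ≤ M.T₁) (d : Design) {s t : ℕ} (hs : 1 ≤ s) (hst : s ≤ t)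
    (z : Fin 2) : ∀ᵐ ω ∂M.μ, ω ∈ M.finalSet d s (some z) → M.rawBelief₂ d (t + 1) ω =
      M.bayes (t + 1) (M.rawBelief₂ d t ω) (M.Y₂ (t + 1) ω) := by
  have hZ : ∀ k, 1 ≤ k → k ≠ s → ∀ ω ∈ M.finalSet d s (some z), M.Z d k ω = none := by
    intro k hk hks ω hω
    by_contra hne
    exact hks ((Z_ne_none_iff hT₁ hk).1 hne ▸ (τ₁_of_mem_finalSet hT₁ hs hω))
  have hN : M.finalSet d s (some z) ∩ {ω | M.Z d (t + 1) ω = none} = M.finalSet d s (some z) :=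
    Set.inter_eq_left.2 fun ω hω => hZ (t + 1) (by omega) (by omega) ω hω
  have := rawBelief₂_update hT₁ d t none (measurableSet_finalSet_info d hs hst (some z))
    (M.obs₁_le_all s _ (measurableSet_finalSet hT₁ d s (some z)))
    (fun k => if k = s then some z else none) (fun k hk ω hω => by
      rw [Finset.mem_Icc] at hk
      split_ifs with h
      · rw [h]; exact hω.2
      · exact hZ k hk.1 h ω hω) (r := fun _ => 1) (fun _ => zero_le_one)
    (fun h => by rw [hN]; simp)
  rw [hN] at this
  simpa only [bayes_eq] using this

theorem rawBelief₂_before_final (hT₁ : 1 ≤ M.T₁) (d : Design) (t : ℕ) (z : Symb) {r : Fin 2 → ℝ}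
    (hr : ∀ h, 0 ≤ r h) (hrB : ∀ h, M.μ (M.finalSet d (t + 1) z ∩ M.H ⁻¹' {h}) =
      ENNReal.ofReal (r h) * M.μ (M.blankBefore d (t + 1) ∩ M.H ⁻¹' {h})) :
    ∀ᵐ ω ∂M.μ, ω ∈ M.finalSet d (t + 1) z → M.rawBelief₂ d (t + 1) ω =
      bayesUpdate (M.P₂ (t + 1)) r (M.rawBelief₂ d t ω) (M.Y₂ (t + 1) ω) :=
  rawBelief₂_update hT₁ d t z (measurableSet_blankBefore_info d le_rfl)
    (M.obs₁_le_all t _ (measurableSet_blankBefore hT₁ d le_rfl)) (fun _ => none)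
    (fun s hs ω hω => by
      rw [Finset.mem_Icc] at hs
      exact hω s hs.1 (by omega)) hr hrB

end Model

/-! ### Transformations of the information states -/

section Transition

variable {E 𝒴 T : Type*} [MeasurableSpace E] [MeasurableSpace 𝒴] [MeasurableSpace T]

/-- The law of `F ((h, v), y)` when `(h, v)` has the law `ψ` and `y` has the conditional law
`P h`. -/
def transition (P : Fin 2 → Measure 𝒴) (F : (Fin 2 × E) × 𝒴 → T) (ψ : Measure (Fin 2 × E)) :
    Measure T :=
  ∑ h, ((ψ.restrict {x | x.1 = h}).prod (P h)).map F

theorem measurableSet_fst_eq (h : Fin 2) : MeasurableSet {x : Fin 2 × E | x.1 = h} :=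
  measurable_fst (measurableSet_singleton h)

theorem transition_univ (P : Fin 2 → Measure 𝒴) [∀ h, IsProbabilityMeasure (P h)]
    {F : (Fin 2 × E) × 𝒴 → T} (hF : Measurable F) (ψ : Measure (Fin 2 × E)) :
    transition P F ψ Set.univ = ψ Set.univ := by
  have : (Set.univ : Set (Fin 2 × E)) = {x | x.1 = 0} ∪ {x | x.1 = 1} := by
    ext x
    simp only [Set.mem_univ, Set.mem_union, true_iff]
    change x.1 = 0 ∨ x.1 = 1
    omega
  have hd : Disjoint {x : Fin 2 × E | x.1 = 0} {x | x.1 = 1} :=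
    Set.disjoint_left.2 fun x h0 h1 => by
      change x.1 = 0 at h0
      change x.1 = 1 at h1
      simp [h0] at h1
  conv_rhs => rw [this, measure_union hd (measurableSet_fst_eq 1)]
  simp only [transition, Fin.sum_univ_two, Measure.add_apply,
    Measure.map_apply hF MeasurableSet.univ, Set.preimage_univ]
  rw [← Set.univ_prod_univ, Measure.prod_prod, Measure.prod_prod]
  simp

theorem isFiniteMeasure_transition (P : Fin 2 → Measure 𝒴) [∀ h, IsProbabilityMeasure (P h)]
    {F : (Fin 2 × E) × 𝒴 → T} (hF : Measurable F) (ψ : Measure (Fin 2 × E)) [IsFiniteMeasure ψ] :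
    IsFiniteMeasure (transition P F ψ) :=
  ⟨by rw [transition_univ P hF]; exact measure_lt_top _ _⟩

/-- Since `V` and `N` are known from `m`, the joint law with the next observation is a product on
each event `H = h`. If `N` is null, the conditional measure is zero and both sides vanish. -/
theorem map_cond_eq_transition {Ω : Type*} {m m₀ : MeasurableSpace Ω} {μ : Measure Ω}
    [IsProbabilityMeasure μ] {H : Ω → Fin 2} (hH : Measurable H) (hm : m ≤ m₀)
    (P : Fin 2 → Measure 𝒴) [∀ h, IsProbabilityMeasure (P h)] {Y : Ω → 𝒴} (hY : Measurable Y)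
    (hind : ∀ h A, MeasurableSet[m] A → ∀ C, MeasurableSet C →
      μ (A ∩ Y ⁻¹' C ∩ H ⁻¹' {h}) = μ (A ∩ H ⁻¹' {h}) * P h C)
    {V : Ω → E} (hV : Measurable[m] V) {N : Set Ω} (hN : MeasurableSet[m] N)
    {F : (Fin 2 × E) × 𝒴 → T} (hF : Measurable F) {Φ : Ω → T}
    (hΦ : ∀ᵐ ω ∂μ, ω ∈ N → Φ ω = F ((H ω, V ω), Y ω)) :
    (μ[|N]).map Φ = transition P F ((μ[|N]).map fun ω => (H ω, V ω)) := by
  have hV' : Measurable V := hV.mono hm le_rfl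
  have hHV : Measurable fun ω => (H ω, V ω) := hH.prodMk hV'
  have hHVY : Measurable fun ω => ((H ω, V ω), Y ω) := hHV.prodMk hY
  have hN' := hm _ hN
  have key : ∀ h, ((μ[|N]).restrict (H ⁻¹' {h})).map (fun ω => ((H ω, V ω), Y ω)) =
      (((μ[|N]).map fun ω => (H ω, V ω)).restrict {x | x.1 = h}).prod (P h) := by
    intro h
    refine (Measure.prod_eq fun S C hS hC => ?_).symm
    have hSh : MeasurableSet {v | (h, v) ∈ S} := measurable_prodMk_left hS
    rw [Measure.map_apply hHVY (hS.prod hC), Measure.restrict_apply (hHVY (hS.prod hC)),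
      Measure.restrict_apply hS, Measure.map_apply hHV (hS.inter (measurableSet_fst_eq h)),
      cond_apply hN', cond_apply hN', mul_assoc]
    congr 1
    have e1 : N ∩ ((fun ω => ((H ω, V ω), Y ω)) ⁻¹' S ×ˢ C ∩ H ⁻¹' {h}) =
        (N ∩ V ⁻¹' {v | (h, v) ∈ S}) ∩ Y ⁻¹' C ∩ H ⁻¹' {h} := by
      ext ω
      simp only [Set.mem_inter_iff, Set.mem_preimage, Set.mem_prod, Set.mem_singleton_iff]
      constructor
      · rintro ⟨h1, ⟨h2, h3⟩, rfl⟩; exact ⟨⟨⟨h1, h2⟩, h3⟩, rfl⟩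
      · rintro ⟨⟨⟨h1, h2⟩, h3⟩, rfl⟩; exact ⟨h1, ⟨h2, h3⟩, rfl⟩
    have e2 : N ∩ (fun ω => (H ω, V ω)) ⁻¹' (S ∩ {x | x.1 = h}) =
        (N ∩ V ⁻¹' {v | (h, v) ∈ S}) ∩ H ⁻¹' {h} := by
      ext ω
      constructor
      · rintro ⟨h1, h2, rfl⟩; exact ⟨⟨h1, h2⟩, rfl⟩
      · rintro ⟨⟨h1, h2⟩, rfl⟩; exact ⟨h1, h2, rfl⟩
    rw [e1, e2]
    exact hind h _ (MeasurableSet.inter hN (hV hSh)) C hC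
  have hae : Φ =ᵐ[μ[|N]] F ∘ fun ω => ((H ω, V ω), Y ω) := by
    exact Measure.ae_smul_measure ((ae_restrict_iff' hN').2 hΦ) _
  rw [Measure.map_congr hae, ← Measure.map_map hF hHVY]
  have hsplit : (μ[|N]) = (μ[|N]).restrict (H ⁻¹' {0}) + (μ[|N]).restrict (H ⁻¹' {1}) := by
    have : H ⁻¹' {1} = (H ⁻¹' {0})ᶜ := by
      ext ω
      simp only [Set.mem_compl_iff, Set.mem_preimage, Set.mem_singleton_iff]
      omega
    rw [this, Measure.restrict_add_restrict_compl (hH (measurableSet_singleton 0))]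
  conv_lhs => rw [hsplit, Measure.map_add _ _ hHVY, Measure.map_add _ _ hF, key, key]
  simp [transition, Fin.sum_univ_two]

theorem cond_map {Ω : Type*} {m₀ : MeasurableSpace Ω} {μ : Measure Ω} [IsFiniteMeasure μ]
    {Ψ : Ω → E} (hΨ : Measurable Ψ) {S : Set E} (hS : MeasurableSet S) :
    (μ.map Ψ)[|S] = (μ[|Ψ ⁻¹' S]).map Ψ := by
  unfold ProbabilityTheory.cond
  rw [Measure.map_smul, Measure.restrict_map hΨ hS, Measure.map_apply hΨ hS]

theorem cond_real_apply {Ω : Type*} {m₀ : MeasurableSpace Ω} {μ : Measure Ω} {S : Set Ω}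
    (hS : MeasurableSet S) (A : Set Ω) :
    (μ[|S]).real A = (μ.real S)⁻¹ * μ.real (S ∩ A) := by
  simp [Measure.real, cond_apply hS]

end Transition

/-! ### Updates of the state by O1's message and by O1's next measurement -/

namespace Model

variable {Ω 𝒴₁ 𝒴₂ : Type*} [MeasurableSpace Ω] [MeasurableSpace 𝒴₁] [MeasurableSpace 𝒴₂]
variable (M : Model Ω 𝒴₁ 𝒴₂)

/-- The information states at which the rule `ρ` of O1 sends `z`. -/
def msgSet (ρ : Belief → Symb) (z : Symb) : Set (Fin 2 × Belief × Belief × Bool) :=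
  {x | ρ x.2.1 = z}

theorem measurableSet_msgSet {ρ : Belief → Symb} (hρ : Measurable ρ) (z : Symb) :
    MeasurableSet (msgSet ρ z) :=
  (hρ.comp (measurable_fst.comp measurable_snd)) (measurableSet_singleton z)

/-- Probability of the message `z` given `H = h`, under the state `ψ`. -/
def msgLikelihood (ψ : InfoState) (ρ : Belief → Symb) (z : Symb) (h : Fin 2) : ℝ :=
  ψ.real (msgSet ρ z ∩ {x | x.1 = h}) / ψ.real {x | x.1 = h}

/-- Effect of a measurement of O2 and of the message likelihoods `r` on the state. -/
def msgStep (t : ℕ) (r : Fin 2 → ℝ) (x : (Fin 2 × Belief × Belief × Bool) × 𝒴₂) :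
    Fin 2 × Belief × Belief × Bool :=
  (x.1.1, x.1.2.1,
    if x.1.2.2.2 then bayesUpdate (M.P₂ t) r x.1.2.2.1 x.2 else x.1.2.2.1, x.1.2.2.2)

/-- The state after the measurement of O2 at time `t` and the message `z`, sent by the rule `ρ`. -/
def msgUpdate (t : ℕ) (ψ : InfoState) (ρ : Belief → Symb) (z : Symb) : InfoState :=
  transition (M.P₂ t) (M.msgStep t (msgLikelihood ψ ρ z)) ψ[|msgSet ρ z]

/-- Effect of a measurement of O1 and of the decision rule `g` of O2 on the state. -/
def obsStep (t : ℕ) (g : TwoThr) (x : (Fin 2 × Belief × Belief × Bool) × 𝒴₁) :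
    Fin 2 × Belief × Belief × Bool :=
  (x.1.1, bayesUpdate (M.P₁ (t + 1)) (fun _ => 1) x.1.2.1 x.2, x.1.2.2.1,
    x.1.2.2.2 && decide (rule2 False g x.1.2.2.1 = none))

/-- The state after the decision of O2 at time `t` and the measurement of O1 at time `t + 1`. -/
def obsUpdate (t : ℕ) (φ : InfoState) (g : TwoThr) : InfoState :=
  transition (M.P₁ (t + 1)) (M.obsStep t g) φ

theorem measurable_msgStep (t : ℕ) (r : Fin 2 → ℝ) : Measurable (M.msgStep t r) := by
  have h1 : Measurable fun x : (Fin 2 × Belief × Belief × Bool) × 𝒴₂ => x.1.2.2.1 := by fun_prop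
  have h2 : Measurable fun x : (Fin 2 × Belief × Belief × Bool) × 𝒴₂ => x.1.2.2.2 := by fun_prop
  have h3 : Measurable fun x : (Fin 2 × Belief × Belief × Bool) × 𝒴₂ =>
      if x.1.2.2.2 then bayesUpdate (M.P₂ t) r x.1.2.2.1 x.2 else x.1.2.2.1 :=
    Measurable.ite (h2 (measurableSet_singleton true))
      ((measurable_bayesUpdate (M.P₂ t) r).comp (h1.prodMk measurable_snd)) h1
  unfold msgStep
  fun_prop

theorem measurable_obsStep (t : ℕ) (g : TwoThr) : Measurable (M.obsStep t g) := by
  have h1 : Measurable fun x : (Fin 2 × Belief × Belief × Bool) × 𝒴₁ => x.1.2.1 := by fun_prop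
  have h2 : Measurable fun x : (Fin 2 × Belief × Belief × Bool) × 𝒴₁ => x.1.2.2.1 := by fun_prop
  have h3 := (measurable_bayesUpdate (M.P₁ (t + 1)) (fun _ => 1)).comp (h1.prodMk measurable_snd)
  have h4 : Measurable fun x : Belief × Bool => x.2 && decide (rule2 False g x.1 = none) := by
    have h : Measurable fun x : Belief × Bool => decide (rule2 False g x.1 = none) :=
      (measurable_from_top (f := fun z : Symb => decide (z = none))).comp
        ((measurable_rule2 False g).comp measurable_fst)
    exact (measurable_of_countable fun x : Bool × Bool => x.1 && x.2).comp
      (measurable_snd.prodMk h)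
  have h5 : Measurable fun x : (Fin 2 × Belief × Belief × Bool) × 𝒴₁ => x.1.2.2 := by fun_prop
  exact (measurable_fst.comp measurable_fst).prodMk (h3.prodMk (h2.prodMk (h4.comp h5)))

variable {M}

/-- The components of the state `ψ_t` except the hypothesis. -/
def preState (M : Model Ω 𝒴₁ 𝒴₂) (d : Design) (t : ℕ) (ω : Ω) : Belief × Belief × Bool :=
  (M.belief₁ t ω, M.belief₂ d (t - 1) ω, M.D d t ω)

/-- The state at `t + 1` before the message uses, on O2's side, only what O2 knows at `t`: whether
`τ₂ ≥ t + 1` is settled by its decision at `t`. Hence O2's measurement at `t + 1` is still fresh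
given `H`. -/
theorem measurable_preState (hT₁ : 1 ≤ M.T₁) (hT₂ : 1 ≤ M.T₂) (d : Design) (t : ℕ) :
    Measurable[M.allObs₁ ⊔ M.obs₂ t] (M.preState d (t + 1)) := by
  have hle : M.info₂ d t ≤ M.allObs₁ ⊔ M.obs₂ t :=
    (info₂_le_sup hT₁ d t).trans (sup_le_sup_right (M.obs₁_le_all t) _)
  exact ((M.measurable_belief₁ (t + 1)).mono ((M.obs₁_le_all _).trans le_sup_left) le_rfl).prodMk
    (((measurable_belief₂ hT₁ hT₂ d t).mono hle le_rfl).prodMk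
      ((measurable_D hT₁ hT₂ d le_rfl).mono hle le_rfl))

/-- The components of the state `φ_t` except the hypothesis. -/
def postState (M : Model Ω 𝒴₁ 𝒴₂) (d : Design) (t : ℕ) (ω : Ω) : Belief × Belief × Bool :=
  (M.belief₁ t ω, M.belief₂ d t ω, M.D d t ω)

/-- The counterpart for O1: nothing here involves its observations after `t`, so the measurement at
`t + 1` is fresh given `H`. -/
theorem measurable_postState (hT₁ : 1 ≤ M.T₁) (hT₂ : 1 ≤ M.T₂) (d : Design) (t : ℕ) :
    Measurable[M.allObs₂ ⊔ M.obs₁ t] (M.postState d t) := by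
  have hle : M.info₂ d t ≤ M.allObs₂ ⊔ M.obs₁ t :=
    (info₂_le_sup hT₁ d t).trans (sup_le le_sup_right ((M.obs₂_le_all t).trans le_sup_left))
  exact ((M.measurable_belief₁ t).mono le_sup_right le_rfl).prodMk
    (((measurable_belief₂ hT₁ hT₂ d t).mono hle le_rfl).prodMk
      ((measurable_D hT₁ hT₂ d (by omega)).mono hle le_rfl))

theorem blankBefore_inter_msg (hT₁ : 1 ≤ M.T₁) (d : Design) (t : ℕ) (z : Symb) :
    M.blankBefore d t ∩ {ω | M.msgRule d t (M.belief₁ t ω) = z} = M.finalSet d t z := by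
  ext ω
  refine and_congr_right fun hω => ?_
  change _ = z ↔ _ = z
  rw [Z_eq_of_le ((mem_blankBefore hT₁).1 hω)]

theorem psi_eq (d : Design) (t : ℕ) :
    M.psi d t = (M.μ[|M.blankBefore d t]).map fun ω => (M.H ω, M.preState d t ω) := rfl

theorem phi_eq (d : Design) (t : ℕ) (z : Symb) :
    M.phi d t z = (M.μ[|M.finalSet d t z]).map fun ω => (M.H ω, M.postState d t ω) := rfl

theorem measurable_H_preState (hT₁ : 1 ≤ M.T₁) (hT₂ : 1 ≤ M.T₂) (d : Design) (t : ℕ) :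
    Measurable fun ω => (M.H ω, M.preState d (t + 1) ω) :=
  M.meas_H.prodMk ((measurable_preState hT₁ hT₂ d t).mono
    (sup_le M.allObs₁_le (M.obs₂_le t)) le_rfl)

theorem measurable_H_postState (hT₁ : 1 ≤ M.T₁) (hT₂ : 1 ≤ M.T₂) (d : Design) (t : ℕ) :
    Measurable fun ω => (M.H ω, M.postState d t ω) :=
  M.meas_H.prodMk ((measurable_postState hT₁ hT₂ d t).mono
    (sup_le M.allObs₂_le (M.obs₁_le t)) le_rfl)

theorem measurableSet_blankBefore' (hT₁ : 1 ≤ M.T₁) (d : Design) (t : ℕ) :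
    MeasurableSet (M.blankBefore d t) :=
  M.obs₁_le t _ (measurableSet_blankBefore hT₁ d (by omega))

theorem measurableSet_finalSet' (hT₁ : 1 ≤ M.T₁) (d : Design) (t : ℕ) (z : Symb) :
    MeasurableSet (M.finalSet d t z) :=
  M.obs₁_le t _ (measurableSet_finalSet hT₁ d t z)

/-- The likelihood of the message computed from the state. -/
theorem measure_finalSet_inter_H (hT₁ : 1 ≤ M.T₁) (hT₂ : 1 ≤ M.T₂) (d : Design) (t : ℕ)
    (z : Symb) (h : Fin 2) : M.μ (M.finalSet d (t + 1) z ∩ M.H ⁻¹' {h}) =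
      ENNReal.ofReal (msgLikelihood (M.psi d (t + 1)) (M.msgRule d (t + 1)) z h) *
        M.μ (M.blankBefore d (t + 1) ∩ M.H ⁻¹' {h}) := by
  set B := M.blankBefore d (t + 1) with hB
  have hBm : MeasurableSet B := measurableSet_blankBefore' hT₁ d _
  have hsub : M.finalSet d (t + 1) z ⊆ B := Set.inter_subset_left
  have hΨ := measurable_H_preState hT₁ hT₂ d t
  -- If the denominator of the likelihood vanishes, its value `0` by convention is harmless, since
  -- both sides are zero.
  by_cases h0 : M.μ (B ∩ M.H ⁻¹' {h}) = 0
  · rw [h0, mul_zero]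
    exact measure_mono_null (Set.inter_subset_inter_left _ hsub) h0
  have hB0 : M.μ B ≠ 0 := fun h => h0 (measure_mono_null Set.inter_subset_left h)
  have e1 : (M.psi d (t + 1)).real {x | x.1 = h} = (M.μ.real B)⁻¹ * M.μ.real (B ∩ M.H ⁻¹' {h}) := by
    rw [psi_eq, map_measureReal_apply hΨ (measurableSet_fst_eq h), cond_real_apply hBm]
    rfl
  have e2 : (M.psi d (t + 1)).real (msgSet (M.msgRule d (t + 1)) z ∩ {x | x.1 = h}) =
      (M.μ.real B)⁻¹ * M.μ.real (M.finalSet d (t + 1) z ∩ M.H ⁻¹' {h}) := by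
    rw [psi_eq, map_measureReal_apply hΨ ((measurableSet_msgSet (M.measurable_msgRule d _) z).inter
      (measurableSet_fst_eq h)), cond_real_apply hBm, ← blankBefore_inter_msg hT₁, Set.inter_assoc]
    rfl
  have hBr : M.μ.real B ≠ 0 := by simpa [measureReal_eq_zero_iff] using hB0
  have h0r : M.μ.real (B ∩ M.H ⁻¹' {h}) ≠ 0 := by simpa [measureReal_eq_zero_iff] using h0
  rw [msgLikelihood, e1, e2, mul_div_mul_left _ _ (inv_ne_zero hBr),
    ← ofReal_measureReal (μ := M.μ) (s := B ∩ M.H ⁻¹' {h}),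
    ← ENNReal.ofReal_mul (div_nonneg measureReal_nonneg measureReal_nonneg),
    div_mul_cancel₀ _ h0r, ofReal_measureReal]

theorem phi_eq_msgUpdate (hT₁ : 1 ≤ M.T₁) (hT₂ : 1 ≤ M.T₂) (d : Design) {t : ℕ} (ht : 1 ≤ t)
    (z : Symb) : M.phi d t z = M.msgUpdate t (M.psi d t) (M.msgRule d t) z := by
  obtain ⟨t, rfl⟩ := Nat.exists_eq_add_of_le' ht
  set r := msgLikelihood (M.psi d (t + 1)) (M.msgRule d (t + 1)) z with hr
  have hΨ := measurable_H_preState hT₁ hT₂ d t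
  have hcond : (M.psi d (t + 1))[|msgSet (M.msgRule d (t + 1)) z] =
      (M.μ[|M.finalSet d (t + 1) z]).map fun ω => (M.H ω, M.preState d (t + 1) ω) := by
    have hS := measurableSet_msgSet (M.measurable_msgRule d (t + 1)) z
    rw [psi_eq, cond_map hΨ hS,
      cond_cond_eq_cond_inter (measurableSet_blankBefore' hT₁ d (t + 1)) (hΨ hS),
      ← blankBefore_inter_msg hT₁]
    rfl
  rw [msgUpdate, hcond, phi_eq]
  refine map_cond_eq_transition M.meas_H (sup_le M.allObs₁_le (M.obs₂_le t)) (M.P₂ (t + 1))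
    (M.meas_Y₂ (t + 1)) (fun h A hA C hC => measure_inter_Y₂ h t hA hC)
    (measurable_preState hT₁ hT₂ d t) ((M.obs₁_le_all _).trans le_sup_left _
      (measurableSet_finalSet hT₁ d (t + 1) z)) (M.measurable_msgStep _ _) ?_
  filter_upwards [rawBelief₂_before_final hT₁ d t z (r := r)
    (fun h => div_nonneg measureReal_nonneg measureReal_nonneg)
    (measure_finalSet_inter_H hT₁ hT₂ d t z)] with ω hω hN
  by_cases h : t + 1 ≤ M.τ₂ d ω
  · have h' : t ≤ M.τ₂ d ω := by omega
    simp only [postState, msgStep, ← hr, preState, D, h, decide_true, if_true,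
      belief₂_of_le h, hω hN,
      Nat.add_sub_cancel, belief₂_of_le h']
  · simp only [postState, msgStep, preState, D, h, decide_false, Bool.false_eq_true, if_false,
      belief₂_of_lt (not_le.1 h)]

theorem psi_succ_eq_obsUpdate (hT₁ : 1 ≤ M.T₁) (hT : M.T₁ ≤ M.T₂) (d : Design) {t : ℕ}
    (ht : 1 ≤ t) (htT : t < M.T₁) :
    M.psi d (t + 1) = M.obsUpdate t (M.phi d t none) (d.o2 t) := by
  have hT₂ := hT₁.trans hT
  have hB : M.finalSet d t none = M.blankBefore d (t + 1) := (blankBefore_succ d ht).symm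
  rw [obsUpdate, phi_eq, hB, psi_eq]
  refine map_cond_eq_transition M.meas_H (sup_le M.allObs₂_le (M.obs₁_le t)) (M.P₁ (t + 1))
    (M.meas_Y₁ (t + 1)) (fun h A hA C hC => measure_inter_Y₁ h t hA hC)
    (measurable_postState hT₁ hT₂ d t) ((le_sup_right : _ ≤ M.allObs₂ ⊔ M.obs₁ t) _
      (measurableSet_blankBefore hT₁ d le_rfl)) (M.measurable_obsStep _ _) ?_
  filter_upwards [M.belief₁_succ t] with ω hω hN
  -- From `t < M.T₁ ≤ M.T₂` O2 is not yet forced to stop, so its rule applies with end condition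
  -- `False`. If it had stopped earlier, both sides are false.
  have hD : M.D d (t + 1) ω =
      (M.D d t ω && decide (rule2 False (d.o2 t) (M.belief₂ d t ω) = none)) := by
    by_cases h : t ≤ M.τ₂ d ω
    · have hU := U_eq_of_blank hT₁ hN
      rw [rule2_congr (show t = M.T₂ ↔ False by simp; omega)] at hU
      simp [D, belief₂_of_le h, succ_le_τ₂_iff hT₂ ht, h, hU]
    · have h' : ¬ t + 1 ≤ M.τ₂ d ω := by omega
      simp [D, h, h']
  simp only [preState, obsStep, postState, Nat.add_sub_cancel, hω, hD]
  rfl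

/-- At time `0` O2 has no information, so its belief is a posterior for the trivial σ-algebra, and
`τ₂ ≥ 1` always; neither depends on the design. -/
theorem psi_one (hT₂ : 1 ≤ M.T₂) (d d' : Design) : M.psi d 1 = M.psi d' 1 := by
  have h0 : M.belief₂ d 0 = M.belief₂ d' 0 := by
    funext ω
    simp [belief₂, rawBelief₂]
  have h1 : ∀ d ω, M.D d 1 ω = true := fun d ω => by simp [D, (τ₂_mem hT₂ d ω).1]
  simp only [psi, blankBefore_one, h1, Nat.sub_self, h0]

end Model

/-! ### Integrals under conditional measures -/

section Cond

variable {Ω : Type*} [MeasurableSpace Ω] {μ : Measure Ω}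

theorem integral_cond (S : Set Ω) (f : Ω → ℝ) :
    ∫ ω, f ω ∂(μ[|S]) = (μ.real S)⁻¹ * ∫ ω in S, f ω ∂μ := by
  rw [ProbabilityTheory.cond, integral_smul_measure, smul_eq_mul, ENNReal.toReal_inv]
  rfl

theorem measureReal_mul_integral_cond [IsFiniteMeasure μ] (S : Set Ω) (f : Ω → ℝ) :
    μ.real S * ∫ ω, f ω ∂(μ[|S]) = ∫ ω in S, f ω ∂μ := by
  rw [integral_cond]
  by_cases h : μ.real S = 0
  · have h' : μ S = 0 := by simpa [measureReal_eq_zero_iff] using h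
    rw [h, zero_mul, Measure.restrict_eq_zero.2 h', integral_zero_measure]
  · rw [mul_inv_cancel_left₀ h]

/-- Law of total expectation for a finite partition. -/
theorem integral_eq_sum_cond [IsFiniteMeasure μ] {Z : Ω → Symb} (hZ : Measurable Z) {B : Set Ω}
    (hB : MeasurableSet B) {f : Ω → ℝ} (hf : Integrable f (μ[|B])) :
    ∫ ω, f ω ∂(μ[|B]) =
      ∑ z, (μ[|B]).real {ω | Z ω = z} * ∫ ω, f ω ∂(μ[|B ∩ {ω | Z ω = z}]) := by
  have hm : ∀ z, MeasurableSet {ω | Z ω = z} := fun z => hZ (measurableSet_singleton z)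
  have hu : (⋃ z, {ω | Z ω = z}) = Set.univ := by ext ω; simp
  rw [← setIntegral_univ, ← hu, integral_iUnion_fintype hm (fun z z' hzz' =>
    Set.disjoint_left.2 fun ω (h : Z ω = z) (h' : Z ω = z') => hzz' (h.symm.trans h'))
    fun z => hf.integrableOn]
  refine Finset.sum_congr rfl fun z _ => ?_
  rw [← cond_cond_eq_cond_inter hB (hm z), measureReal_mul_integral_cond]

theorem measurable_apply_nat {E : Type*} [MeasurableSpace E] {u : ℕ → Ω → E}
    (hu : ∀ n, Measurable (u n)) {τ : Ω → ℕ} (hτ : Measurable τ) :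
    Measurable fun ω => u (τ ω) ω := by
  have h : Measurable fun x : Ω × ℕ => u x.2 x.1 := measurable_from_prod_countable_left hu
  exact h.comp (measurable_id.prodMk hτ)

end Cond

namespace Model

variable {Ω 𝒴₁ 𝒴₂ : Type*} [MeasurableSpace Ω] [MeasurableSpace 𝒴₁] [MeasurableSpace 𝒴₂]
variable {M : Model Ω 𝒴₁ 𝒴₂}

/-! ### Measurability and boundedness of the costs -/

theorem measurable_τ₁ (hT₁ : 1 ≤ M.T₁) (d : Design) : Measurable (M.τ₁ d) :=
  measurable_of_Ici fun t => M.obs₁_le t _ (measurableSet_le_τ₁ hT₁ d (by omega))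

theorem measurable_τ₂ (hT₁ : 1 ≤ M.T₁) (hT₂ : 1 ≤ M.T₂) (d : Design) : Measurable (M.τ₂ d) :=
  measurable_of_Ici fun t => info₂_le hT₁ d t _ (measurableSet_le_τ₂ hT₁ hT₂ d (by omega))

theorem measurable_decision (hT₁ : 1 ≤ M.T₁) (hT₂ : 1 ≤ M.T₂) (d : Design) :
    Measurable (M.decision d) := by
  have h' : Measurable fun ω => M.U d (M.τ₂ d ω) ω :=
    measurable_apply_nat (fun t => (measurable_U hT₁ d t).mono (info₂_le hT₁ d t) le_rfl)
      (measurable_τ₂ hT₁ hT₂ d)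
  have h'' : Measurable fun z : Symb => z.getD (0 : Fin 2) := measurable_of_countable _
  unfold decision
  exact h''.comp h'

theorem measurable_decisionCost (hT₁ : 1 ≤ M.T₁) (hT₂ : 1 ≤ M.T₂) (d : Design) :
    Measurable fun ω => M.J (M.decision d ω) (M.H ω) :=
  (measurable_of_countable fun x : Fin 2 × Fin 2 => M.J x.1 x.2).comp
    ((measurable_decision hT₁ hT₂ d).prodMk M.meas_H)

theorem measurable_remaining₂ (hT₁ : 1 ≤ M.T₁) (hT₂ : 1 ≤ M.T₂) (d : Design) (t : ℕ) :
    Measurable (M.remaining₂ d t) := by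
  have h : Measurable fun ω => (M.τ₂ d ω : ℝ) :=
    (measurable_of_countable fun n : ℕ => (n : ℝ)).comp (measurable_τ₂ hT₁ hT₂ d)
  exact Measurable.ite (info₂_le hT₁ d t _ (measurableSet_le_τ₂ hT₁ hT₂ d (by omega)))
    (((h.sub_const _).const_mul _).add (measurable_decisionCost hT₁ hT₂ d)) measurable_const

theorem abs_remaining₂_le (hT₂ : 1 ≤ M.T₂) (d : Design) (t : ℕ) (ω : Ω) :
    |M.remaining₂ d t ω| ≤ |M.c₂| * M.T₂ + M.costBound := by
  have h0 : 0 ≤ |M.c₂| * M.T₂ := by positivity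
  unfold remaining₂
  split_ifs with h
  · refine (abs_add_le _ _).trans (add_le_add ?_ (M.abs_J_le _ _))
    rw [abs_mul]
    refine mul_le_mul_of_nonneg_left ?_ (abs_nonneg _)
    have h1 : (t : ℝ) ≤ M.τ₂ d ω := by exact_mod_cast h
    have h2 : (M.τ₂ d ω : ℝ) ≤ M.T₂ := by exact_mod_cast τ₂_le hT₂ d ω
    have h3 : (0 : ℝ) ≤ t := by positivity
    rw [abs_of_nonneg (by linarith)]
    linarith
  · rw [abs_zero]
    linarith [M.costBound_nonneg]

theorem integrable_remaining₂ (hT₁ : 1 ≤ M.T₁) (hT₂ : 1 ≤ M.T₂) (d : Design) (t : ℕ)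
    (ν : Measure Ω) [IsFiniteMeasure ν] : Integrable (M.remaining₂ d t) ν :=
  Integrable.of_bound (measurable_remaining₂ hT₁ hT₂ d t).aestronglyMeasurable _
    (Filter.Eventually.of_forall (abs_remaining₂_le hT₂ d t))

theorem integrable_τ₁ (hT₁ : 1 ≤ M.T₁) (d : Design) (ν : Measure Ω) [IsFiniteMeasure ν] :
    Integrable (fun ω => (M.τ₁ d ω : ℝ)) ν :=
  Integrable.of_bound (C := M.T₁) ((measurable_of_countable fun n : ℕ => (n : ℝ)).comp
    (measurable_τ₁ hT₁ d)).aestronglyMeasurable (Filter.Eventually.of_forall fun ω => by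
      rw [Real.norm_of_nonneg (by positivity)]
      exact_mod_cast τ₁_le hT₁ d ω)

theorem integrable_cost₁ (hT₁ : 1 ≤ M.T₁) (d : Design) (x : ℝ) (ν : Measure Ω)
    [IsFiniteMeasure ν] : Integrable (fun ω => M.c₁ * ((M.τ₁ d ω : ℝ) - x)) ν :=
  ((integrable_τ₁ hT₁ d ν).sub (integrable_const _)).const_mul _

theorem integrable_toGo (hT₁ : 1 ≤ M.T₁) (hT₂ : 1 ≤ M.T₂) (d : Design) (x : ℝ) (t : ℕ)
    (ν : Measure Ω) [IsFiniteMeasure ν] :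
    Integrable (fun ω => M.c₁ * ((M.τ₁ d ω : ℝ) - x) + M.remaining₂ d t ω) ν :=
  (integrable_cost₁ hT₁ d x ν).add (integrable_remaining₂ hT₁ hT₂ d t ν)

theorem totalCost_eq (hT₂ : 1 ≤ M.T₂) (d : Design) (ω : Ω) : M.totalCost d ω =
    M.c₁ + M.c₂ + (M.c₁ * ((M.τ₁ d ω : ℝ) - (1 : ℕ)) + M.remaining₂ d 1 ω) := by
  simp only [totalCost, remaining₂, (τ₂_mem hT₂ d ω).1, if_true]
  push_cast
  ring

theorem integrable_totalCost (hT₁ : 1 ≤ M.T₁) (hT₂ : 1 ≤ M.T₂) (d : Design) :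
    Integrable (M.totalCost d) M.μ := by
  rw [funext (totalCost_eq hT₂ d)]
  exact (integrable_const _).add (integrable_toGo hT₁ hT₂ d _ 1 _)

/-! ### Decomposition of the costs-to-go -/

theorem cost_eq_toGo₁ (hT₁ : 1 ≤ M.T₁) (hT₂ : 1 ≤ M.T₂) (d : Design) :
    M.cost d = M.c₁ + M.c₂ + M.toGo₁ d 1 := by
  rw [cost, toGo₁, blankBefore_one, cond_univ, integral_congr_ae
    (Filter.Eventually.of_forall (totalCost_eq hT₂ d)), integral_add (integrable_const _)
    (integrable_toGo hT₁ hT₂ d _ 1 _)]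
  simp

/-- Expected cost of O2 that is still to come when O1 sends its final message `z` at time `t`. -/
def postCost (M : Model Ω 𝒴₁ 𝒴₂) (d : Design) (t : ℕ) (z : Fin 2) : ℝ :=
  ∫ ω, M.remaining₂ d t ω ∂(M.μ[|M.finalSet d t (some z)])

theorem psi_real_msgSet (hT₁ : 1 ≤ M.T₁) (hT₂ : 1 ≤ M.T₂) (d : Design) {t : ℕ} (ht : 1 ≤ t)
    (z : Symb) : (M.psi d t).real (msgSet (M.msgRule d t) z) =
      (M.μ[|M.blankBefore d t]).real {ω | M.Z d t ω = z} := by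
  obtain ⟨t, rfl⟩ := Nat.exists_eq_add_of_le' ht
  rw [psi_eq, map_measureReal_apply (measurable_H_preState hT₁ hT₂ d t)
    (measurableSet_msgSet (M.measurable_msgRule d _) z),
    cond_real_apply (measurableSet_blankBefore' hT₁ d _),
    cond_real_apply (measurableSet_blankBefore' hT₁ d _)]
  congr 2
  exact blankBefore_inter_msg hT₁ d (t + 1) z

/-- Total expectation over the message at `t`. A final message ends the costs of O1; a blank costs
one further measurement, the `c₁` that `toGo₂` leaves out. -/
theorem toGo₁_eq (hT₁ : 1 ≤ M.T₁) (hT₂ : 1 ≤ M.T₂) (d : Design) {t : ℕ} (ht : 1 ≤ t) :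
    M.toGo₁ d t = ∑ z : Fin 2, (M.psi d t).real (msgSet (M.msgRule d t) (some z)) *
        M.postCost d t z +
      (M.psi d t).real (msgSet (M.msgRule d t) none) * (M.c₁ + M.toGo₂ d t) := by
  have hB := measurableSet_blankBefore' hT₁ d t
  have hi := integrable_toGo hT₁ hT₂ d t t (M.μ[|M.blankBefore d t])
  simp only [psi_real_msgSet hT₁ hT₂ d ht]
  rw [toGo₁, integral_eq_sum_cond ((measurable_Z hT₁ d t).mono (M.obs₁_le t) le_rfl) hB hi,
    Fintype.sum_option, add_comm]
  congr 1
  · refine Finset.sum_congr rfl fun z _ => ?_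
    congr 1
    refine integral_congr_ae ?_
    filter_upwards [ae_cond_mem (measurableSet_finalSet' hT₁ d t (some z))] with ω hω
    simp [τ₁_of_mem_finalSet hT₁ ht hω]
  · rw [← blankBefore_succ d ht]
    by_cases h0 : M.μ (M.blankBefore d (t + 1)) = 0
    · have : (M.μ[|M.blankBefore d t]).real {ω | M.Z d t ω = none} = 0 := by
        rw [cond_real_apply hB, ← blankBefore_succ d ht, Measure.real, Measure.real, h0]
        simp
      rw [this, zero_mul, zero_mul]
    · have := cond_isProbabilityMeasure (μ := M.μ) h0
      congr 1
      have e : ∫ ω, (M.c₁ + (M.c₁ * ((M.τ₁ d ω : ℝ) - (t + 1)) + M.remaining₂ d t ω))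
          ∂(M.μ[|M.blankBefore d (t + 1)]) = M.c₁ + M.toGo₂ d t := by
        rw [integral_add (integrable_const _) (integrable_toGo hT₁ hT₂ d _ t _)]
        simp [toGo₂]
      rw [← e]
      congr 1
      funext ω
      ring

theorem toGo₁_last (hT₁ : 1 ≤ M.T₁) (hT₂ : 1 ≤ M.T₂) (d : Design) :
    M.toGo₁ d M.T₁ = ∑ z : Fin 2, (M.psi d M.T₁).real (msgSet (M.msgRule d M.T₁) (some z)) *
        M.postCost d M.T₁ z := by
  have : msgSet (M.msgRule d M.T₁) none = ∅ := by
    ext x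
    simp [msgSet, msgRule]
  rw [toGo₁_eq hT₁ hT₂ d hT₁, this]
  simp

/-- The cost of O2 at time `t`, before the final decision of O2. -/
def stageCost (M : Model Ω 𝒴₁ 𝒴₂) (d : Design) (t : ℕ) (ω : Ω) : ℝ :=
  if t ≤ M.τ₂ d ω then
    (match M.U d t ω with
      | some u => M.J u (M.H ω)
      | none => M.c₂) else 0

theorem integrable_stageCost (hT₁ : 1 ≤ M.T₁) (hT₂ : 1 ≤ M.T₂) (d : Design) {t : ℕ} (ht : 1 ≤ t)
    (ν : Measure Ω) [IsFiniteMeasure ν] : Integrable (M.stageCost d t) ν := by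
  have : M.stageCost d t = fun ω => M.remaining₂ d t ω - M.remaining₂ d (t + 1) ω := by
    funext ω
    rw [remaining₂_succ hT₂ d ht, add_sub_cancel_right]
    rfl
  rw [this]
  exact (integrable_remaining₂ hT₁ hT₂ d t ν).sub (integrable_remaining₂ hT₁ hT₂ d _ ν)

theorem measurable_stageIntegrand (g : TwoThr) : Measurable
    fun x : Fin 2 × Belief × Belief × Bool => (if x.2.2.2 then
      (match rule2 False g x.2.2.1 with
        | some u => M.J u x.1
        | none => M.c₂)
    else 0) := by
  have h1 : Measurable fun x : Fin 2 × Belief × Belief × Bool => x.2.2.1 := by fun_prop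
  have h2 : Measurable fun x : Fin 2 × Belief × Belief × Bool => x.2.2.2 := by fun_prop
  have h3 : Measurable fun y : Symb × Fin 2 =>
    (match y.1 with
        | some u => M.J u y.2
        | none => M.c₂) := measurable_of_countable _
  exact Measurable.ite (h2 (measurableSet_singleton true))
    (h3.comp (((measurable_rule2 False g).comp h1).prodMk measurable_fst)) measurable_const

/-- O2's decision is not conditioned upon: both costs-to-go are averages over the same event of
blanks up to `t`, so no weights appear. -/
theorem toGo₂_eq (hT₁ : 1 ≤ M.T₁) (hT : M.T₁ ≤ M.T₂) (d : Design) {t : ℕ} (ht : 1 ≤ t)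
    (htT : t < M.T₁) :
    M.toGo₂ d t = M.stageCost₂ (M.phi d t none) (d.o2 t) + M.toGo₁ d (t + 1) := by
  have hT₂ := hT₁.trans hT
  have hφ : M.stageCost₂ (M.phi d t none) (d.o2 t) =
      ∫ ω, M.stageCost d t ω ∂(M.μ[|M.blankBefore d (t + 1)]) := by
    refine (integral_map (measurable_H_postState hT₁ hT₂ d t).aemeasurable
      (measurable_stageIntegrand (M := M) (d.o2 t)).aestronglyMeasurable).trans ?_
    rw [← blankBefore_succ d ht]
    refine integral_congr_ae ?_
    filter_upwards [ae_cond_mem (measurableSet_blankBefore' hT₁ d (t + 1))] with ω hω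
    have hU := U_eq_of_blank hT₁ hω
    rw [rule2_congr (show t = M.T₂ ↔ False by simp; omega)] at hU
    by_cases h : t ≤ M.τ₂ d ω
    · simp [postState, stageCost, D, h, hU, belief₂_of_le h]
    · simp [postState, stageCost, D, h]
  rw [hφ, toGo₂, toGo₁, ← integral_add (integrable_stageCost hT₁ hT₂ d ht _)
    (integrable_toGo hT₁ hT₂ d _ _ _)]
  congr 1
  funext ω
  rw [show M.remaining₂ d t ω = M.stageCost d t ω + M.remaining₂ d (t + 1) ω from
    remaining₂_succ hT₂ d ht ω]
  push_cast
  ring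

/-! ### Costs after a final message -/

/-- Averaging over the hypothesis, given the information of O2. -/
theorem integral_H_eq (hT₁ : 1 ≤ M.T₁) (d : Design) (t : ℕ) {g : Fin 2 → Ω → ℝ}
    (hg : ∀ h, Measurable[M.info₂ d t] (g h)) {C : ℝ} (hC : ∀ h ω, |g h ω| ≤ C) :
    ∫ ω, g (M.H ω) ω ∂M.μ = ∫ ω, (M.rawBelief₂ d t ω * g 0 ω +
      (1 - M.rawBelief₂ d t ω) * g 1 ω) ∂M.μ := by
  have hle := info₂_le hT₁ d t
  have hgi : ∀ h, Integrable (g h) M.μ := fun h =>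
    Integrable.of_bound (C := C) ((hg h).mono hle le_rfl).aestronglyMeasurable
      (Filter.Eventually.of_forall (hC h))
  have hgH : Measurable fun ω => g (M.H ω) ω := by
    have : Measurable fun x : Ω × Fin 2 => g x.2 x.1 :=
      measurable_from_prod_countable_left fun h => (hg h).mono hle le_rfl
    exact this.comp (measurable_id.prodMk M.meas_H)
  have hgHi : Integrable (fun ω => g (M.H ω) ω) M.μ :=
    Integrable.of_bound (C := C) hgH.aestronglyMeasurable
      (Filter.Eventually.of_forall fun ω => hC _ ω)
  have hp : Integrable (fun ω => (M.rawBelief₂ d t ω : ℝ)) M.μ := integrable_posterior hle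
  have hp' : Integrable (fun ω => 1 - (M.rawBelief₂ d t ω : ℝ)) M.μ :=
    (integrable_const 1).sub hp
  rw [integral_add (hp.mul_bdd (c := C) (hgi 0).aestronglyMeasurable
      (Filter.Eventually.of_forall (hC 0)))
    (hp'.mul_bdd (c := C) (hgi 1).aestronglyMeasurable
      (Filter.Eventually.of_forall (hC 1))),
    ← integral_add_compl (M.measurableSet_H 0) hgHi]
  congr 1
  · refine Eq.trans ?_ (setIntegral_mul_posterior hle (M.measurableSet_H 0) (hg 0) (hC 0))
    exact setIntegral_congr_fun (M.measurableSet_H 0) fun ω (hω : M.H ω = 0) => by simp only [hω]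
  · refine Eq.trans ?_ (setIntegral_compl_mul_posterior hle (M.measurableSet_H 0) (hg 1) (hC 1))
    refine setIntegral_congr_fun (M.measurableSet_H 0).compl fun ω hω => ?_
    rw [compl_H] at hω
    have : M.H ω = 1 := hω
    simp only [this]

/-- The cost at time `t` when O2 follows the design, with continuation cost `C`. -/
def bellman (M : Model Ω 𝒴₁ 𝒴₂) (d : Design) (t : ℕ) (C : Belief → ℝ) (ω : Ω) : ℝ :=
  if t ≤ M.τ₂ d ω then
    (match M.U d t ω with
      | some u => M.stopCost u (M.rawBelief₂ d t ω)
      | none => C (M.rawBelief₂ d t ω)) else 0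

theorem measurable_bellman (hT₁ : 1 ≤ M.T₁) (hT₂ : 1 ≤ M.T₂) (d : Design) (t : ℕ)
    {C : Belief → ℝ} (hC : Measurable C) : Measurable (M.bellman d t C) := by
  have hle := info₂_le hT₁ d t
  have h : Measurable fun x : Belief × Symb =>
      (match x.2 with
        | some u => M.stopCost u x.1
        | none => C x.1) := by
    refine measurable_from_prod_countable_left fun z => ?_
    rcases z with _ | u
    · exact hC
    · exact (M.continuous_stopCost u).measurable
  exact Measurable.ite (hle _ (measurableSet_le_τ₂ hT₁ hT₂ d (by omega)))
    (h.comp (((M.measurable_rawBelief₂ d t).mono hle le_rfl).prodMk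
      ((measurable_U hT₁ d t).mono hle le_rfl))) measurable_const

theorem integrable_bellman (hT₁ : 1 ≤ M.T₁) (hT₂ : 1 ≤ M.T₂) (d : Design) (t : ℕ)
    {C : Belief → ℝ} (hC : Measurable C) {K : ℝ} (hK : ∀ p, |C p| ≤ K) (ν : Measure Ω)
    [IsFiniteMeasure ν] : Integrable (M.bellman d t C) ν := by
  have hK0 : 0 ≤ K := (abs_nonneg _).trans (hK 0)
  refine Integrable.of_bound (C := M.costBound + K)
    (measurable_bellman hT₁ hT₂ d t hC).aestronglyMeasurable
    (Filter.Eventually.of_forall fun ω => ?_)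
  rw [Real.norm_eq_abs, bellman]
  have h0 := M.costBound_nonneg
  split_ifs
  · rcases M.U d t ω with _ | u
    · exact (hK _).trans (by linarith)
    · exact (M.abs_stopCost_le u _).trans (by linarith)
  · rw [abs_zero]; linarith

/-- O2 knows whether it is still active and what it decides, so only `H` has to be averaged out,
which turns `J u H` into `stopCost u`. -/
theorem setIntegral_stageCost (hT₁ : 1 ≤ M.T₁) (hT₂ : 1 ≤ M.T₂) (d : Design) {t : ℕ}
    {E : Set Ω} (hE : MeasurableSet[M.info₂ d t] E) :
    ∫ ω in E, M.stageCost d t ω ∂M.μ = ∫ ω in E, M.bellman d t (fun _ => M.c₂) ω ∂M.μ := by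
  have hle := info₂_le hT₁ d t
  set g : Fin 2 → Ω → ℝ := fun h => E.indicator fun ω => if t ≤ M.τ₂ d ω then
    (match M.U d t ω with
      | some u => M.J u h
      | none => M.c₂) else 0 with hg
  have hgm : ∀ h, Measurable[M.info₂ d t] (g h) := fun h =>
    (Measurable.ite (measurableSet_le_τ₂ hT₁ hT₂ d (by omega))
      ((measurable_of_countable fun z : Symb => (match z with
        | some u => M.J u h
        | none => M.c₂)).comp (measurable_U hT₁ d t)) measurable_const).indicator hE
  have hgb : ∀ h ω, |g h ω| ≤ M.costBound + |M.c₂| := fun h ω => by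
    have h0 := M.costBound_nonneg
    have h1 := abs_nonneg M.c₂
    by_cases hω : ω ∈ E
    · simp only [hg, Set.indicator_of_mem hω]
      split_ifs
      · rcases M.U d t ω with _ | u
        · simp only; linarith
        · exact (M.abs_J_le u h).trans (by linarith)
      · rw [abs_zero]; linarith
    · simp only [hg, Set.indicator_of_notMem hω, abs_zero]
      linarith
  have := integral_H_eq hT₁ d t hgm hgb
  rw [← integral_indicator (hle _ hE), ← integral_indicator (hle _ hE)]
  refine Eq.trans ?_ (this.trans ?_)
  · refine integral_congr_ae (Filter.Eventually.of_forall fun ω => ?_)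
    by_cases hω : ω ∈ E <;> simp [hg, hω, stageCost]
  · refine integral_congr_ae (Filter.Eventually.of_forall fun ω => ?_)
    by_cases hω : ω ∈ E
    · by_cases hτ : t ≤ M.τ₂ d ω
      · rcases hU : M.U d t ω with _ | u
        · simp [hg, hω, bellman, hτ, hU]
          ring
        · simp [hg, hω, bellman, hτ, hU, stopCost]
      · simp [hg, hω, bellman, hτ]
    · simp [hg, hω]

/-- Expected cost of the Wald problem after the next measurement of O2. -/
theorem setIntegral_comp_bayes (hT₁ : 1 ≤ M.T₁) (d : Design) (t : ℕ) {E : Set Ω}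
    (hE : MeasurableSet[M.info₂ d t] E) {V : Belief → ℝ} (hV : Measurable V) {K : ℝ}
    (hK : ∀ p, |V p| ≤ K) :
    ∫ ω in E, V (M.bayes (t + 1) (M.rawBelief₂ d t ω) (M.Y₂ (t + 1) ω)) ∂M.μ =
      ∫ ω in E, (M.contCost t V (M.rawBelief₂ d t ω) - M.c₂) ∂M.μ := by
  have hle := info₂_le hT₁ d t
  have hle' : M.info₂ d t ≤ M.allObs₁ ⊔ M.obs₂ t :=
    (info₂_le_sup hT₁ d t).trans (sup_le_sup_right (M.obs₁_le_all t) _)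
  have hq := M.measurable_rawBelief₂ d t
  have hq' : Measurable (M.rawBelief₂ d t) := hq.mono hle le_rfl
  set k : Fin 2 → Belief → ℝ := fun h p => ∫ y, V (M.bayes (t + 1) p y) ∂(M.P₂ (t + 1) h) with hk
  have hkm : ∀ h, Measurable (k h) := fun h => M.measurable_integral_bayes (t + 1) h hV
  have hkb : ∀ h p, |k h p| ≤ K := fun h p => by
    have := norm_integral_le_of_norm_le_const (μ := M.P₂ (t + 1) h)
      (f := fun y => V (M.bayes (t + 1) p y)) (C := K) (Filter.Eventually.of_forall fun y => hK _)
    simpa using this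
  have hVb : Measurable fun x : Belief × 𝒴₂ => V (M.bayes (t + 1) x.1 x.2) := by
    simp only [bayes_eq]
    exact hV.comp (measurable_bayesUpdate (M.P₂ (t + 1)) fun _ => 1)
  have hVi : ∀ (ν : Measure (Belief × 𝒴₂)) [IsFiniteMeasure ν],
      Integrable (fun x : Belief × 𝒴₂ => V (M.bayes (t + 1) x.1 x.2)) ν := fun ν _ =>
    Integrable.of_bound (C := K) hVb.aestronglyMeasurable
      (Filter.Eventually.of_forall fun x => hK _)
  have hqY : Measurable fun ω => (M.rawBelief₂ d t ω, M.Y₂ (t + 1) ω) :=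
    hq'.prodMk (M.meas_Y₂ (t + 1))
  -- Given `H = h` the next measurement is independent of the current belief and of `E`, so Fubini's
  -- theorem applies. The remaining dependence on `H` is then averaged with the belief.
  have key : ∀ h, ∫ ω in E ∩ M.H ⁻¹' {h},
      V (M.bayes (t + 1) (M.rawBelief₂ d t ω) (M.Y₂ (t + 1) ω)) ∂M.μ =
        ∫ ω in E ∩ M.H ⁻¹' {h}, k h (M.rawBelief₂ d t ω) ∂M.μ := fun h => by
    have hmap := map_prodMk_Y₂ h t (hq.mono hle' le_rfl) (hle' _ hE)
    have e1 := integral_map (μ := M.μ.restrict (E ∩ M.H ⁻¹' {h})) hqY.aemeasurable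
      (f := fun x : Belief × 𝒴₂ => V (M.bayes (t + 1) x.1 x.2)) hVb.aestronglyMeasurable
    rw [← e1, hmap, integral_prod _ (hVi _), integral_map hq'.aemeasurable
      (hkm h).aestronglyMeasurable]
  have hsplit : ∀ f : Ω → ℝ, Integrable f M.μ → ∫ ω in E, f ω ∂M.μ =
      ∫ ω in E ∩ M.H ⁻¹' {0}, f ω ∂M.μ + ∫ ω in E ∩ M.H ⁻¹' {1}, f ω ∂M.μ := fun f hf => by
    rw [← compl_H, ← Set.sdiff_eq]
    exact (integral_inter_add_sdiff (M.measurableSet_H 0) hf.integrableOn).symm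
  have hfi : Integrable (fun ω => V (M.bayes (t + 1) (M.rawBelief₂ d t ω) (M.Y₂ (t + 1) ω))) M.μ :=
    Integrable.of_bound (C := K) (hVb.comp hqY).aestronglyMeasurable
      (Filter.Eventually.of_forall fun ω => hK _)
  have hkHm : Measurable fun ω => k (M.H ω) (M.rawBelief₂ d t ω) := by
    have : Measurable fun x : Belief × Fin 2 => k x.2 x.1 :=
      measurable_from_prod_countable_left fun h => hkm h
    exact this.comp (hq'.prodMk M.meas_H)
  have hki : Integrable (fun ω => k (M.H ω) (M.rawBelief₂ d t ω)) M.μ :=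
    Integrable.of_bound (C := K) hkHm.aestronglyMeasurable
      (Filter.Eventually.of_forall fun ω => hkb _ _)
  have hH : ∀ h, ∫ ω in E ∩ M.H ⁻¹' {h}, k h (M.rawBelief₂ d t ω) ∂M.μ =
      ∫ ω in E ∩ M.H ⁻¹' {h}, k (M.H ω) (M.rawBelief₂ d t ω) ∂M.μ := fun h =>
    setIntegral_congr_fun ((hle _ hE).inter (M.measurableSet_H h)) fun ω hω => by
      rw [show M.H ω = h from hω.2]
  rw [hsplit _ hfi, key, key, hH, hH, ← hsplit _ hki]
  have hav := integral_H_eq hT₁ d t (g := fun h => E.indicator fun ω => k h (M.rawBelief₂ d t ω))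
    (fun h => ((hkm h).comp hq).indicator hE) (C := K) (fun h ω => by
      by_cases hω : ω ∈ E
      · simpa [hω] using hkb h _
      · simpa [hω] using (abs_nonneg _).trans (hkb 0 0))
  rw [← integral_indicator (hle _ hE), ← integral_indicator (hle _ hE)]
  refine Eq.trans ?_ (hav.trans ?_)
  · refine integral_congr_ae (Filter.Eventually.of_forall fun ω => ?_)
    by_cases hω : ω ∈ E <;> simp [hω]
  · refine integral_congr_ae (Filter.Eventually.of_forall fun ω => ?_)
    by_cases hω : ω ∈ E
    · simp [hω, contCost, hk]
    · simp [hω]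

/-- The Wald cost at time `t` on the event that O2 has not stopped before. -/
def waldIntegrand (M : Model Ω 𝒴₁ 𝒴₂) (d : Design) (t : ℕ) (ω : Ω) : ℝ :=
  if t ≤ M.τ₂ d ω then M.waldCost (M.T₂ - t) t (M.rawBelief₂ d t ω) else 0

theorem measurable_waldIntegrand (hT₁ : 1 ≤ M.T₁) (hT₂ : 1 ≤ M.T₂) (d : Design) (t : ℕ) :
    Measurable (M.waldIntegrand d t) := by
  have hle := info₂_le hT₁ d t
  exact Measurable.ite (hle _ (measurableSet_le_τ₂ hT₁ hT₂ d (by omega)))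
    ((M.measurable_waldCost _ t).comp ((M.measurable_rawBelief₂ d t).mono hle le_rfl))
    measurable_const

theorem integrable_waldIntegrand (hT₁ : 1 ≤ M.T₁) (hT₂ : 1 ≤ M.T₂) (hc₂ : 0 ≤ M.c₂) (d : Design)
    (t : ℕ) (ν : Measure Ω) [IsFiniteMeasure ν] : Integrable (M.waldIntegrand d t) ν := by
  refine Integrable.of_bound (C := M.costBound)
    (measurable_waldIntegrand hT₁ hT₂ d t).aestronglyMeasurable
    (Filter.Eventually.of_forall fun ω => ?_)
  rw [Real.norm_eq_abs, waldIntegrand]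
  split_ifs
  · exact M.abs_waldCost_le hc₂ _ _ _
  · rw [abs_zero]; exact M.costBound_nonneg

/-- O2 reaches `t + 1` exactly when it is active at `t` and continues. There the expected next Wald
cost is `contCost - c₂`, and the `c₂` charged in the first integral restores the full continuation
cost. -/
theorem setIntegral_bellman_add (hT₁ : 1 ≤ M.T₁) (hT : M.T₁ ≤ M.T₂) (hc₂ : 0 ≤ M.c₂) (d : Design)
    {s t : ℕ} (hs : 1 ≤ s) (hst : s ≤ t) (z : Fin 2) :
    ∫ ω in M.finalSet d s (some z), M.bellman d t (fun _ => M.c₂) ω ∂M.μ +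
      ∫ ω in M.finalSet d s (some z), M.waldIntegrand d (t + 1) ω ∂M.μ =
      ∫ ω in M.finalSet d s (some z),
        M.bellman d t (M.contCost t (M.waldCost (M.T₂ - (t + 1)) (t + 1))) ω ∂M.μ := by
  have hT₂ := hT₁.trans hT
  have hle := info₂_le hT₁ d t
  set E := M.finalSet d s (some z) with hE
  have hEm : MeasurableSet[M.info₂ d t] E := measurableSet_finalSet_info d hs hst (some z)
  set V := M.waldCost (M.T₂ - (t + 1)) (t + 1) with hV
  have hVm : Measurable V := M.measurable_waldCost _ _
  have hVb : ∀ p, |V p| ≤ M.costBound := M.abs_waldCost_le hc₂ _ _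
  set S : Set Ω := {ω | t + 1 ≤ M.τ₂ d ω} with hS
  have hSm : MeasurableSet[M.info₂ d t] S := measurableSet_le_τ₂ hT₁ hT₂ d le_rfl
  have h1 : ∫ ω in E, M.waldIntegrand d (t + 1) ω ∂M.μ =
      ∫ ω in E, S.indicator (fun ω => M.contCost t V (M.rawBelief₂ d t ω) - M.c₂) ω ∂M.μ := by
    rw [setIntegral_indicator (hle _ hSm),
      ← setIntegral_comp_bayes hT₁ d t (MeasurableSet.inter hEm hSm) hVm hVb,
      ← setIntegral_indicator (hle _ hSm)]
    refine setIntegral_congr_ae (hle _ hEm) ?_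
    filter_upwards [rawBelief₂_after_final hT₁ d hs hst z] with ω hω hωE
    by_cases hωS : t + 1 ≤ M.τ₂ d ω
    · rw [Set.indicator_of_mem (show ω ∈ S from hωS), ← hω hωE]
      simp [waldIntegrand, hωS, hV]
    · rw [Set.indicator_of_notMem (show ω ∉ S from hωS)]
      simp [waldIntegrand, hωS]
  have hCb : Measurable (M.contCost t V) := M.measurable_contCost t hVm
  have hCbd := M.abs_contCost_le hc₂ t hVm hVb
  have hSi : Integrable (S.indicator fun ω => M.contCost t V (M.rawBelief₂ d t ω) - M.c₂)
      (M.μ.restrict E) := by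
    refine Integrable.indicator ?_ (hle _ hSm)
    refine Integrable.sub ?_ (integrable_const _)
    exact Integrable.of_bound (C := M.c₂ + M.costBound)
      (hCb.comp ((M.measurable_rawBelief₂ d t).mono hle le_rfl)).aestronglyMeasurable
      (Filter.Eventually.of_forall fun ω => hCbd _)
  rw [h1, ← integral_add (integrable_bellman hT₁ hT₂ d t measurable_const (K := |M.c₂|)
    (fun _ => le_rfl) _) hSi]
  congr 1
  funext ω
  by_cases hωS : t + 1 ≤ M.τ₂ d ω
  · have h' := (succ_le_τ₂_iff hT₂ (hs.trans hst)).1 hωS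
    rw [Set.indicator_of_mem (show ω ∈ S from hωS)]
    simp [bellman, h'.1, h'.2]
  · rw [Set.indicator_of_notMem (show ω ∉ S from hωS), add_zero]
    by_cases hτ : t ≤ M.τ₂ d ω
    · have hU : M.U d t ω ≠ none := fun hU =>
        hωS ((succ_le_τ₂_iff hT₂ (hs.trans hst)).2 ⟨hτ, hU⟩)
      obtain ⟨u, hu⟩ := Option.ne_none_iff_exists'.1 hU
      simp [bellman, hτ, hu]
    · simp [bellman, hτ]

/-- Bellman's inequality, pointwise: no decision beats the minimum. Continuing is impossible at
`M.T₂`, so the truncated subtraction `M.T₂ - (t + 1)` is harmless there. -/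
theorem waldIntegrand_le_bellman {d : Design} {t : ℕ} (htT : t ≤ M.T₂) (ω : Ω) :
    M.waldIntegrand d t ω ≤
      M.bellman d t (M.contCost t (M.waldCost (M.T₂ - (t + 1)) (t + 1))) ω := by
  unfold waldIntegrand bellman
  split_ifs
  · rcases hU : M.U d t ω with _ | u
    · have hlt : t ≠ M.T₂ := by
        rintro rfl
        exact U_horizon d ω hU
      have : M.T₂ - t = (M.T₂ - (t + 1)) + 1 := by omega
      rw [this]
      exact M.waldCost_succ_le_contCost _ _ _
    · exact M.waldCost_le_stopCost _ _ u _
  · exact le_rfl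

theorem waldIntegrand_eq_bellman (hT₁ : 1 ≤ M.T₁) {d : Design} {s t : ℕ} (hs : 1 ≤ s) (hst : s ≤ t)
    (htT : t ≤ M.T₂) {z : Fin 2} (hw : M.IsWaldThr (M.T₂ - t) t (d.post s z t)) {ω : Ω}
    (hω : ω ∈ M.finalSet d s (some z)) : M.waldIntegrand d t ω =
      M.bellman d t (M.contCost t (M.waldCost (M.T₂ - (t + 1)) (t + 1))) ω := by
  unfold waldIntegrand bellman
  split_ifs
  · rw [U_eq_of_final hT₁ hs hst hω, ← hw (M.rawBelief₂ d t ω), Nat.sub_sub]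
    rw [rule2_congr (show t = M.T₂ ↔ M.T₂ - t = 0 by omega)]
  · rfl

theorem remaining₂_eq_zero (hT₂ : 1 ≤ M.T₂) (d : Design) (ω : Ω) :
    M.remaining₂ d (M.T₂ + 1) ω = 0 := by
  have := τ₂_le hT₂ d ω
  exact if_neg (by omega)

theorem setIntegral_remaining₂ (hT₁ : 1 ≤ M.T₁) (hT₂ : 1 ≤ M.T₂) (d : Design) {s t : ℕ}
    (hs : 1 ≤ s) (hst : s ≤ t) (z : Fin 2) :
    ∫ ω in M.finalSet d s (some z), M.remaining₂ d t ω ∂M.μ =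
      ∫ ω in M.finalSet d s (some z), M.bellman d t (fun _ => M.c₂) ω ∂M.μ +
        ∫ ω in M.finalSet d s (some z), M.remaining₂ d (t + 1) ω ∂M.μ := by
  rw [← setIntegral_stageCost hT₁ hT₂ d (measurableSet_finalSet_info d hs hst (some z)),
    ← integral_add (integrable_stageCost hT₁ hT₂ d (hs.trans hst) _)
      (integrable_remaining₂ hT₁ hT₂ d _ _)]
  congr 1
  funext ω
  exact remaining₂_succ hT₂ d (hs.trans hst) ω

/-- At the horizon O2 stops, so the continuation cost is never charged. This starts the two backward
inductions below. -/
theorem setIntegral_bellman_last {d : Design} {E : Set Ω} (C C' : Belief → ℝ) :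
    ∫ ω in E, M.bellman d M.T₂ C ω ∂M.μ = ∫ ω in E, M.bellman d M.T₂ C' ω ∂M.μ := by
  congr 1
  funext ω
  obtain ⟨u, hu⟩ := Option.ne_none_iff_exists'.1 (U_horizon (M := M) d ω)
  simp [bellman, hu]

theorem integrable_bellman_wald (hT₁ : 1 ≤ M.T₁) (hT₂ : 1 ≤ M.T₂) (hc₂ : 0 ≤ M.c₂) (d : Design)
    (t : ℕ) (ν : Measure Ω) [IsFiniteMeasure ν] :
    Integrable (M.bellman d t (M.contCost t (M.waldCost (M.T₂ - (t + 1)) (t + 1)))) ν := by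
  have hVb := M.abs_waldCost_le hc₂ (M.T₂ - (t + 1)) (t + 1)
  have hVm := M.measurable_waldCost (M.T₂ - (t + 1)) (t + 1)
  refine integrable_bellman hT₁ hT₂ d t (M.measurable_contCost t hVm)
    (M.abs_contCost_le hc₂ t hVm hVb) ν

/-- After a final message, the cost of O2 is at least the Wald cost. -/
theorem waldIntegral_le (hT₁ : 1 ≤ M.T₁) (hT : M.T₁ ≤ M.T₂) (hc₂ : 0 ≤ M.c₂) (d : Design)
    {s t : ℕ} (hs : 1 ≤ s) (hst : s ≤ t) (htT : t ≤ M.T₂) (z : Fin 2) :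
    ∫ ω in M.finalSet d s (some z), M.waldIntegrand d t ω ∂M.μ ≤
      ∫ ω in M.finalSet d s (some z), M.remaining₂ d t ω ∂M.μ := by
  have hT₂ := hT₁.trans hT
  have hmono : ∀ t ≤ M.T₂, ∫ ω in M.finalSet d s (some z), M.waldIntegrand d t ω ∂M.μ ≤
      ∫ ω in M.finalSet d s (some z),
        M.bellman d t (M.contCost t (M.waldCost (M.T₂ - (t + 1)) (t + 1))) ω ∂M.μ := fun t ht =>
    integral_mono (integrable_waldIntegrand hT₁ hT₂ hc₂ d t _)
      (integrable_bellman_wald hT₁ hT₂ hc₂ d t _) fun ω => waldIntegrand_le_bellman ht ω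
  induction htT using Nat.decreasingInduction with
  | self =>
    refine (hmono _ le_rfl).trans (le_of_eq ?_)
    rw [setIntegral_remaining₂ hT₁ hT₂ d hs hst]
    simp only [remaining₂_eq_zero hT₂, integral_zero, add_zero]
    exact setIntegral_bellman_last _ _
  | of_succ k hk ih =>
    refine (hmono _ hk.le).trans ?_
    rw [setIntegral_remaining₂ hT₁ hT₂ d hs hst,
      ← setIntegral_bellman_add hT₁ hT hc₂ d hs hst]
    exact add_le_add le_rfl (ih (by omega))

/-- With Wald thresholds after a final message, the cost of O2 is the Wald cost. -/
theorem waldIntegral_eq (hT₁ : 1 ≤ M.T₁) (hT : M.T₁ ≤ M.T₂) (hc₂ : 0 ≤ M.c₂) {d : Design}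
    (hw : M.UsesWald d) {s t : ℕ} (hs : 1 ≤ s) (hsT : s ≤ M.T₁) (hst : s ≤ t) (htT : t ≤ M.T₂)
    (z : Fin 2) :
    ∫ ω in M.finalSet d s (some z), M.waldIntegrand d t ω ∂M.μ =
      ∫ ω in M.finalSet d s (some z), M.remaining₂ d t ω ∂M.μ := by
  have hT₂ := hT₁.trans hT
  have heq : ∀ t, s ≤ t → t ≤ M.T₂ → ∫ ω in M.finalSet d s (some z), M.waldIntegrand d t ω ∂M.μ =
      ∫ ω in M.finalSet d s (some z),
        M.bellman d t (M.contCost t (M.waldCost (M.T₂ - (t + 1)) (t + 1))) ω ∂M.μ :=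
    fun t hst ht => setIntegral_congr_fun (measurableSet_finalSet' hT₁ d s (some z)) fun ω hω =>
      waldIntegrand_eq_bellman hT₁ hs hst ht (hw s z t hs hsT hst ht) hω
  induction htT using Nat.decreasingInduction with
  | self =>
    refine (heq _ hst le_rfl).trans ?_
    rw [setIntegral_remaining₂ hT₁ hT₂ d hs hst]
    simp only [remaining₂_eq_zero hT₂, integral_zero, add_zero]
    exact setIntegral_bellman_last _ _
  | of_succ k hk ih =>
    refine (heq _ hst hk.le).trans ?_
    rw [setIntegral_remaining₂ hT₁ hT₂ d hs hst,
      ← setIntegral_bellman_add hT₁ hT hc₂ d hs hst, ih (by omega)]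

theorem waldTerm_phi (hT₁ : 1 ≤ M.T₁) (hT₂ : 1 ≤ M.T₂) (d : Design) (t : ℕ) (z : Symb) :
    M.waldTerm t (M.phi d t z) =
      (M.μ.real (M.finalSet d t z))⁻¹ * ∫ ω in M.finalSet d t z, M.waldIntegrand d t ω ∂M.μ := by
  have hm : Measurable fun x : Fin 2 × Belief × Belief × Bool =>
      if x.2.2.2 then M.waldCost (M.T₂ - t) t x.2.2.1 else 0 := by
    have h1 : Measurable fun x : Fin 2 × Belief × Belief × Bool => x.2.2.1 := by fun_prop
    have h2 : Measurable fun x : Fin 2 × Belief × Belief × Bool => x.2.2.2 := by fun_prop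
    exact Measurable.ite (h2 (measurableSet_singleton true))
      ((M.measurable_waldCost _ t).comp h1) measurable_const
  rw [waldTerm, phi_eq, integral_map (measurable_H_postState hT₁ hT₂ d t).aemeasurable
    hm.aestronglyMeasurable, ← integral_cond]
  congr 1
  funext ω
  by_cases h : t ≤ M.τ₂ d ω
  · simp [postState, waldIntegrand, D, h, belief₂_of_le h]
  · simp [postState, waldIntegrand, D, h]

theorem waldTerm_le_postCost (hT₁ : 1 ≤ M.T₁) (hT : M.T₁ ≤ M.T₂) (hc₂ : 0 ≤ M.c₂) (d : Design)
    {t : ℕ} (ht : 1 ≤ t) (htT : t ≤ M.T₁) (z : Fin 2) :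
    M.waldTerm t (M.phi d t (some z)) ≤ M.postCost d t z := by
  rw [waldTerm_phi hT₁ (hT₁.trans hT), postCost, integral_cond]
  exact mul_le_mul_of_nonneg_left (waldIntegral_le hT₁ hT hc₂ d ht le_rfl (htT.trans hT) z)
    (inv_nonneg.2 measureReal_nonneg)

theorem waldTerm_eq_postCost (hT₁ : 1 ≤ M.T₁) (hT : M.T₁ ≤ M.T₂) (hc₂ : 0 ≤ M.c₂) {d : Design}
    (hw : M.UsesWald d) {t : ℕ} (ht : 1 ≤ t) (htT : t ≤ M.T₁) (z : Fin 2) :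
    M.waldTerm t (M.phi d t (some z)) = M.postCost d t z := by
  rw [waldTerm_phi hT₁ (hT₁.trans hT), postCost, integral_cond,
    waldIntegral_eq hT₁ hT hc₂ hw ht htT le_rfl (htT.trans hT) z]

end Model

/-! ### Infima of bounded families -/

instance : Nonempty FourThr := ⟨⟨0, 0, 0, 0, le_rfl, le_rfl, le_rfl, le_rfl, zero_le_one⟩⟩

instance : Nonempty TwoThr := ⟨⟨0, 0, le_rfl, le_rfl, zero_le_one⟩⟩

theorem abs_ciInf_le {ι : Type*} [Nonempty ι] {f : ι → ℝ} {b : ℝ} (h : ∀ i, |f i| ≤ b) :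
    |⨅ i, f i| ≤ b := by
  have hbdd : BddBelow (Set.range f) := ⟨-b, by rintro _ ⟨i, rfl⟩; exact (abs_le.1 (h i)).1⟩
  refine abs_le.2 ⟨le_ciInf fun i => (abs_le.1 (h i)).1, ?_⟩
  obtain ⟨i⟩ := ‹Nonempty ι›
  exact (ciInf_le hbdd i).trans (abs_le.1 (h i)).2

theorem isGLB_ciInf_of_abs_le {ι : Type*} [Nonempty ι] {f : ι → ℝ} {b : ℝ} (h : ∀ i, |f i| ≤ b) :
    IsGLB (Set.range f) (⨅ i, f i) :=
  isGLB_ciInf ⟨-b, by rintro _ ⟨i, rfl⟩; exact (abs_le.1 (h i)).1⟩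

theorem exists_lt_ciInf_add {ι : Type*} [Nonempty ι] {f : ι → ℝ} {a ε : ℝ}
    (h : IsGLB (Set.range f) a) (hε : 0 < ε) : ∃ i, f i ≤ a + ε := by
  obtain ⟨_, ⟨i, rfl⟩, _, hi⟩ := h.exists_between (lt_add_of_pos_right a hε)
  exact ⟨i, hi.le⟩

namespace Model

variable {Ω 𝒴₁ 𝒴₂ : Type*} [MeasurableSpace Ω] [MeasurableSpace 𝒴₁] [MeasurableSpace 𝒴₂]
variable (M : Model Ω 𝒴₁ 𝒴₂)

/-! ### The dynamic program -/

/-- The rule of O1 at its horizon, as a message rule. -/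
def lastRule (a : Belief) (p : Belief) : Symb := some (rule1Last a p)

/-- Expected cost of the final messages sent by the rule `ρ`. -/
def finalCost (t : ℕ) (ψ : InfoState) (ρ : Belief → Symb) : ℝ :=
  ∑ z : Fin 2, ψ.real (msgSet ρ (some z)) * M.waldTerm t (M.msgUpdate t ψ ρ (some z))

/-- The function `𝒢` with the cost-to-go `V` at the next time. -/
def stageG (t : ℕ) (V : InfoState → ℝ) (φ : InfoState) (g : TwoThr) : ℝ :=
  M.stageCost₂ φ g + V (M.obsUpdate t φ g)

/-- The function `ℱ` with the cost-to-go `V` at the next time. -/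
def stageF (t : ℕ) (V : InfoState → ℝ) (ψ : InfoState) (g : FourThr) : ℝ :=
  M.finalCost t ψ (rule1 g) + ψ.real (msgSet (rule1 g) none) *
    (M.c₁ + ⨅ g', M.stageG t V (M.msgUpdate t ψ (rule1 g) none) g')

/-- Optimal cost-to-go when `n` further measurements of O1 are available after time `t`. -/
def optValue : ℕ → ℕ → InfoState → ℝ
  | 0, t, ψ => ⨅ a, M.finalCost t ψ (lastRule a)
  | n + 1, t, ψ => ⨅ g, M.stageF t (optValue n (t + 1)) ψ g

/-- `ℱ*`. -/
def starF (t : ℕ) : InfoState → ℝ := M.optValue (M.T₁ - t) t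

/-- `𝒢*`. -/
def starG (t : ℕ) (φ : InfoState) : ℝ := ⨅ g, M.stageG t (M.starF (t + 1)) φ g

variable {M}

theorem starF_of_lt {t : ℕ} (h : t < M.T₁) (ψ : InfoState) :
    M.starF t ψ = ⨅ g, M.stageF t (M.starF (t + 1)) ψ g := by
  have : M.T₁ - t = (M.T₁ - (t + 1)) + 1 := by omega
  rw [starF, this]
  rfl

theorem starF_last (ψ : InfoState) : M.starF M.T₁ ψ = ⨅ a, M.finalCost M.T₁ ψ (lastRule a) := by
  rw [starF, Nat.sub_self]
  rfl

/-- Conditioning normalizes any finite `ψ`, or gives zero, so the later values are bounded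
independently of the mass of `ψ`. -/
theorem msgUpdate_real_univ_le (t : ℕ) (ψ : InfoState) (ρ : Belief → Symb) (z : Symb) :
    IsFiniteMeasure (M.msgUpdate t ψ ρ z) ∧ (M.msgUpdate t ψ ρ z).real Set.univ ≤ 1 := by
  have h : M.msgUpdate t ψ ρ z Set.univ ≤ 1 := by
    rw [msgUpdate, transition_univ _ (M.measurable_msgStep _ _)]
    exact prob_le_one
  exact ⟨⟨h.trans_lt ENNReal.one_lt_top⟩, ENNReal.toReal_le_of_le_ofReal zero_le_one (by simpa)⟩

theorem obsUpdate_real_univ (t : ℕ) (φ : InfoState) [IsFiniteMeasure φ] (g : TwoThr) :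
    IsFiniteMeasure (M.obsUpdate t φ g) ∧ (M.obsUpdate t φ g).real Set.univ = φ.real Set.univ := by
  refine ⟨isFiniteMeasure_transition _ (M.measurable_obsStep _ _) φ, ?_⟩
  rw [Measure.real, obsUpdate, transition_univ _ (M.measurable_obsStep _ _)]
  rfl

theorem abs_waldTerm_le (hc₂ : 0 ≤ M.c₂) (t : ℕ) (φ : InfoState) [IsFiniteMeasure φ] :
    |M.waldTerm t φ| ≤ M.costBound * φ.real Set.univ := by
  rw [waldTerm, ← Real.norm_eq_abs]
  refine norm_integral_le_of_norm_le_const (Filter.Eventually.of_forall fun x => ?_)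
  rw [Real.norm_eq_abs]
  split_ifs
  · exact M.abs_waldCost_le hc₂ _ _ _
  · rw [abs_zero]; exact M.costBound_nonneg

theorem abs_stageCost₂_le (φ : InfoState) [IsFiniteMeasure φ] (g : TwoThr) :
    |M.stageCost₂ φ g| ≤ (M.costBound + |M.c₂|) * φ.real Set.univ := by
  rw [stageCost₂, ← Real.norm_eq_abs]
  refine norm_integral_le_of_norm_le_const (Filter.Eventually.of_forall fun x => ?_)
  have h0 := M.costBound_nonneg
  have h1 := abs_nonneg M.c₂
  rw [Real.norm_eq_abs]
  split_ifs
  · rcases rule2 False g x.2.2.1 with _ | u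
    · simp only; linarith
    · exact (M.abs_J_le u _).trans (by linarith)
  · rw [abs_zero]; linarith

theorem abs_finalCost_le (hc₂ : 0 ≤ M.c₂) (t : ℕ) (ψ : InfoState) [IsFiniteMeasure ψ]
    (ρ : Belief → Symb) : |M.finalCost t ψ ρ| ≤ 2 * M.costBound * ψ.real Set.univ := by
  have key : ∀ z : Fin 2, |ψ.real (msgSet ρ (some z)) *
      M.waldTerm t (M.msgUpdate t ψ ρ (some z))| ≤ M.costBound * ψ.real Set.univ := fun z => by
    obtain ⟨hf, h1⟩ := msgUpdate_real_univ_le (M := M) t ψ ρ (some z)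
    have h2 : |M.waldTerm t (M.msgUpdate t ψ ρ (some z))| ≤ M.costBound :=
      (abs_waldTerm_le hc₂ t _).trans (mul_le_of_le_one_right M.costBound_nonneg h1)
    rw [abs_mul, abs_of_nonneg measureReal_nonneg, mul_comm]
    exact mul_le_mul h2 (measureReal_mono (Set.subset_univ _)) measureReal_nonneg
      M.costBound_nonneg
  rw [finalCost, Fin.sum_univ_two]
  refine (abs_add_le _ _).trans ((add_le_add (key 0) (key 1)).trans (le_of_eq (by ring)))

theorem abs_stageG_le {V : InfoState → ℝ} {C : ℝ}
    (hV : ∀ ψ : InfoState, IsFiniteMeasure ψ → |V ψ| ≤ C * ψ.real Set.univ) (t : ℕ)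
    (φ : InfoState) [IsFiniteMeasure φ] (g : TwoThr) :
    |M.stageG t V φ g| ≤ (M.costBound + |M.c₂| + C) * φ.real Set.univ := by
  obtain ⟨hf, h1⟩ := obsUpdate_real_univ (M := M) t φ g
  have h2 := hV _ hf
  rw [h1] at h2
  refine (abs_add_le _ _).trans ((add_le_add (abs_stageCost₂_le φ g) h2).trans (le_of_eq ?_))
  ring

theorem abs_stageF_le (hc₂ : 0 ≤ M.c₂) {V : InfoState → ℝ} {C : ℝ} (hC : 0 ≤ C)
    (hV : ∀ ψ : InfoState, IsFiniteMeasure ψ → |V ψ| ≤ C * ψ.real Set.univ) (t : ℕ)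
    (ψ : InfoState) [IsFiniteMeasure ψ] (g : FourThr) :
    |M.stageF t V ψ g| ≤
      (3 * M.costBound + |M.c₁| + |M.c₂| + C) * ψ.real Set.univ := by
  obtain ⟨hf, h1⟩ := msgUpdate_real_univ_le (M := M) t ψ (rule1 g) none
  have hK : 0 ≤ M.costBound + |M.c₂| + C :=
    add_nonneg (add_nonneg M.costBound_nonneg (abs_nonneg _)) hC
  have h2 : |⨅ g', M.stageG t V (M.msgUpdate t ψ (rule1 g) none) g'| ≤
      M.costBound + |M.c₂| + C :=
    abs_ciInf_le fun g' => (abs_stageG_le hV t _ g').trans (mul_le_of_le_one_right hK h1)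
  have h3 : |M.c₁ + ⨅ g', M.stageG t V (M.msgUpdate t ψ (rule1 g) none) g'| ≤
      |M.c₁| + (M.costBound + |M.c₂| + C) := (abs_add_le _ _).trans (add_le_add le_rfl h2)
  have h4 : |ψ.real (msgSet (rule1 g) none) *
      (M.c₁ + ⨅ g', M.stageG t V (M.msgUpdate t ψ (rule1 g) none) g')| ≤
      ψ.real Set.univ * (|M.c₁| + (M.costBound + |M.c₂| + C)) := by
    rw [abs_mul, abs_of_nonneg measureReal_nonneg]
    exact mul_le_mul (measureReal_mono (Set.subset_univ _)) h3 (abs_nonneg _) measureReal_nonneg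
  refine (abs_add_le _ _).trans ((add_le_add (abs_finalCost_le hc₂ t ψ _) h4).trans (le_of_eq ?_))
  ring

/-- A real `⨅` is a greatest lower bound only for families bounded below, so bounds are needed at
all finite measures and not just at reachable states. Proportionality to the mass also forces the
value `0` at the zero measure, as used for null events. -/
theorem exists_abs_optValue_le (hc₂ : 0 ≤ M.c₂) (n t : ℕ) : ∃ C, 0 ≤ C ∧
    ∀ ψ : InfoState, IsFiniteMeasure ψ → |M.optValue n t ψ| ≤ C * ψ.real Set.univ := by
  have h0 := M.costBound_nonneg
  induction n generalizing t with
  | zero =>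
    exact ⟨2 * M.costBound, by positivity, fun ψ _ =>
      abs_ciInf_le fun a => abs_finalCost_le hc₂ t ψ _⟩
  | succ n ih =>
    obtain ⟨C, hC, hV⟩ := ih (t + 1)
    exact ⟨3 * M.costBound + |M.c₁| + |M.c₂| + C, by positivity, fun ψ _ =>
      abs_ciInf_le fun g => abs_stageF_le hc₂ hC hV t ψ g⟩

theorem isGLB_stageF (hc₂ : 0 ≤ M.c₂) {t : ℕ} (ht : t < M.T₁) (ψ : InfoState)
    [IsFiniteMeasure ψ] : IsGLB (Set.range (M.stageF t (M.starF (t + 1)) ψ)) (M.starF t ψ) := by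
  obtain ⟨C, hC, hV⟩ := exists_abs_optValue_le hc₂ (M.T₁ - (t + 1)) (t + 1)
  rw [starF_of_lt ht]
  exact isGLB_ciInf_of_abs_le fun g => abs_stageF_le hc₂ hC hV t ψ g

theorem isGLB_stageG (hc₂ : 0 ≤ M.c₂) (t : ℕ) (φ : InfoState) [IsFiniteMeasure φ] :
    IsGLB (Set.range (M.stageG t (M.starF (t + 1)) φ)) (M.starG t φ) := by
  obtain ⟨C, hC, hV⟩ := exists_abs_optValue_le hc₂ (M.T₁ - (t + 1)) (t + 1)
  exact isGLB_ciInf_of_abs_le fun g => abs_stageG_le hV t φ g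

theorem isGLB_finalCost (hc₂ : 0 ≤ M.c₂) (ψ : InfoState) [IsFiniteMeasure ψ] :
    IsGLB (Set.range fun a => M.finalCost M.T₁ ψ (lastRule a)) (M.starF M.T₁ ψ) := by
  rw [starF_last]
  exact isGLB_ciInf_of_abs_le fun a => abs_finalCost_le hc₂ _ ψ _

theorem starG_zero (hc₂ : 0 ≤ M.c₂) (t : ℕ) : M.starG t 0 = 0 := by
  obtain ⟨C, hC, hV⟩ := exists_abs_optValue_le hc₂ (M.T₁ - (t + 1)) (t + 1)
  have := abs_ciInf_le (f := M.stageG t (M.starF (t + 1)) 0) fun g => abs_stageG_le hV t 0 g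
  simpa [starG] using this

/-! ### Evolution of the information states under a design -/

theorem msgRule_of_lt (d : Design) {t : ℕ} (ht : t < M.T₁) : M.msgRule d t = rule1 (d.o1 t) :=
  funext fun _ => if_pos ht

theorem msgRule_last (d : Design) : M.msgRule d M.T₁ = lastRule d.o1Last :=
  funext fun _ => if_neg (lt_irrefl _)

instance (d : Design) (t : ℕ) : IsFiniteMeasure (M.psi d t) := by
  unfold psi
  infer_instance

instance (d : Design) (t : ℕ) (z : Symb) : IsFiniteMeasure (M.phi d t z) := by
  unfold phi
  infer_instance

theorem phi_of_lt (hT₁ : 1 ≤ M.T₁) (hT : M.T₁ ≤ M.T₂) (d : Design) {t : ℕ} (ht : 1 ≤ t)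
    (htT : t < M.T₁) (z : Symb) :
    M.phi d t z = M.msgUpdate t (M.psi d t) (rule1 (d.o1 t)) z := by
  rw [phi_eq_msgUpdate hT₁ (hT₁.trans hT) d ht, msgRule_of_lt d htT]

theorem phi_last (hT₁ : 1 ≤ M.T₁) (hT : M.T₁ ≤ M.T₂) (d : Design) (z : Symb) :
    M.phi d M.T₁ z = M.msgUpdate M.T₁ (M.psi d M.T₁) (lastRule d.o1Last) z := by
  rw [phi_eq_msgUpdate hT₁ (hT₁.trans hT) d hT₁, msgRule_last]

/-- Thresholds act on the state only through the updates before `t`; those after a final message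
never do. -/
theorem psi_congr (hT₁ : 1 ≤ M.T₁) (hT : M.T₁ ≤ M.T₂) {d d' : Design} {t : ℕ} (ht : 1 ≤ t)
    (htT : t ≤ M.T₁) (h : AgreeBefore d d' t) : M.psi d' t = M.psi d t := by
  induction t, ht using Nat.le_induction with
  | base => exact psi_one (hT₁.trans hT) _ _
  | succ t ht ih =>
    have hlt : t < M.T₁ := by omega
    rw [psi_succ_eq_obsUpdate hT₁ hT d' ht hlt, psi_succ_eq_obsUpdate hT₁ hT d ht hlt,
      phi_of_lt hT₁ hT d' ht hlt, phi_of_lt hT₁ hT d ht hlt, (h t ht (by omega)).1,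
      (h t ht (by omega)).2, ih hlt.le fun s hs hst => h s hs (by omega)]

theorem phi_congr (hT₁ : 1 ≤ M.T₁) (hT : M.T₁ ≤ M.T₂) {d d' : Design} {t : ℕ} (ht : 1 ≤ t)
    (htT : t < M.T₁) (h : AgreeBefore d d' t) (h₁ : d'.o1 t = d.o1 t) (z : Symb) :
    M.phi d' t z = M.phi d t z := by
  rw [phi_of_lt hT₁ hT d' ht htT, phi_of_lt hT₁ hT d ht htT, h₁, psi_congr hT₁ hT ht htT.le h]

/-! ### Verification of the dynamic program -/

theorem finalCost_psi (hT₁ : 1 ≤ M.T₁) (hT : M.T₁ ≤ M.T₂) (d : Design) {t : ℕ} (ht : 1 ≤ t) :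
    M.finalCost t (M.psi d t) (M.msgRule d t) =
      ∑ z : Fin 2, (M.psi d t).real (msgSet (M.msgRule d t) (some z)) *
        M.waldTerm t (M.phi d t (some z)) := by
  simp only [finalCost, phi_eq_msgUpdate hT₁ (hT₁.trans hT) d ht]

theorem finalCost_psi_le (hT₁ : 1 ≤ M.T₁) (hT : M.T₁ ≤ M.T₂) (hc₂ : 0 ≤ M.c₂) (d : Design)
    {t : ℕ} (ht : 1 ≤ t) (htT : t ≤ M.T₁) :
    M.finalCost t (M.psi d t) (M.msgRule d t) ≤
      ∑ z : Fin 2, (M.psi d t).real (msgSet (M.msgRule d t) (some z)) * M.postCost d t z := by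
  rw [finalCost_psi hT₁ hT d ht]
  exact Finset.sum_le_sum fun z _ => mul_le_mul_of_nonneg_left
    (waldTerm_le_postCost hT₁ hT hc₂ d ht htT z) measureReal_nonneg

theorem finalCost_psi_eq (hT₁ : 1 ≤ M.T₁) (hT : M.T₁ ≤ M.T₂) (hc₂ : 0 ≤ M.c₂) {d : Design}
    (hw : M.UsesWald d) {t : ℕ} (ht : 1 ≤ t) (htT : t ≤ M.T₁) :
    M.finalCost t (M.psi d t) (M.msgRule d t) =
      ∑ z : Fin 2, (M.psi d t).real (msgSet (M.msgRule d t) (some z)) * M.postCost d t z := by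
  rw [finalCost_psi hT₁ hT d ht]
  exact Finset.sum_congr rfl fun z _ => by rw [waldTerm_eq_postCost hT₁ hT hc₂ hw ht htT z]

theorem stageF_psi (hT₁ : 1 ≤ M.T₁) (hT : M.T₁ ≤ M.T₂) (d : Design) {t : ℕ} (ht : 1 ≤ t)
    (htT : t < M.T₁) : M.stageF t (M.starF (t + 1)) (M.psi d t) (d.o1 t) =
      M.finalCost t (M.psi d t) (M.msgRule d t) +
        (M.psi d t).real (msgSet (M.msgRule d t) none) *
          (M.c₁ + M.starG t (M.phi d t none)) := by
  rw [stageF, msgRule_of_lt d htT, phi_of_lt hT₁ hT d ht htT]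
  rfl

theorem toGo₂_eq_stageG (hT₁ : 1 ≤ M.T₁) (hT : M.T₁ ≤ M.T₂) (d : Design) {t : ℕ} (ht : 1 ≤ t)
    (htT : t < M.T₁) : M.toGo₂ d t = M.stageG t (M.starF (t + 1)) (M.phi d t none) (d.o2 t) +
      (M.toGo₁ d (t + 1) - M.starF (t + 1) (M.psi d (t + 1))) := by
  rw [toGo₂_eq hT₁ hT d ht htT, stageG, ← psi_succ_eq_obsUpdate hT₁ hT d ht htT]
  ring

/-- The only loss comes from O2's thresholds after a final message; with Wald thresholds there is
equality, `toGo₁_eq_stageF`. -/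
theorem stageF_le_toGo₁ (hT₁ : 1 ≤ M.T₁) (hT : M.T₁ ≤ M.T₂) (hc₂ : 0 ≤ M.c₂) (d : Design) {t : ℕ}
    (ht : 1 ≤ t) (htT : t < M.T₁) : M.stageF t (M.starF (t + 1)) (M.psi d t) (d.o1 t) +
      (M.psi d t).real (msgSet (M.msgRule d t) none) *
        (M.toGo₂ d t - M.starG t (M.phi d t none)) ≤ M.toGo₁ d t := by
  rw [stageF_psi hT₁ hT d ht htT, toGo₁_eq hT₁ (hT₁.trans hT) d ht]
  have := finalCost_psi_le hT₁ hT hc₂ d ht htT.le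
  linarith

theorem toGo₁_eq_stageF (hT₁ : 1 ≤ M.T₁) (hT : M.T₁ ≤ M.T₂) (hc₂ : 0 ≤ M.c₂) {d : Design}
    (hw : M.UsesWald d) {t : ℕ} (ht : 1 ≤ t) (htT : t < M.T₁) :
    M.toGo₁ d t = M.stageF t (M.starF (t + 1)) (M.psi d t) (d.o1 t) +
      (M.psi d t).real (msgSet (M.msgRule d t) none) *
        (M.toGo₂ d t - M.starG t (M.phi d t none)) := by
  rw [stageF_psi hT₁ hT d ht htT, toGo₁_eq hT₁ (hT₁.trans hT) d ht,
    finalCost_psi_eq hT₁ hT hc₂ hw ht htT.le]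
  ring

theorem finalCost_le_toGo₁ (hT₁ : 1 ≤ M.T₁) (hT : M.T₁ ≤ M.T₂) (hc₂ : 0 ≤ M.c₂) (d : Design) :
    M.finalCost M.T₁ (M.psi d M.T₁) (lastRule d.o1Last) ≤ M.toGo₁ d M.T₁ := by
  rw [toGo₁_last hT₁ (hT₁.trans hT), ← msgRule_last (M := M) d]
  exact finalCost_psi_le hT₁ hT hc₂ d hT₁ le_rfl

theorem toGo₁_last_eq (hT₁ : 1 ≤ M.T₁) (hT : M.T₁ ≤ M.T₂) (hc₂ : 0 ≤ M.c₂) {d : Design}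
    (hw : M.UsesWald d) :
    M.toGo₁ d M.T₁ = M.finalCost M.T₁ (M.psi d M.T₁) (lastRule d.o1Last) := by
  rw [toGo₁_last hT₁ (hT₁.trans hT), ← msgRule_last (M := M) d,
    finalCost_psi_eq hT₁ hT hc₂ hw hT₁ le_rfl]

theorem starG_le_of_starF_le (hT₁ : 1 ≤ M.T₁) (hT : M.T₁ ≤ M.T₂) (hc₂ : 0 ≤ M.c₂) (d : Design)
    {t : ℕ} (ht : 1 ≤ t) (htT : t < M.T₁)
    (h : M.starF (t + 1) (M.psi d (t + 1)) ≤ M.toGo₁ d (t + 1)) :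
    M.starG t (M.phi d t none) ≤ M.toGo₂ d t := by
  have h1 := (isGLB_stageG hc₂ t (M.phi d t none)).1 ⟨d.o2 t, rfl⟩
  rw [toGo₂_eq_stageG hT₁ hT d ht htT]
  linarith

theorem starF_le_toGo₁ (hT₁ : 1 ≤ M.T₁) (hT : M.T₁ ≤ M.T₂) (hc₂ : 0 ≤ M.c₂) (d : Design) {t : ℕ}
    (ht : 1 ≤ t) (htT : t ≤ M.T₁) : M.starF t (M.psi d t) ≤ M.toGo₁ d t := by
  induction htT using Nat.decreasingInduction with
  | self =>
    exact ((isGLB_finalCost hc₂ (M.psi d M.T₁)).1 ⟨d.o1Last, rfl⟩).trans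
      (finalCost_le_toGo₁ hT₁ hT hc₂ d)
  | of_succ t htT ih =>
    have h1 := (isGLB_stageF hc₂ htT (M.psi d t)).1 ⟨d.o1 t, rfl⟩
    have h2 := starG_le_of_starF_le hT₁ hT hc₂ d ht htT (ih (by omega))
    have h3 := stageF_le_toGo₁ hT₁ hT hc₂ d ht htT
    have h4 : 0 ≤ (M.psi d t).real (msgSet (M.msgRule d t) none) *
        (M.toGo₂ d t - M.starG t (M.phi d t none)) :=
      mul_nonneg measureReal_nonneg (sub_nonneg.2 h2)
    linarith

theorem starG_le_toGo₂ (hT₁ : 1 ≤ M.T₁) (hT : M.T₁ ≤ M.T₂) (hc₂ : 0 ≤ M.c₂) (d : Design) {t : ℕ}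
    (ht : 1 ≤ t) (htT : t < M.T₁) : M.starG t (M.phi d t none) ≤ M.toGo₂ d t :=
  starG_le_of_starF_le hT₁ hT hc₂ d ht htT (starF_le_toGo₁ hT₁ hT hc₂ d (by omega) htT)

theorem agreeBefore_trans {d₁ d₂ d₃ : Design} {s t : ℕ} (h : AgreeBefore d₁ d₂ s)
    (h' : AgreeBefore d₂ d₃ t) (hst : s ≤ t) : AgreeBefore d₁ d₃ s := fun r hr hrs =>
  ⟨(h' r hr (by omega)).1.trans (h r hr hrs).1, (h' r hr (by omega)).2.trans (h r hr hrs).2⟩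

/-- O2's half of a stage in the construction of near-optimal designs. The claim for `t + 1` is the
hypothesis `h`, so that the lemma serves both inside the induction of `exists_toGo₁_le` and after
it. Half of `ε` is spent on the threshold at `t`, half on the later ones. -/
theorem exists_toGo₂_le_of (hT₁ : 1 ≤ M.T₁) (hT : M.T₁ ≤ M.T₂) (hc₂ : 0 ≤ M.c₂) {t : ℕ}
    (ht : 1 ≤ t) (htT : t < M.T₁)
    (h : ∀ d, M.UsesWald d → ∀ ε > 0, ∃ d', AgreeBefore d d' (t + 1) ∧ M.UsesWald d' ∧
      M.toGo₁ d' (t + 1) ≤ M.starF (t + 1) (M.psi d (t + 1)) + ε)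
    {d : Design} (hw : M.UsesWald d) {ε : ℝ} (hε : 0 < ε) :
    ∃ d', AgreeBefore d d' t ∧ d'.o1 t = d.o1 t ∧ M.UsesWald d' ∧
      M.toGo₂ d' t ≤ M.starG t (M.phi d t none) + ε := by
  obtain ⟨g, hg⟩ := exists_lt_ciInf_add (isGLB_stageG hc₂ t (M.phi d t none)) (half_pos hε)
  set d₁ : Design := { d with o2 := Function.update d.o2 t g } with hd₁
  have hw₁ : M.UsesWald d₁ := hw
  have ha₁ : AgreeBefore d d₁ t := fun s _ hst =>
    ⟨rfl, Function.update_of_ne (by omega) _ _⟩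
  obtain ⟨d₂, ha₂, hw₂, hd₂⟩ := h d₁ hw₁ (ε / 2) (half_pos hε)
  have ha : AgreeBefore d d₂ t := agreeBefore_trans ha₁ ha₂ (by omega)
  have ho1 : d₂.o1 t = d.o1 t := (ha₂ t ht (by omega)).1
  have ho2 : d₂.o2 t = g := by
    rw [(ha₂ t ht (by omega)).2, hd₁]
    exact Function.update_self _ _ _
  refine ⟨d₂, ha, ho1, hw₂, ?_⟩
  rw [← psi_congr hT₁ hT (by omega) htT ha₂] at hd₂
  rw [toGo₂_eq_stageG hT₁ hT d₂ ht htT, ho2, phi_congr hT₁ hT ht htT ha ho1]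
  linarith

theorem exists_toGo₁_le (hT₁ : 1 ≤ M.T₁) (hT : M.T₁ ≤ M.T₂) (hc₂ : 0 ≤ M.c₂) {t : ℕ}
    (ht : 1 ≤ t) (htT : t ≤ M.T₁) : ∀ d, M.UsesWald d → ∀ ε > 0, ∃ d', AgreeBefore d d' t ∧
      M.UsesWald d' ∧ M.toGo₁ d' t ≤ M.starF t (M.psi d t) + ε := by
  induction htT using Nat.decreasingInduction with
  | self =>
    intro d hw ε hε
    obtain ⟨a, ha⟩ := exists_lt_ciInf_add (isGLB_finalCost hc₂ (M.psi d M.T₁)) hε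
    have hagree : AgreeBefore d { d with o1Last := a } M.T₁ := fun s _ _ => ⟨rfl, rfl⟩
    have hw' : M.UsesWald { d with o1Last := a } := hw
    refine ⟨_, hagree, hw', ?_⟩
    rw [toGo₁_last_eq hT₁ hT hc₂ hw', psi_congr hT₁ hT hT₁ le_rfl hagree]
    exact ha
  | of_succ t htT ih =>
    intro d hw ε hε
    obtain ⟨g, hg⟩ := exists_lt_ciInf_add (isGLB_stageF hc₂ htT (M.psi d t)) (half_pos hε)
    set d₁ : Design := { d with o1 := Function.update d.o1 t g } with hd₁
    have hw₁ : M.UsesWald d₁ := hw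
    have ha₁ : AgreeBefore d d₁ t := fun s _ hst =>
      ⟨Function.update_of_ne (by omega) _ _, rfl⟩
    obtain ⟨d₂, ha₂, ho1, hw₂, hd₂⟩ := exists_toGo₂_le_of hT₁ hT hc₂ ht htT (ih (by omega)) hw₁
      (half_pos hε)
    have ha : AgreeBefore d d₂ t := agreeBefore_trans ha₁ ha₂ le_rfl
    have ho1' : d₂.o1 t = g := by
      rw [ho1, hd₁]
      exact Function.update_self _ _ _
    refine ⟨d₂, ha, hw₂, ?_⟩
    rw [← phi_congr hT₁ hT ht htT ha₂ ho1] at hd₂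
    rw [toGo₁_eq_stageF hT₁ hT hc₂ hw₂ ht htT, ho1', psi_congr hT₁ hT ht htT.le ha]
    have h1 : (M.psi d t).real (msgSet (M.msgRule d₂ t) none) ≤ 1 := by
      have : IsZeroOrProbabilityMeasure (M.psi d t) := by
        unfold psi
        infer_instance
      exact measureReal_le_one
    -- The later error is weighted by the probability of a blank, which is at most `1`, so it does
    -- not grow backwards in time.
    have h2 : (M.psi d t).real (msgSet (M.msgRule d₂ t) none) *
        (M.toGo₂ d₂ t - M.starG t (M.phi d₂ t none)) ≤ 1 * (ε / 2) :=
      mul_le_mul h1 (by linarith)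
        (sub_nonneg.2 (starG_le_toGo₂ hT₁ hT hc₂ d₂ ht htT)) zero_le_one
    linarith

/-- The remaining horizon depends only on the current time, so one choice of thresholds serves for
every time and value of the final message. -/
theorem exists_usesWald (hc₂ : 0 ≤ M.c₂) (hJ₀ : M.J 0 0 ≤ M.J 1 0) (hJ₁ : M.J 1 1 ≤ M.J 0 1)
    (d : Design) : ∃ d' : Design, d'.o1 = d.o1 ∧ d'.o1Last = d.o1Last ∧ d'.o2 = d.o2 ∧
      M.UsesWald d' := by
  choose w hw using fun t => M.exists_isWaldThr hc₂ hJ₀ hJ₁ (M.T₂ - t) t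
  exact ⟨{ d with post := fun _ _ t => w t }, rfl, rfl, rfl, fun _ _ t _ _ _ _ => hw t⟩

theorem isGLB_toGo₁ (hT₁ : 1 ≤ M.T₁) (hT : M.T₁ ≤ M.T₂) (hc₂ : 0 ≤ M.c₂)
    (hJ₀ : M.J 0 0 ≤ M.J 1 0) (hJ₁ : M.J 1 1 ≤ M.J 0 1) (d : Design) {t : ℕ} (ht : 1 ≤ t)
    (htT : t ≤ M.T₁) :
    IsGLB {x | ∃ d', AgreeBefore d d' t ∧ x = M.toGo₁ d' t} (M.starF t (M.psi d t)) := by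
  constructor
  · rintro _ ⟨d', ha, rfl⟩
    rw [← psi_congr hT₁ hT ht htT ha]
    exact starF_le_toGo₁ hT₁ hT hc₂ d' ht htT
  · intro b hb
    -- Near-optimal designs are sought among those with Wald thresholds; passing to one changes
    -- neither the earlier thresholds nor the state.
    obtain ⟨d₁, h1, -, h2, hw⟩ := exists_usesWald hc₂ hJ₀ hJ₁ d
    have ha₁ : AgreeBefore d d₁ t := fun s _ _ => ⟨by rw [h1], by rw [h2]⟩
    refine le_of_forall_pos_le_add fun ε hε => ?_
    obtain ⟨d₂, ha₂, -, hd₂⟩ := exists_toGo₁_le hT₁ hT hc₂ ht htT d₁ hw ε hε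
    rw [psi_congr hT₁ hT ht htT ha₁] at hd₂
    exact (hb ⟨d₂, agreeBefore_trans ha₁ ha₂ le_rfl, rfl⟩).trans hd₂

theorem isGLB_toGo₂ (hT₁ : 1 ≤ M.T₁) (hT : M.T₁ ≤ M.T₂) (hc₂ : 0 ≤ M.c₂)
    (hJ₀ : M.J 0 0 ≤ M.J 1 0) (hJ₁ : M.J 1 1 ≤ M.J 0 1) (d : Design) {t : ℕ} (ht : 1 ≤ t)
    (htT : t < M.T₁) :
    IsGLB {x | ∃ d', AgreeBefore d d' t ∧ d'.o1 t = d.o1 t ∧ x = M.toGo₂ d' t}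
      (M.starG t (M.phi d t none)) := by
  constructor
  · rintro _ ⟨d', ha, ho, rfl⟩
    rw [← phi_congr hT₁ hT ht htT ha ho]
    exact starG_le_toGo₂ hT₁ hT hc₂ d' ht htT
  · intro b hb
    obtain ⟨d₁, h1, -, h2, hw⟩ := exists_usesWald hc₂ hJ₀ hJ₁ d
    have ha₁ : AgreeBefore d d₁ t := fun s _ _ => ⟨by rw [h1], by rw [h2]⟩
    refine le_of_forall_pos_le_add fun ε hε => ?_
    obtain ⟨d₂, ha₂, ho, -, hd₂⟩ := exists_toGo₂_le_of hT₁ hT hc₂ ht htT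
      (exists_toGo₁_le hT₁ hT hc₂ (by omega) htT) hw hε
    rw [phi_congr hT₁ hT ht htT ha₁ (by rw [h1])] at hd₂
    exact (hb ⟨d₂, agreeBefore_trans ha₁ ha₂ le_rfl, by rw [ho, h1], rfl⟩).trans hd₂

theorem isGLB_cost (hT₁ : 1 ≤ M.T₁) (hT : M.T₁ ≤ M.T₂) (hc₂ : 0 ≤ M.c₂)
    (hJ₀ : M.J 0 0 ≤ M.J 1 0) (hJ₁ : M.J 1 1 ≤ M.J 0 1) (d : Design) :
    IsGLB (Set.range M.cost) (M.c₁ + M.c₂ + M.starF 1 (M.psi d 1)) := by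
  have h := isGLB_toGo₁ hT₁ hT hc₂ hJ₀ hJ₁ d le_rfl hT₁
  have ha : ∀ d', AgreeBefore d d' 1 := fun d' s hs hst => by omega
  constructor
  · rintro _ ⟨d', rfl⟩
    rw [cost_eq_toGo₁ hT₁ (hT₁.trans hT)]
    exact add_le_add le_rfl (h.1 ⟨d', ha d', rfl⟩)
  · intro b hb
    have : b - (M.c₁ + M.c₂) ≤ M.starF 1 (M.psi d 1) := by
      refine h.2 ?_
      rintro _ ⟨d', -, rfl⟩
      have := hb ⟨d', rfl⟩
      rw [cost_eq_toGo₁ hT₁ (hT₁.trans hT)] at this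
      linarith
    linarith

/-- Wald thresholds after a final message do not increase the costs-to-go. -/
theorem toGo₁_le_of_usesWald (hT₁ : 1 ≤ M.T₁) (hT : M.T₁ ≤ M.T₂) (hc₂ : 0 ≤ M.c₂)
    {d d' : Design} (h₁ : d'.o1 = d.o1) (hl : d'.o1Last = d.o1Last) (h₂ : d'.o2 = d.o2)
    (hw : M.UsesWald d') {t : ℕ} (ht : 1 ≤ t) (htT : t ≤ M.T₁) :
    M.toGo₁ d' t ≤ M.toGo₁ d t := by
  have ha : ∀ t, AgreeBefore d d' t := fun t s _ _ => ⟨by rw [h₁], by rw [h₂]⟩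
  induction htT using Nat.decreasingInduction with
  | self =>
    rw [toGo₁_last_eq hT₁ hT hc₂ hw, psi_congr hT₁ hT hT₁ le_rfl (ha _), hl]
    exact finalCost_le_toGo₁ hT₁ hT hc₂ d
  | of_succ t htT ih =>
    have hψ := psi_congr hT₁ hT ht htT.le (ha t)
    have hφ := phi_congr hT₁ hT ht htT (ha t) (by rw [h₁]) none
    have hρ : M.msgRule d' t = M.msgRule d t := by
      rw [msgRule_of_lt d' htT, msgRule_of_lt d htT, h₁]
    have h2 : M.toGo₂ d' t ≤ M.toGo₂ d t := by
      rw [toGo₂_eq hT₁ hT d' ht htT, toGo₂_eq hT₁ hT d ht htT, hφ, h₂]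
      exact add_le_add le_rfl (ih (by omega))
    -- Both designs have the same state and rule at `t`, so the values `stageF` and `starG` cancel
    -- and only `toGo₂` is compared.
    refine le_trans ?_ (stageF_le_toGo₁ hT₁ hT hc₂ d ht htT)
    rw [toGo₁_eq_stageF hT₁ hT hc₂ hw ht htT, hψ, hφ, hρ, h₁]
    exact add_le_add le_rfl (mul_le_mul_of_nonneg_left (by linarith) measureReal_nonneg)

/-- With a null blank event the conditional measure and the state are zero, and so are both values.
Optimality can therefore be propagated past times that are almost surely not reached. -/
theorem toGo₂_eq_starG_of_null (hT₁ : 1 ≤ M.T₁) (hT : M.T₁ ≤ M.T₂) (hc₂ : 0 ≤ M.c₂) (d : Design)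
    {t : ℕ} (ht : 1 ≤ t) (h : (M.psi d t).real (msgSet (M.msgRule d t) none) = 0) :
    M.toGo₂ d t = M.starG t (M.phi d t none) := by
  have hB := measurableSet_blankBefore' hT₁ d t
  have h0 : M.μ (M.blankBefore d (t + 1)) = 0 := by
    rw [psi_real_msgSet hT₁ (hT₁.trans hT) d ht, cond_real_apply hB, ← blankBefore_succ d ht,
      mul_eq_zero, inv_eq_zero, measureReal_eq_zero_iff, measureReal_eq_zero_iff] at h
    rcases h with h | h
    · exact measure_mono_null (blankBefore_anti d (by omega)) h
    · exact h
  have hc : (M.μ[|M.blankBefore d (t + 1)]) = 0 := cond_eq_zero_of_meas_eq_zero h0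
  have hφ : M.phi d t none = 0 := by
    rw [phi, ← blankBefore_succ d ht, hc, Measure.map_zero]
  rw [hφ, starG_zero hc₂, toGo₂, hc, integral_zero_measure]

theorem optimal_iff (hT₁ : 1 ≤ M.T₁) (hT : M.T₁ ≤ M.T₂) (hc₂ : 0 ≤ M.c₂)
    (hJ₀ : M.J 0 0 ≤ M.J 1 0) (hJ₁ : M.J 1 1 ≤ M.J 0 1) {d : Design} (hw : M.UsesWald d) :
    (∀ d', M.cost d ≤ M.cost d') ↔
      (∀ t, 1 ≤ t → t < M.T₁ →
        M.stageF t (M.starF (t + 1)) (M.psi d t) (d.o1 t) = M.starF t (M.psi d t) ∧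
        M.stageG t (M.starF (t + 1)) (M.phi d t none) (d.o2 t) = M.starG t (M.phi d t none)) ∧
      M.finalCost M.T₁ (M.psi d M.T₁) (lastRule d.o1Last) = M.starF M.T₁ (M.psi d M.T₁) := by
  have hT₂ := hT₁.trans hT
  have hglb := isGLB_cost hT₁ hT hc₂ hJ₀ hJ₁ d
  have hiff : (∀ d', M.cost d ≤ M.cost d') ↔ M.toGo₁ d 1 = M.starF 1 (M.psi d 1) := by
    constructor
    · intro h
      refine le_antisymm ?_ (starF_le_toGo₁ hT₁ hT hc₂ d le_rfl hT₁)
      have := hglb.2 (show M.cost d ∈ lowerBounds (Set.range M.cost) by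
        rintro _ ⟨d', rfl⟩; exact h d')
      rw [cost_eq_toGo₁ hT₁ hT₂] at this
      linarith
    · intro h d'
      rw [cost_eq_toGo₁ hT₁ hT₂ d, h]
      exact hglb.1 ⟨d', rfl⟩
  rw [hiff]
  constructor
  · intro h
    -- The excess at `t` is a sum of nonnegative terms. If it vanishes, each term does, and this
    -- includes the excess at `t + 1`; a zero blank probability is covered by
    -- `toGo₂_eq_starG_of_null`.
    have step : ∀ t, 1 ≤ t → t < M.T₁ → M.toGo₁ d t = M.starF t (M.psi d t) →
        (M.stageF t (M.starF (t + 1)) (M.psi d t) (d.o1 t) = M.starF t (M.psi d t) ∧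
        M.stageG t (M.starF (t + 1)) (M.phi d t none) (d.o2 t) = M.starG t (M.phi d t none)) ∧
        M.toGo₁ d (t + 1) = M.starF (t + 1) (M.psi d (t + 1)) := by
      intro t ht htT h
      have h1 := (isGLB_stageF hc₂ htT (M.psi d t)).1 ⟨d.o1 t, rfl⟩
      have h2 := starG_le_toGo₂ hT₁ hT hc₂ d ht htT
      have h3 := toGo₁_eq_stageF hT₁ hT hc₂ hw ht htT
      have h4 : 0 ≤ (M.psi d t).real (msgSet (M.msgRule d t) none) *
          (M.toGo₂ d t - M.starG t (M.phi d t none)) :=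
        mul_nonneg measureReal_nonneg (sub_nonneg.2 h2)
      have h5 : M.toGo₂ d t = M.starG t (M.phi d t none) := by
        by_cases h0 : (M.psi d t).real (msgSet (M.msgRule d t) none) = 0
        · exact toGo₂_eq_starG_of_null hT₁ hT hc₂ d ht h0
        · have : (M.psi d t).real (msgSet (M.msgRule d t) none) *
              (M.toGo₂ d t - M.starG t (M.phi d t none)) = 0 := by linarith
          rcases mul_eq_zero.1 this with h' | h'
          · exact absurd h' h0
          · linarith
      have h6 := (isGLB_stageG hc₂ t (M.phi d t none)).1 ⟨d.o2 t, rfl⟩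
      have h7 := starF_le_toGo₁ hT₁ hT hc₂ d (t := t + 1) (by omega) htT
      have h8 := toGo₂_eq_stageG hT₁ hT d ht htT
      exact ⟨⟨by linarith, by linarith⟩, by linarith⟩
    have all : ∀ t, 1 ≤ t → t ≤ M.T₁ → M.toGo₁ d t = M.starF t (M.psi d t) := by
      intro t ht
      induction t, ht using Nat.le_induction with
      | base => exact fun _ => h
      | succ t ht ih => exact fun htT => (step t ht htT (ih (by omega))).2
    exact ⟨fun t ht htT => (step t ht htT (all t ht htT.le)).1,
      (toGo₁_last_eq hT₁ hT hc₂ hw).symm.trans (all _ hT₁ le_rfl)⟩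
  · rintro ⟨h, hl⟩
    have all : ∀ t, t ≤ M.T₁ → 1 ≤ t → M.toGo₁ d t = M.starF t (M.psi d t) := by
      intro t htT
      induction htT using Nat.decreasingInduction with
      | self => exact fun _ => (toGo₁_last_eq hT₁ hT hc₂ hw).trans hl
      | of_succ t htT ih =>
        intro ht
        have h2 : M.toGo₂ d t = M.starG t (M.phi d t none) := by
          rw [toGo₂_eq_stageG hT₁ hT d ht htT, ih (by omega), (h t ht htT).2]
          ring
        rw [toGo₁_eq_stageF hT₁ hT hc₂ hw ht htT, h2, (h t ht htT).1]
        ring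
    exact all 1 hT₁ le_rfl

end Model

end SeqDet

end

/-! ### The theorem -/

theorem theorem6 {Ω 𝒴₁ 𝒴₂ : Type*} [MeasurableSpace Ω] [MeasurableSpace 𝒴₁] [MeasurableSpace 𝒴₂]
    (M : SeqDet.Model Ω 𝒴₁ 𝒴₂)
    (hT₁ : 1 ≤ M.T₁) (hT : M.T₁ ≤ M.T₂) (hc₂ : 0 ≤ M.c₂)
    (hJ₀ : M.J 0 0 ≤ M.J 1 0) (hJ₁ : M.J 1 1 ≤ M.J 0 1) :
    ∃ (Q₁ : ℕ → SeqDet.InfoState → SeqDet.FourThr → SeqDet.Symb → SeqDet.InfoState)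
      (Q₁Last : SeqDet.InfoState → SeqDet.Belief → SeqDet.Symb → SeqDet.InfoState)
      (Q₂ : ℕ → SeqDet.InfoState → SeqDet.TwoThr → SeqDet.InfoState)
      (F : ℕ → SeqDet.InfoState → SeqDet.FourThr → ℝ)
      (FLast : SeqDet.InfoState → SeqDet.Belief → ℝ)
      (Fstar : ℕ → SeqDet.InfoState → ℝ)
      (G : ℕ → SeqDet.InfoState → SeqDet.TwoThr → ℝ)
      (Gstar : ℕ → SeqDet.InfoState → ℝ),
      -- the value functions are the infima
      (∀ t, 1 ≤ t → t < M.T₁ → ∀ ψ : SeqDet.InfoState, IsFiniteMeasure ψ →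
        IsGLB (Set.range (F t ψ)) (Fstar t ψ)) ∧
      (∀ t, 1 ≤ t → t < M.T₁ → ∀ φ : SeqDet.InfoState, IsFiniteMeasure φ →
        IsGLB (Set.range (G t φ)) (Gstar t φ)) ∧
      (∀ ψ : SeqDet.InfoState, IsFiniteMeasure ψ →
        IsGLB (Set.range (FLast ψ)) (Fstar M.T₁ ψ)) ∧
      -- backward recursion
      (∀ ψ a, FLast ψ a =
        ∑ z : Fin 2, ψ.real {x | SeqDet.rule1Last a x.2.1 = z} *
          M.waldTerm M.T₁ (Q₁Last ψ a (some z))) ∧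
      (∀ t, 1 ≤ t → t < M.T₁ → ∀ φ g,
        G t φ g = M.stageCost₂ φ g + Fstar (t + 1) (Q₂ t φ g)) ∧
      (∀ t, 1 ≤ t → t < M.T₁ → ∀ ψ g, F t ψ g =
        (∑ z : Fin 2, ψ.real {x | SeqDet.rule1 g x.2.1 = some z} *
          M.waldTerm t (Q₁ t ψ g (some z))) +
        ψ.real {x | SeqDet.rule1 g x.2.1 = none} * (M.c₁ + Gstar t (Q₁ t ψ g none))) ∧
      -- forward evolution of the information states
      (∀ d d', M.psi d 1 = M.psi d' 1) ∧
      (∀ d t z, 1 ≤ t → t < M.T₁ → M.phi d t z = Q₁ t (M.psi d t) (d.o1 t) z) ∧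
      (∀ d z, M.phi d M.T₁ z = Q₁Last (M.psi d M.T₁) d.o1Last z) ∧
      (∀ d t, 1 ≤ t → t < M.T₁ → M.psi d (t + 1) = Q₂ t (M.phi d t none) (d.o2 t)) ∧
      -- the value functions are the optimal costs-to-go
      (∀ d t, 1 ≤ t → t ≤ M.T₁ →
        IsGLB {x | ∃ d', SeqDet.AgreeBefore d d' t ∧ x = M.toGo₁ d' t}
          (Fstar t (M.psi d t))) ∧
      (∀ d t, 1 ≤ t → t < M.T₁ →
        IsGLB {x | ∃ d', SeqDet.AgreeBefore d d' t ∧ d'.o1 t = d.o1 t ∧ x = M.toGo₂ d' t}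
          (Gstar t (M.phi d t none))) ∧
      (∀ d, MeasureTheory.Integrable (M.totalCost d) M.μ) ∧
      (∀ d, IsGLB (Set.range M.cost) (M.c₁ + M.c₂ + Fstar 1 (M.psi d 1))) ∧
      -- after a final message the Wald thresholds are optimal
      (∀ n t, ∃ g, M.IsWaldThr n t g) ∧
      (∀ d d', d'.o1 = d.o1 → d'.o1Last = d.o1Last → d'.o2 = d.o2 → M.UsesWald d' →
        M.cost d' ≤ M.cost d) ∧
      -- the forward evaluation gives exactly the optimal thresholds
      (∀ d, M.UsesWald d →
        ((∀ d', M.cost d ≤ M.cost d') ↔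
          (∀ t, 1 ≤ t → t < M.T₁ →
            F t (M.psi d t) (d.o1 t) = Fstar t (M.psi d t) ∧
            G t (M.phi d t none) (d.o2 t) = Gstar t (M.phi d t none)) ∧
          FLast (M.psi d M.T₁) d.o1Last = Fstar M.T₁ (M.psi d M.T₁))) := by
  open SeqDet SeqDet.Model in
  -- At its horizon O1 has no blank, so its rule there takes values in `Fin 2`, whereas `finalCost`
  -- works with `Symb`.
  have hset (a : Belief) (z : Fin 2) :
      msgSet (lastRule a) (some z) = {x | rule1Last a x.2.1 = z} := by
    ext x
    exact Option.some_inj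
  open SeqDet SeqDet.Model in
  exact ⟨fun t ψ g z => M.msgUpdate t ψ (rule1 g) z,
    fun ψ a z => M.msgUpdate M.T₁ ψ (lastRule a) z, fun t φ g => M.obsUpdate t φ g,
    fun t => M.stageF t (M.starF (t + 1)), fun ψ a => M.finalCost M.T₁ ψ (lastRule a),
    M.starF, fun t => M.stageG t (M.starF (t + 1)), M.starG,
    fun t _ htT ψ _ => isGLB_stageF hc₂ htT ψ,
    fun t _ _ φ _ => isGLB_stageG hc₂ t φ,
    fun ψ _ => isGLB_finalCost hc₂ ψ,
    fun ψ a => by simp only [finalCost, hset],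
    fun t _ _ φ g => rfl,
    fun t _ _ ψ g => rfl,
    fun d d' => psi_one (hT₁.trans hT) d d',
    fun d t z ht htT => phi_of_lt hT₁ hT d ht htT z,
    fun d z => phi_last hT₁ hT d z,
    fun d t ht htT => psi_succ_eq_obsUpdate hT₁ hT d ht htT,
    fun d t ht htT => isGLB_toGo₁ hT₁ hT hc₂ hJ₀ hJ₁ d ht htT,
    fun d t ht htT => isGLB_toGo₂ hT₁ hT hc₂ hJ₀ hJ₁ d ht htT,
    fun d => integrable_totalCost hT₁ (hT₁.trans hT) d,
    fun d => isGLB_cost hT₁ hT hc₂ hJ₀ hJ₁ d,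
    fun n t => M.exists_isWaldThr hc₂ hJ₀ hJ₁ n t,
    fun d d' h₁ hl h₂ hw => by
      rw [cost_eq_toGo₁ hT₁ (hT₁.trans hT), cost_eq_toGo₁ hT₁ (hT₁.trans hT)]
      exact add_le_add le_rfl (toGo₁_le_of_usesWald hT₁ hT hc₂ h₁ hl h₂ hw le_rfl hT₁),
    fun d hw => optimal_iff hT₁ hT hc₂ hJ₀ hJ₁ hw⟩
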